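/- Let $V$ be a simple vertex algebra over $\mathbb C$ of countable dimension and let $G$ be a finite subgroup of $\operatorname{Aut}V$, with fixed point subalgebra $V^G$. For $g\in\operatorname{Aut}V$ of finite order, $g$-twisted weak $V$-modules are twisted modules without any grading, where for $ga=e^{-2\pi\sqrt{-1}\,r/|g|}a$ only the modes $a_n$ with $n\in r/|g|+\mathbb Z$ of $Y_M(a,x)=\sum_n a_nx^{-n-1}$ occur; a homomorphism between twisted weak modules (for possibly different automorphisms) is a linear map commuting with all modes $a_n$, $a\in V$, $n\in\mathbb Q$. For a twisted weak module $M$ and $\sigma\in G$ let $M\cdot\sigma$ be the space $M$ with $Y_{M\cdot\sigma}(a,x)=Y_M(\sigma a,x)$. Let $\mathcal S$ be a finite set of pairwise inequivalent irreducible twisted weak $V$-modules, each of them $g$-twisted for some $g\in G$ (which may depend on the module), and suppose that $\mathcal S$ is $G$-stable: for $M\in\mathcal S$ and $\sigma\in G$, $M\cdot\sigma$ is isomorphic to a member of $\mathcal S$. We identify $M\cdot\sigma$ with this member, so that $G$ acts on $\mathcal S$ from the right. Put $\mathcal M=\bigoplus_{M\in\mathcal S}M$. For $\sigma\in G$ and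 $M\in\mathcal S$ choose a linear isomorphism $\phi(\sigma,M):M\to M\cdot\sigma^{-1}$ with $\phi(\sigma,M)Y_M(a,x)=Y_{M\cdot\sigma^{-1}}(\sigma a,x)\phi(\sigma,M)$ for all $a \in V$ (here $Y_{M\cdot\sigma^{-1}}$ is the vertex operator map of the member of $\mathcal S$), and let $\alpha_M(\sigma,\tau)\in\mathbb C^\times$ be the scalar with $\phi(\sigma,M\cdot\tau^{-1})\phi(\tau,M)=\alpha_M(\sigma,\tau)\phi(\sigma\tau,M)$. Let $\mathcal A=\mathcal A_\alpha(G,\mathcal S)$ be the associative algebra with basis $\sigma\otimes e(M)$ ($\sigma\in G$, $M\in\mathcal S$) and product $$(\sigma\otimes e(M))(\tau\otimes e(N))=\begin{cases}\alpha_N(\sigma,\tau)\,\sigma\tau\otimes e(N)&\text{if }M\cdot\tau=N,\\0&\text{otherwise;}\end{cases}$$ it acts on $\mathcal M$, where $\sigma\otimes e(M)$ acts as $\phi(\sigma,M)$ on $M$ and as $0$ on the other summands. Let $(\mathcal O_j)_{j\in J}$ be the $G$-orbits in $\mathcal S$, choose $M^j\in\mathcal O_j$, let $G_j=\{\sigma\in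 G: M^j\cdot\sigma\cong M^j\}$ and let $\mathbb C^{\alpha_j}[G_j]$ be the twisted group algebra for $\alpha_j=\alpha_{M^j}|_{G_j\times G_j}$; it is identified with $\operatorname{Span}\{\sigma\otimes e(M^j):\sigma\in G_j\}\subset\mathcal A$ and acts on $M^j$. Let $(W_{j,\lambda})_{\lambda\in\Lambda_j}$ be representatives of the isomorphism classes of irreducible $\mathbb C^{\alpha_j}[G_j]$-modules. Put $D(M^j)=\operatorname{Span}\{\sigma\otimes e(M^j):\sigma\in G\}$ and $$W^j_\lambda=D(M^j)\otimes_{\mathbb C^{\alpha_j}[G_j]}W_{j,\lambda},\qquad M^j_\lambda=\operatorname{Hom}_{\mathbb C^{\alpha_j}[G_j]}(W_{j,\lambda},M^j),$$ on which $V^G$ acts by $(a_nf)(w)=a_n(f(w))$. Then the $W^j_\lambda$ ($j\in J$, $\lambda\in\Lambda_j$) form a complete set of representatives of the isomorphism classes of irreducible $\mathcal A$-modules, and under the action of $\mathcal A\otimes_{\mathbb C}V^G$ the space $\mathcal M$ decomposes as $$\mathcal M\cong\bigoplus_{j\in J,\ \lambda\in\Lambda_j}W^j_\lambda\otimes_{\mathbb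 C}M^j_\lambda .$$ Moreover: 1. for all $j\in J$ and $\lambda\in\Lambda_j$, $M^j_\lambda$ is nonzero and is an irreducible weak $V^G$-module; 2. for $j_1,j_2\in J$, $\lambda_1\in\Lambda_{j_1}$, $\lambda_2\in\Lambda_{j_2}$, the weak $V^G$-modules $M^{j_1}_{\lambda_1}$ and $M^{j_2}_{\lambda_2}$ are isomorphic if and only if $(j_1,\lambda_1)=(j_2,\lambda_2)$. In particular, for every $g\in G$, every irreducible $g$-twisted weak $V$-module is a completely reducible weak $V^G$-module. -/

import Mathlib

/-!
Vertex algebras over `ℂ`, their twisted weak modules, and the twisted algebra of a finite set with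
a group action and a `2`-cocycle.  The mode `a_n` of a vertex operator `Y(a, x) = ∑ a_n x^{-n-1}`
is `mode n a`.
-/

universe u v w u₁

noncomputable section

open scoped DirectSum TensorProduct

namespace SchurWeyl

/-! ### Vertex algebras -/

/-- A vertex algebra over `ℂ`: the products `a_n b = mode n a b` (`n : ℤ`) and the vacuum vector
satisfy truncation, the vacuum and creation properties, and the Borcherds (Jacobi) identity. All
sums are finite by truncation. -/
class VertexAlgebra (V : Type u) [AddCommGroup V] [Module ℂ V] where
  mode : ℤ → V →ₗ[ℂ] V →ₗ[ℂ] V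
  vac : V
  trunc : ∀ a b : V, ∃ N : ℤ, ∀ n : ℤ, N ≤ n → mode n a b = 0
  vac_mode : ∀ (n : ℤ) (b : V), mode n vac b = if n = -1 then b else 0
  mode_vac : ∀ (n : ℤ) (a : V), 0 ≤ n → mode n a vac = 0
  creation : ∀ a : V, mode (-1) a vac = a
  borcherds : ∀ (a b c : V) (l m n : ℤ),
    ∑ᶠ i : ℕ, ((Ring.choose m i : ℤ) : ℂ) • mode (m + n - i) (mode (l + i) a b) c =
    ∑ᶠ i : ℕ, ((-1 : ℂ) ^ i * ((Ring.choose l i : ℤ) : ℂ)) •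
      (mode (l + m - i) a (mode (n + i) b c) -
        (-1 : ℂ) ^ l • mode (l + n - i) b (mode (m + i) a c))

namespace VertexAlgebra

variable (V : Type u) [AddCommGroup V] [Module ℂ V] [VertexAlgebra V]

/-- The group of automorphisms: linear automorphisms that fix the vacuum and preserve all
products. -/
def Aut : Subgroup (V ≃ₗ[ℂ] V) where
  carrier := {f | f vac = vac ∧ ∀ (n : ℤ) (a b : V), f (mode n a b) = mode n (f a) (f b)}
  mul_mem' := by
    rintro f g ⟨hf, hf'⟩ ⟨hg, hg'⟩
    exact ⟨by simp [hg, hf], fun n a b => by simp [hg', hf']⟩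
  one_mem' := ⟨rfl, fun _ _ _ => rfl⟩
  inv_mem' := by
    rintro f ⟨hf, hf'⟩
    refine ⟨f.injective ?_, fun n a b => f.injective ?_⟩
    · rw [hf]; exact f.apply_symm_apply _
    · rw [hf']
      exact (f.apply_symm_apply _).trans
        (congrArg₂ (fun x y => mode n x y) (f.apply_symm_apply a).symm (f.apply_symm_apply b).symm)

/-- A (two-sided) ideal of a vertex algebra. -/
def IsIdeal (I : Submodule ℂ V) : Prop :=
  ∀ (n : ℤ) (a b : V), b ∈ I → mode n a b ∈ I ∧ mode n b a ∈ I

/-- A vertex algebra is simple if it is nonzero and has no ideals except `0` and itself. -/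
def IsSimple : Prop :=
  Nontrivial V ∧ ∀ I : Submodule ℂ V, IsIdeal V I → I = ⊥ ∨ I = ⊤

variable {V}

/-- The space `V^G` of fixed points. -/
def fixedPoints (G : Subgroup (Aut V)) : Submodule ℂ V where
  carrier := {a | ∀ σ : G, σ • a = a}
  add_mem' ha hb σ := by rw [smul_add, ha σ, hb σ]
  zero_mem' σ := smul_zero σ
  smul_mem' c a ha σ := by
    have := ha σ
    exact (map_smul ((σ : Aut V) : V ≃ₗ[ℂ] V) c a).trans (congrArg _ this)

theorem smul_mode (σ : Aut V) (n : ℤ) (a b : V) : σ • mode n a b = mode n (σ • a) (σ • b) :=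
  σ.2.2 n a b

theorem smul_vac (σ : Aut V) : σ • (vac : V) = vac := σ.2.1

theorem mode_mem_fixedPoints (G : Subgroup (Aut V)) (n : ℤ) {a b : V} (ha : a ∈ fixedPoints G)
    (hb : b ∈ fixedPoints G) : mode n a b ∈ fixedPoints G := fun σ => by
  have h1 : (σ : Aut V) • a = a := ha σ
  have h2 : (σ : Aut V) • b = b := hb σ
  change (σ : Aut V) • mode n a b = mode n a b
  rw [smul_mode, h1, h2]

/-- The products of `V` restricted to `V^G`. -/
def fixedMode (G : Subgroup (Aut V)) (n : ℤ) :
    fixedPoints G →ₗ[ℂ] fixedPoints G →ₗ[ℂ] fixedPoints G :=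
  LinearMap.mk₂ ℂ (fun a b => ⟨mode n a.1 b.1, mode_mem_fixedPoints G n a.2 b.2⟩)
    (fun _ _ _ => Subtype.ext (by simp)) (fun _ _ _ => Subtype.ext (by simp))
    (fun _ _ _ => Subtype.ext (by simp)) (fun _ _ _ => Subtype.ext (by simp))

theorem coe_fixedMode (G : Subgroup (Aut V)) (n : ℤ) (a b : fixedPoints G) :
    (fixedMode G n a b : V) = mode n (a : V) (b : V) := rfl

/-- The fixed point subalgebra `V^G`. -/
instance fixedPointAlgebra (G : Subgroup (Aut V)) : VertexAlgebra (fixedPoints G) where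
  mode := fixedMode G
  vac := ⟨vac, fun σ => smul_vac (σ : Aut V)⟩
  trunc a b := by
    obtain ⟨N, hN⟩ := trunc (a : V) (b : V)
    exact ⟨N, fun n hn => Subtype.ext (hN n hn)⟩
  vac_mode n b := Subtype.ext (by
    rw [coe_fixedMode, vac_mode]; split_ifs <;> rfl)
  mode_vac n a hn := Subtype.ext (mode_vac n (a : V) hn)
  creation a := Subtype.ext (creation (a : V))
  borcherds a b c l m n := by
    apply (fixedPoints G).injective_subtype
    have key : ∀ f : ℕ → fixedPoints G, (fixedPoints G).subtype (∑ᶠ i, f i) =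
        ∑ᶠ i, ((f i : fixedPoints G) : V) := fun f =>
      (fixedPoints G).subtype.toAddMonoidHom.map_finsum_of_injective
        (fixedPoints G).injective_subtype f
    rw [key, key]
    exact borcherds (a : V) (b : V) (c : V) l m n

end VertexAlgebra

open VertexAlgebra

/-! ### Families of modes, homomorphisms, submodules -/

/-- A family of operators `a_n` (`n : Γ`) on `M`, linear in `a : V`. -/
abbrev ModeFamily (Γ : Type*) (V : Type u) [AddCommGroup V] [Module ℂ V] (M : Type v)
    [AddCommGroup M] [Module ℂ M] :=
  Γ → V →ₗ[ℂ] M →ₗ[ℂ] M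

section ModeFamily

variable {Γ : Type*} {V : Type u} [AddCommGroup V] [Module ℂ V]
  {M : Type v} [AddCommGroup M] [Module ℂ M] {M' : Type w} [AddCommGroup M'] [Module ℂ M']

/-- A subspace stable under all modes, that is, a submodule. -/
def IsInvariant (Y : ModeFamily Γ V M) (N : Submodule ℂ M) : Prop :=
  ∀ (n : Γ) (a : V), ∀ x ∈ N, Y n a x ∈ N

/-- `M` is nonzero and has no submodule except `0` and `M`. -/
def IsIrreducibleModule (Y : ModeFamily Γ V M) : Prop :=
  Nontrivial M ∧ ∀ N : Submodule ℂ M, IsInvariant Y N → N = ⊥ ∨ N = ⊤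

/-- `N` is an irreducible submodule of `M`. -/
def IsIrreducibleSubmodule (Y : ModeFamily Γ V M) (N : Submodule ℂ M) : Prop :=
  IsInvariant Y N ∧ N ≠ ⊥ ∧ ∀ N' : Submodule ℂ M, IsInvariant Y N' → N' ≤ N → N' = ⊥ ∨ N' = N

/-- `M` is the direct sum of a set of irreducible submodules. -/
def IsCompletelyReducible (Y : ModeFamily Γ V M) : Prop :=
  ∃ s : Set (Submodule ℂ M), (∀ N ∈ s, IsIrreducibleSubmodule Y N) ∧ sSupIndep s ∧ sSup s = ⊤

/-- `M` and `M'` are isomorphic: there is a linear isomorphism that commutes with all modes. -/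
def Isomorphic (Y : ModeFamily Γ V M) (Y' : ModeFamily Γ V M') : Prop :=
  ∃ e : M ≃ₗ[ℂ] M', ∀ (n : Γ) (a : V) (x : M), e (Y n a x) = Y' n a (e x)

end ModeFamily

/-! ### Weak modules and twisted weak modules -/

/-- `Y` makes `M` a weak `V`-module: truncation, vacuum, and the Jacobi identity in the form of
the Borcherds identity. -/
structure IsWeakModule {V : Type u} [AddCommGroup V] [Module ℂ V] [VertexAlgebra V] {M : Type v}
    [AddCommGroup M] [Module ℂ M] (Y : ModeFamily ℤ V M) : Prop where
  trunc : ∀ (a : V) (x : M), ∃ N : ℤ, ∀ n : ℤ, N ≤ n → Y n a x = 0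
  vac : ∀ (n : ℤ) (x : M), Y n vac x = if n = -1 then x else 0
  borcherds : ∀ (a b : V) (x : M) (l m n : ℤ),
    ∑ᶠ i : ℕ, ((Ring.choose m i : ℤ) : ℂ) • Y (m + n - i) (mode (l + i) a b) x =
    ∑ᶠ i : ℕ, ((-1 : ℂ) ^ i * ((Ring.choose l i : ℤ) : ℂ)) •
      (Y (l + m - i) a (Y (n + i) b x) - (-1 : ℂ) ^ l • Y (l + n - i) b (Y (m + i) a x))

/-- The eigenspace `V^{(g, r)} = {a | g a = e^{-2 π i r / T} a}`, where `T` is the order of `g`. -/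
def twistedSector {V : Type u} [AddCommGroup V] [Module ℂ V] [VertexAlgebra V] (g : Aut V)
    (r : ℕ) : Set V :=
  {a | g • a = Complex.exp (-2 * Real.pi * Complex.I * r / orderOf g) • a}

/-- For `g` of finite order `T`, `Y` makes `M` a `g`-twisted weak `V`-module: for `a ∈ V^{(g, r)}`
only the modes `a_n` with `n ∈ r / T + ℤ` occur, and truncation, the vacuum property and the
twisted Jacobi identity (in the form of the twisted Borcherds identity) hold.  Modes are indexed
by `ℚ`; as `V` is the sum of the `V^{(g, r)}`, those outside `(1 / T) ℤ` are zero. -/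
structure IsTwistedModule {V : Type u} [AddCommGroup V] [Module ℂ V] [VertexAlgebra V] (g : Aut V)
    {M : Type v} [AddCommGroup M] [Module ℂ M] (Y : ModeFamily ℚ V M) : Prop where
  support : ∀ r : ℕ, r < orderOf g → ∀ a ∈ twistedSector g r, ∀ n : ℚ,
    (¬ ∃ k : ℤ, n = (r : ℚ) / orderOf g + k) → Y n a = 0
  trunc : ∀ (a : V) (x : M), ∃ N : ℚ, ∀ n : ℚ, N ≤ n → Y n a x = 0
  vac : ∀ (n : ℚ) (x : M), Y n vac x = if n = -1 then x else 0
  borcherds : ∀ r : ℕ, r < orderOf g → ∀ a ∈ twistedSector g r, ∀ (b : V) (x : M) (l : ℤ)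
    (m n : ℚ), (∃ k : ℤ, m = (r : ℚ) / orderOf g + k) →
    ∑ᶠ i : ℕ, ((Ring.choose m i : ℚ) : ℂ) • Y (m + n - i) (mode (l + i) a b) x =
    ∑ᶠ i : ℕ, ((-1 : ℂ) ^ i * ((Ring.choose l i : ℤ) : ℂ)) •
      (Y (l + m - i) a (Y (n + i) b x) - (-1 : ℂ) ^ l • Y (l + n - i) b (Y (m + i) a x))

section Constructions

variable {V : Type u} [AddCommGroup V] [Module ℂ V] [VertexAlgebra V]
  {M : Type v} [AddCommGroup M] [Module ℂ M]

/-- The modes of `V^G` on a twisted weak `V`-module: the integral modes of the elements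
of `V^G`. -/
def restrictFixed (G : Subgroup (Aut V)) (Y : ModeFamily ℚ V M) :
    ModeFamily ℤ (fixedPoints G) M :=
  fun n => (Y (n : ℚ)) ∘ₗ (fixedPoints G).subtype

/-- `M · σ`: the space `M` with `Y_{M · σ}(a, x) = Y_M(σ a, x)`. -/
def twistBy (σ : Aut V) (Y : ModeFamily ℚ V M) : ModeFamily ℚ V M :=
  fun n => (Y n) ∘ₗ ((σ : V ≃ₗ[ℂ] V) : V →ₗ[ℂ] V)

end Constructions

/-! ### The algebra of a finite `G`-set and a `2`-cocycle -/

/-- A `2`-cocycle `α : G × G → U(ℂ X)`, `α(σ, τ) = ∑ α_x(σ, τ) e(x)`. The left action used here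
is `σ • x = x · σ⁻¹` in terms of a right action. -/
structure Cocycle (G : Type u) (X : Type w) [Group G] [MulAction G X] where
  toFun : X → G → G → ℂˣ
  cocycle : ∀ (x : X) (σ τ ρ : G),
    toFun (ρ • x) σ τ * toFun x (σ * τ) ρ = toFun x σ (τ * ρ) * toFun x τ ρ

/-- The vector space `ℂ[G] ⊗ ℂ X` underlying the algebra `A_α(G, X)`, as the space with basis
`G × X`. -/
def TwistedAlgebra {G : Type u} {X : Type w} [Group G] [MulAction G X] (_α : Cocycle G X) :
    Type (max u w) :=
  G × X →₀ ℂ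

namespace TwistedAlgebra

variable {G : Type u} {X : Type w} [Group G] [MulAction G X] (α : Cocycle G X)

instance : AddCommGroup (TwistedAlgebra α) := inferInstanceAs (AddCommGroup (G × X →₀ ℂ))

instance : Module ℂ (TwistedAlgebra α) := inferInstanceAs (Module ℂ (G × X →₀ ℂ))

/-- The basis of the elements `σ ⊗ e(x)`. -/
def basis : Module.Basis (G × X) ℂ (TwistedAlgebra α) := Module.Basis.ofRepr (LinearEquiv.refl ℂ _)

open Classical in
/-- The multiplication: `(σ ⊗ e(x)) (τ ⊗ e(y)) = α_y(σ, τ) στ ⊗ e(x · τ) e(y)`, which is nonzero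
only if `x = y · τ⁻¹`. -/
def mulLin : TwistedAlgebra α →ₗ[ℂ] TwistedAlgebra α →ₗ[ℂ] TwistedAlgebra α :=
  (basis α).constr ℂ fun p => (basis α).constr ℂ fun q =>
    if p.2 = q.1 • q.2 then (α.toFun q.2 p.1 q.1 : ℂ) • basis α (p.1 * q.1, q.2) else 0

/-- The identity element `∑ α_x(1, 1)⁻¹ 1 ⊗ e(x)`. -/
def one [Fintype X] : TwistedAlgebra α :=
  ∑ x : X, ((α.toFun x 1 1)⁻¹ : ℂˣ).val • basis α (1, x)

open Classical in
theorem mulLin_basis (p q : G × X) : mulLin α (basis α p) (basis α q) =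
    if p.2 = q.1 • q.2 then (α.toFun q.2 p.1 q.1 : ℂ) • basis α (p.1 * q.1, q.2) else 0 := by
  rw [mulLin, Module.Basis.constr_basis, Module.Basis.constr_basis]

theorem induction {P : TwistedAlgebra α → Prop} (a : TwistedAlgebra α)
    (hb : ∀ p, P (basis α p)) (h0 : P 0) (hadd : ∀ a b, P a → P b → P (a + b))
    (hsmul : ∀ (c : ℂ) a, P a → P (c • a)) : P a := by
  have ha : a ∈ Submodule.span ℂ (Set.range (basis α)) := by
    rw [(basis α).span_eq]; trivial
  induction ha using Submodule.span_induction with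
  | mem x hx => obtain ⟨p, rfl⟩ := hx; exact hb p
  | zero => exact h0
  | add x y _ _ hx hy => exact hadd x y hx hy
  | smul c x _ hx => exact hsmul c x hx

theorem mulLin_assoc (a b c : TwistedAlgebra α) :
    mulLin α (mulLin α a b) c = mulLin α a (mulLin α b c) := by
  classical
  induction a using induction with
  | h0 => simp
  | hadd a a' h h' => simp [h, h']
  | hsmul t a h => simp [h]
  | hb p =>
  induction b using induction with
  | h0 => simp
  | hadd a a' h h' => simp [h, h']
  | hsmul t a h => simp [h]
  | hb q =>
  induction c using induction with
  | h0 => simp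
  | hadd a a' h h' => simp [h, h']
  | hsmul t a h => simp [h]
  | hb r =>
  obtain ⟨σ, x⟩ := p
  obtain ⟨τ, y⟩ := q
  obtain ⟨ρ, z⟩ := r
  simp only [mulLin_basis]
  by_cases h1 : y = ρ • z
  · subst h1
    by_cases h2 : x = τ • ρ • z
    · subst h2
      have h := congrArg Units.val (α.cocycle z σ τ ρ)
      simp only [Units.val_mul] at h
      have h2 : (τ * ρ) • z = τ • ρ • z := mul_smul τ ρ z
      simp only [if_true, map_smul, LinearMap.smul_apply, mulLin_basis, h2, mul_assoc]
      rw [smul_smul, smul_smul]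
      congr 1
      linear_combination h
    · simp [h2, mulLin_basis, mul_smul]
  · by_cases h2 : x = τ • y
    · simp [h1, h2, mulLin_basis]
    · simp [h1, h2]

theorem cocycle_one_left (x : X) (ρ : G) : α.toFun (ρ • x) 1 1 = α.toFun x 1 ρ := by
  have h := α.cocycle x 1 1 ρ
  simpa using h

theorem cocycle_one_right (x : X) (σ : G) : α.toFun x σ 1 = α.toFun x 1 1 := by
  have h := α.cocycle x σ 1 1
  simpa using h

theorem one_mulLin [Fintype X] (a : TwistedAlgebra α) : mulLin α (one α) a = a := by
  classical
  induction a using induction with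
  | h0 => simp
  | hadd a a' h h' => simp [h, h']
  | hsmul t a h => simp [h]
  | hb p =>
  obtain ⟨σ, x⟩ := p
  simp [one, mulLin_basis, LinearMap.sum_apply, cocycle_one_left, smul_smul]

theorem mulLin_one [Fintype X] (a : TwistedAlgebra α) : mulLin α a (one α) = a := by
  classical
  induction a using induction with
  | h0 => simp
  | hadd a a' h h' => simp [h, h']
  | hsmul t a h => simp [h]
  | hb p =>
  obtain ⟨σ, x⟩ := p
  simp [one, mulLin_basis, cocycle_one_right, smul_smul]

instance [Fintype X] : Ring (TwistedAlgebra α) where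
  __ := (inferInstance : AddCommGroup (TwistedAlgebra α))
  mul a b := mulLin α a b
  one := one α
  left_distrib a b c := map_add (mulLin α a) b c
  right_distrib a b c := LinearMap.map_add₂ (mulLin α) a b c
  zero_mul a := LinearMap.map_zero₂ (mulLin α) a
  mul_zero a := map_zero (mulLin α a)
  mul_assoc := mulLin_assoc α
  one_mul := one_mulLin α
  mul_one := mulLin_one α

theorem mul_def [Fintype X] (a b : TwistedAlgebra α) : a * b = mulLin α a b := rfl

instance [Fintype X] : Algebra ℂ (TwistedAlgebra α) :=
  Algebra.ofModule (fun c a b => LinearMap.map_smul₂ (mulLin α) c a b)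
    (fun c a b => map_smul (mulLin α a) c b)

/-- The restriction of a `2`-cocycle to the stabilizer of `x`; the algebra defined by it
is the twisted group algebra `ℂ^{α_x}[G_x]`. -/
def _root_.SchurWeyl.Cocycle.restrict (x : X) : Cocycle (MulAction.stabilizer G x) PUnit.{1} where
  toFun _ σ τ := α.toFun x σ τ
  cocycle _ σ τ ρ := by
    have h := α.cocycle x σ τ ρ
    rwa [(MulAction.mem_stabilizer_iff.mp ρ.2 : (ρ : G) • x = x)] at h

/-- The twisted group algebra `S(x) = ℂ^{α_x}[G_x]`. -/
abbrev StabAlgebra (x : X) := TwistedAlgebra (α.restrict x)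

/-- The embedding of `S(x)` in `A_α(G, X)`: it maps the basis element `σ` to `σ ⊗ e(x)`. -/
def stabInclusion (x : X) : StabAlgebra α x →ₗ[ℂ] TwistedAlgebra α :=
  (basis (α.restrict x)).constr ℂ fun p => basis α ((p.1 : G), x)

/-- `D(x)`, the span of the elements `σ ⊗ e(x)`, `σ ∈ G`, as a left ideal. -/
def leftIdeal [Fintype X] (x : X) : Submodule (TwistedAlgebra α) (TwistedAlgebra α) :=
  { Submodule.span ℂ (Set.range fun σ : G => basis α (σ, x)) with
    smul_mem' := by
      classical
      intro a d hd
      change mulLin α a d ∈ Submodule.span ℂ (Set.range fun σ : G => basis α (σ, x))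
      induction hd using Submodule.span_induction with
      | zero => simp
      | add y z _ _ hy hz => rw [map_add]; exact add_mem hy hz
      | smul c y _ hy => rw [map_smul]; exact Submodule.smul_mem _ _ hy
      | mem y hy =>
        obtain ⟨τ, rfl⟩ := hy
        induction a using induction with
        | h0 => simp
        | hadd a a' h h' => rw [LinearMap.map_add₂]; exact add_mem h h'
        | hsmul t a h => rw [LinearMap.map_smul₂]; exact Submodule.smul_mem _ _ h
        | hb p =>
          simp only [mulLin_basis]
          split_ifs
          · exact Submodule.smul_mem _ _ (Submodule.subset_span ⟨_, rfl⟩)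
          · exact zero_mem _ }

theorem stabInclusion_mem [Fintype X] (x : X) (s : StabAlgebra α x) :
    stabInclusion α x s ∈ leftIdeal α x := by
  change _ ∈ Submodule.span ℂ (Set.range fun σ : G => basis α (σ, x))
  induction s using induction with
  | h0 => simp
  | hadd a a' h h' => rw [map_add]; exact add_mem h h'
  | hsmul t a h => rw [map_smul]; exact Submodule.smul_mem _ _ h
  | hb p =>
    rw [stabInclusion, Module.Basis.constr_basis]
    exact Submodule.subset_span ⟨_, rfl⟩

/-- The right action of `S(x)` on `D(x)`, by multiplication in `A_α(G, X)`. -/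
def rightMul [Fintype X] (x : X) (d : leftIdeal α x) (s : StabAlgebra α x) : leftIdeal α x :=
  ⟨(d : TwistedAlgebra α) * stabInclusion α x s,
    (leftIdeal α x).smul_mem (d : TwistedAlgebra α) (stabInclusion_mem α x s)⟩

section Induced

variable [Fintype X] (x : X) (W : Type u₁) [AddCommGroup W] [Module ℂ W]
  [Module (StabAlgebra α x) W]

/-- The relations `d s ⊗ w = d ⊗ s w` in `D(x) ⊗_ℂ W`. -/
def inducedRel : Submodule (TwistedAlgebra α) (leftIdeal α x ⊗[ℂ] W) :=
  Submodule.span (TwistedAlgebra α) {t | ∃ (d : leftIdeal α x) (s : StabAlgebra α x) (w : W),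
    t = rightMul α x d s ⊗ₜ[ℂ] w - d ⊗ₜ[ℂ] (s • w)}

/-- The induced module `D(x) ⊗_{S(x)} W`, a left module over `A_α(G, X)`. -/
abbrev Induced := (leftIdeal α x ⊗[ℂ] W) ⧸ inducedRel α x W

end Induced

end TwistedAlgebra

/-- `(W_k)` is a complete set of representatives of the isomorphism classes of irreducible
`R`-modules (every irreducible `R`-module is isomorphic to a quotient of `R`, hence to one in the
universe of `R`). -/
structure IsCompleteIrreducible (R : Type u) [Ring R] {K : Type w} (W : K → Type v)
    [∀ k, AddCommGroup (W k)] [∀ k, Module R (W k)] : Prop where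
  simple : ∀ k, IsSimpleModule R (W k)
  inequivalent : ∀ k l, Nonempty (W k ≃ₗ[R] W l) → k = l
  complete : ∀ (N : Type u) [AddCommGroup N] [Module R N], IsSimpleModule R N →
    ∃ k, Nonempty (N ≃ₗ[R] W k)

/-! ### Schur's lemma in countable dimension -/

section Schur

variable {Γ : Type} [Countable Γ] {V : Type u} [AddCommGroup V] [Module ℂ V]
  {M : Type v} [AddCommGroup M] [Module ℂ M]

theorem IsIrreducibleModule.exists_countable_span (hV : Module.rank ℂ V ≤ Cardinal.aleph0)
    {Y : ModeFamily Γ V M} (hY : IsIrreducibleModule Y) :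
    ∃ s : Set M, s.Countable ∧ Submodule.span ℂ s = ⊤ := by
  obtain ⟨hM, hsub⟩ := hY
  obtain ⟨u, hu⟩ := exists_ne (0 : M)
  let b := Module.Basis.ofVectorSpace ℂ V
  have hc : Countable (Module.Basis.ofVectorSpaceIndex ℂ V) := by
    rw [← Cardinal.mk_le_aleph0_iff]
    exact b.mk_eq_rank''.trans_le hV
  let f : List (Γ × Module.Basis.ofVectorSpaceIndex ℂ V) → M :=
    fun l => l.foldr (fun p x => Y p.1 (b p.2) x) u
  refine ⟨Set.range f, Set.countable_range f, ?_⟩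
  refine (hsub (Submodule.span ℂ (Set.range f)) ?_).resolve_left fun h =>
    hu ((Submodule.span_eq_bot.mp h) u ⟨[], rfl⟩)
  · intro n a x hx
    induction hx using Submodule.span_induction with
    | zero => simp
    | add y z _ _ hy hz => rw [map_add]; exact add_mem hy hz
    | smul c y _ hy => rw [map_smul]; exact Submodule.smul_mem _ _ hy
    | mem y hy =>
      obtain ⟨l, rfl⟩ := hy
      have ha : a ∈ Submodule.span ℂ (Set.range b) := by rw [b.span_eq]; trivial
      induction ha using Submodule.span_induction with
      | zero => simp
      | add y z _ _ hy hz => rw [LinearMap.map_add₂]; exact add_mem hy hz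
      | smul c y _ hy => rw [LinearMap.map_smul₂]; exact Submodule.smul_mem _ _ hy
      | mem y hy =>
        obtain ⟨i, rfl⟩ := hy
        exact Submodule.subset_span ⟨(n, i) :: l, rfl⟩

open Polynomial in
theorem IsIrreducibleModule.schur (hV : Module.rank ℂ V ≤ Cardinal.aleph0)
    {Y : ModeFamily Γ V M} (hY : IsIrreducibleModule Y) (T : Module.End ℂ M)
    (hT : ∀ n a x, T (Y n a x) = Y n a (T x)) : ∃ c : ℂ, ∀ x, T x = c • x := by
  classical
  obtain ⟨s, hs, hspan⟩ := hY.exists_countable_span hV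
  obtain ⟨hM, hsub⟩ := hY
  by_contra hcon
  push Not at hcon
  have hinj : ∀ c : ℂ, Function.Injective (T - algebraMap ℂ (Module.End ℂ M) c : Module.End ℂ M) := fun c => by
    rw [← LinearMap.ker_eq_bot]
    refine (hsub (LinearMap.ker (T - algebraMap ℂ (Module.End ℂ M) c)) ?_).resolve_right ?_
    · intro n a x hx
      simp only [LinearMap.mem_ker, LinearMap.sub_apply, Module.algebraMap_end_apply] at hx ⊢
      rw [hT, ← map_smul, ← map_sub, hx, map_zero]
    · intro h
      obtain ⟨x, hx⟩ := hcon c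
      have : x ∈ LinearMap.ker (T - algebraMap ℂ (Module.End ℂ M) c) := by rw [h]; trivial
      simp only [LinearMap.mem_ker, LinearMap.sub_apply, Module.algebraMap_end_apply,
        sub_eq_zero] at this
      exact hx this
  have hsurj : ∀ c : ℂ, Function.Surjective (T - algebraMap ℂ (Module.End ℂ M) c : Module.End ℂ M) := fun c => by
    rw [← LinearMap.range_eq_top]
    refine (hsub (LinearMap.range (T - algebraMap ℂ (Module.End ℂ M) c)) ?_).resolve_left ?_
    · rintro n a _ ⟨x, rfl⟩
      refine ⟨Y n a x, ?_⟩
      simp only [LinearMap.sub_apply, Module.algebraMap_end_apply, hT, map_sub, map_smul]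
    · intro h
      obtain ⟨x, hx⟩ := exists_ne (0 : M)
      rw [LinearMap.range_eq_bot] at h
      exact hx (hinj c (by rw [h]; rfl))
  have hpoly : ∀ p : ℂ[X], p ≠ 0 → Function.Injective (aeval T p) := fun p hp => by
    have hprod : ∀ t : Multiset ℂ,
        Function.Injective (aeval T (t.map fun a => X - C a).prod) := fun t => by
      induction t using Multiset.induction_on with
      | empty =>
        rw [Multiset.map_zero, Multiset.prod_zero, map_one]
        exact fun _ _ h => h
      | cons a t ih =>
        rw [Multiset.map_cons, Multiset.prod_cons, map_mul, Module.End.mul_eq_comp,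
          LinearMap.coe_comp, map_sub, aeval_X, aeval_C]
        exact (hinj a).comp ih
    have hlc : p.leadingCoeff ≠ 0 := leadingCoeff_ne_zero.mpr hp
    rw [(IsAlgClosed.splits p).eq_prod_roots, map_mul, aeval_C, Module.End.mul_eq_comp,
      LinearMap.coe_comp]
    refine Function.Injective.comp (fun x y hxy => ?_) (hprod _)
    simpa [Module.algebraMap_end_apply, hlc] using hxy
  obtain ⟨u, hu⟩ := exists_ne (0 : M)
  choose g hg using fun c => hsurj c u
  have hli : LinearIndependent ℂ g := by
    rw [linearIndependent_iff']
    intro t m hm i hi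
    by_contra hmi
    let p : ℂ[X] := ∑ c ∈ t, C (m c) * ∏ d ∈ t.erase c, (X - C d)
    have hp : p ≠ 0 := by
      intro h
      have h' := congrArg (eval i) h
      simp only [p, eval_finsetSum, eval_mul, eval_C, eval_prod, eval_sub, eval_X, eval_zero] at h'
      rw [Finset.sum_eq_single_of_mem i hi] at h'
      · refine (mul_ne_zero hmi (Finset.prod_ne_zero_iff.2 fun j hj => ?_)) h'
        exact sub_ne_zero.2 (Finset.ne_of_mem_erase hj).symm
      · intro j hj hji
        rw [Finset.prod_eq_zero (Finset.mem_erase.2 ⟨hji.symm, hi⟩) (sub_self i), mul_zero]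
    have h0 : aeval T p u = 0 := by
      have h1 : aeval T p u = aeval T (∏ d ∈ t, (X - C d)) (∑ c ∈ t, m c • g c) := by
        rw [map_sum]
        simp only [map_sum, LinearMap.sum_apply]
        refine Finset.sum_congr rfl fun c hc => ?_
        rw [← Finset.prod_erase_mul t _ hc, map_mul, map_mul, Module.End.mul_apply,
          Module.End.mul_apply, aeval_C, map_sub, aeval_X, aeval_C, map_smul, hg,
          Module.algebraMap_end_apply, map_smul]
      rw [h1, hm, map_zero]
    exact hu (hpoly p hp (by rw [h0, map_zero]))
  have hrank := hli.cardinal_lift_le_rank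
  have hle : Module.rank ℂ M ≤ Cardinal.aleph0 := by
    rw [← rank_top ℂ M, ← hspan]
    exact (rank_span_le s).trans (Cardinal.mk_le_aleph0_iff.mpr hs.to_subtype)
  have := hrank.trans (Cardinal.lift_le.mpr hle)
  rw [Cardinal.mk_complex, Cardinal.lift_aleph0, Cardinal.lift_continuum] at this
  exact absurd this (not_le.mpr Cardinal.aleph0_lt_continuum)

end Schur

/-! ### Stable sets of irreducible twisted weak modules -/

/-- A finite `G`-stable set `(M_i)` of inequivalent irreducible twisted weak `V`-modules, associated
with possibly different automorphisms in `G`.  It is `G`-stable: for all `i` and all `σ ∈ G`, the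
module `M_i · σ` is isomorphic to some `M_k`. -/
structure StableFamily (V : Type u) [AddCommGroup V] [Module ℂ V] [VertexAlgebra V]
    (G : Subgroup (Aut V)) where
  ι : Type u
  [fintype : Fintype ι]
  M : ι → Type v
  [addCommGroup : ∀ i, AddCommGroup (M i)]
  [module : ∀ i, Module ℂ (M i)]
  Y : ∀ i, ModeFamily ℚ V (M i)
  twisted : ∀ i, ∃ g ∈ G, IsTwistedModule g (Y i)
  irreducible : ∀ i, IsIrreducibleModule (Y i)
  inequivalent : ∀ i k, Isomorphic (Y i) (Y k) → i = k
  stable : ∀ (i : ι) (σ : G), ∃ k, Isomorphic (twistBy (σ : Aut V) (Y i)) (Y k)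

namespace StableFamily

attribute [instance] StableFamily.fintype StableFamily.addCommGroup StableFamily.module

variable {V : Type u} [AddCommGroup V] [Module ℂ V] [VertexAlgebra V] {G : Subgroup (Aut V)}
  (S : StableFamily.{u, v} V G)

instance : DecidableEq S.ι := Classical.decEq _

/-- `e` is a linear isomorphism `M_i → M_k` with `e Y(a, x) = Y(σ a, x) e`, that is, an isomorphism
from `M_i` to `M_k · σ`. -/
def Intertwines (σ : G) (i k : S.ι) (e : S.M i ≃ₗ[ℂ] S.M k) : Prop :=
  ∀ (n : ℚ) (a : V) (x : S.M i), e (S.Y i n a x) = S.Y k n (σ • a) (e x)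

theorem exists_intertwines (σ : G) (i : S.ι) : ∃ k e, S.Intertwines σ i k e := by
  obtain ⟨k, e, he⟩ := S.stable i σ⁻¹
  refine ⟨k, e, fun n a x => ?_⟩
  rw [← he]
  change e (S.Y i n a x) = e (S.Y i n (σ⁻¹ • σ • a) x)
  rw [inv_smul_smul]

variable {S} in
theorem Intertwines.eq {σ : G} {i k k' : S.ι} {e : S.M i ≃ₗ[ℂ] S.M k} {e' : S.M i ≃ₗ[ℂ] S.M k'}
    (he : S.Intertwines σ i k e) (he' : S.Intertwines σ i k' e') : k = k' := by
  refine S.inequivalent k k' ⟨e.symm.trans e', fun n a x => ?_⟩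
  obtain ⟨y, rfl⟩ := e.surjective x
  have h := he n (σ⁻¹ • a) y
  rw [smul_inv_smul] at h
  rw [← h]
  simp only [LinearEquiv.trans_apply, LinearEquiv.symm_apply_apply]
  rw [he', smul_inv_smul]

/-- The left action of `G` on the index set: `σ • i` is the index `k` with `M_k · σ ≅ M_i`. -/
def act (σ : G) (i : S.ι) : S.ι := (S.exists_intertwines σ i).choose

theorem act_eq {σ : G} {i k : S.ι} {e : S.M i ≃ₗ[ℂ] S.M k} (he : S.Intertwines σ i k e) :
    S.act σ i = k :=
  (S.exists_intertwines σ i).choose_spec.choose_spec.eq he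

variable {S} in
theorem Intertwines.trans {σ τ : G} {i k l : S.ι} {e : S.M i ≃ₗ[ℂ] S.M k}
    {f : S.M k ≃ₗ[ℂ] S.M l} (he : S.Intertwines τ i k e) (hf : S.Intertwines σ k l f) :
    S.Intertwines (σ * τ) i l (e.trans f) := fun n a x => by
  rw [LinearEquiv.trans_apply, he, hf, mul_smul, LinearEquiv.trans_apply]

instance : MulAction G S.ι where
  smul := S.act
  one_smul i := S.act_eq (e := LinearEquiv.refl ℂ _) fun n a x => by
    rw [one_smul]; rfl
  mul_smul σ τ i := S.act_eq
    ((S.exists_intertwines τ i).choose_spec.choose_spec.trans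
      (S.exists_intertwines σ (S.act τ i)).choose_spec.choose_spec)

/-- A choice of isomorphisms `φ(σ, M_i) : M_i → M_{σ • i}` with
`φ(σ, M_i) Y(a, x) = Y(σ a, x) φ(σ, M_i)`. -/
structure Intertwiners where
  map : ∀ (σ : G) (i : S.ι), S.M i ≃ₗ[ℂ] S.M (σ • i)
  intertwines : ∀ (σ : G) (i : S.ι), S.Intertwines σ i (σ • i) (map σ i)

/-- The direct sum of the modules of the family. -/
abbrev Total := ⨁ i, S.M i

variable {S} (φ : S.Intertwiners)

/-- The operator `φ(σ, M_i)` on the direct sum: it is `0` on the summands `M_k`, `k ≠ i`. -/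
def op (σ : G) (i : S.ι) : Module.End ℂ S.Total :=
  DirectSum.lof ℂ S.ι S.M (σ • i) ∘ₗ (φ.map σ i).toLinearMap ∘ₗ DirectSum.component ℂ S.ι S.M i

theorem op_apply (σ : G) (i : S.ι) (x : S.Total) :
    op φ σ i x = DirectSum.lof ℂ S.ι S.M (σ • i) (φ.map σ i (x i)) := rfl

theorem op_ne_zero (σ : G) (i : S.ι) : op φ σ i ≠ 0 := fun h => by
  have := (S.irreducible i).1
  obtain ⟨x, hx⟩ := exists_ne (0 : S.M i)
  have h' := congrArg (fun f : Module.End ℂ S.Total =>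
    DirectSum.component ℂ S.ι S.M (σ • i) (f (DirectSum.lof ℂ S.ι S.M i x))) h
  simp only [op_apply, DirectSum.component.lof_self, LinearMap.zero_apply, map_zero] at h'
  have h2 : (DirectSum.lof ℂ S.ι S.M i x) i = x := DirectSum.component.lof_self ℂ i x
  rw [h2] at h'
  exact hx ((φ.map σ i).map_eq_zero_iff.mp h')

theorem Intertwines.exists_scalar (hV : Module.rank ℂ V ≤ Cardinal.aleph0) {σ : G} {i k k' : S.ι}
    {e : S.M i ≃ₗ[ℂ] S.M k} {e' : S.M i ≃ₗ[ℂ] S.M k'}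
    (he : S.Intertwines σ i k e) (he' : S.Intertwines σ i k' e') :
    ∃ c : ℂˣ, ∀ x, DirectSum.lof ℂ S.ι S.M k (e x) =
      (c : ℂ) • DirectSum.lof ℂ S.ι S.M k' (e' x) := by
  obtain rfl := he.eq he'
  obtain ⟨c, hc⟩ := (S.irreducible i).schur hV (e.trans e'.symm).toLinearMap (fun n a x => by
    apply e'.injective
    simp only [LinearEquiv.coe_coe, LinearEquiv.trans_apply, LinearEquiv.apply_symm_apply]
    rw [he, he', LinearEquiv.apply_symm_apply])
  have hc' : ∀ x, e x = c • e' x := fun x => by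
    rw [← map_smul, ← hc x]; simp
  have hc0 : c ≠ 0 := by
    rintro rfl
    have := (S.irreducible i).1
    obtain ⟨x, hx⟩ := exists_ne (0 : S.M i)
    exact hx (e.map_eq_zero_iff.mp (by rw [hc', zero_smul]))
  exact ⟨Units.mk0 c hc0, fun x => by rw [hc', map_smul]; rfl⟩

theorem exists_alpha (hV : Module.rank ℂ V ≤ Cardinal.aleph0) (i : S.ι) (σ τ : G) :
    ∃ c : ℂˣ, op φ σ (τ • i) * op φ τ i = (c : ℂ) • op φ (σ * τ) i := by
  obtain ⟨c, hc⟩ := Intertwines.exists_scalar hV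
    ((φ.intertwines τ i).trans (φ.intertwines σ (τ • i))) (φ.intertwines (σ * τ) i)
  refine ⟨c, LinearMap.ext fun x => ?_⟩
  have hlof : (DirectSum.lof ℂ S.ι S.M (τ • i) (φ.map τ i (x i))) (τ • i) = φ.map τ i (x i) :=
    DirectSum.component.lof_self ℂ (τ • i) (φ.map τ i (x i))
  rw [Module.End.mul_apply, LinearMap.smul_apply, op_apply, op_apply, op_apply, hlof, ← hc]
  rfl

/-- The scalar `α_i(σ, τ)` with `φ(σ, M_{τ • i}) φ(τ, M_i) = α_i(σ, τ) φ(σ τ, M_i)`. -/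
def alpha (hV : Module.rank ℂ V ≤ Cardinal.aleph0) (i : S.ι) (σ τ : G) : ℂˣ :=
  (exists_alpha φ hV i σ τ).choose

theorem op_mul_op (hV : Module.rank ℂ V ≤ Cardinal.aleph0) (i : S.ι) (σ τ : G) :
    op φ σ (τ • i) * op φ τ i = (alpha φ hV i σ τ : ℂ) • op φ (σ * τ) i :=
  (exists_alpha φ hV i σ τ).choose_spec

/-- The `2`-cocycle `α` determined by the `φ(σ, M_i)`. -/
def cocycle (hV : Module.rank ℂ V ≤ Cardinal.aleph0) : Cocycle G S.ι where
  toFun := alpha φ hV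
  cocycle i σ τ ρ := by
    have h1 : op φ σ (τ • ρ • i) * op φ τ (ρ • i) * op φ ρ i =
        ((alpha φ hV (ρ • i) σ τ : ℂ) * (alpha φ hV i (σ * τ) ρ : ℂ)) •
          op φ (σ * τ * ρ) i := by
      rw [op_mul_op φ hV, smul_mul_assoc, op_mul_op φ hV, mul_smul]
    have h2 : op φ σ (τ • ρ • i) * op φ τ (ρ • i) * op φ ρ i =
        ((alpha φ hV i σ (τ * ρ) : ℂ) * (alpha φ hV i τ ρ : ℂ)) • op φ (σ * τ * ρ) i := by
      rw [mul_assoc, op_mul_op φ hV i τ ρ, mul_smul_comm, ← mul_smul τ ρ i, op_mul_op φ hV,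
        smul_smul, mul_comm, mul_assoc σ τ ρ]
    exact Units.ext (smul_left_injective ℂ (op_ne_zero φ (σ * τ * ρ) i) (h1.symm.trans h2))

variable (hV : Module.rank ℂ V ≤ Cardinal.aleph0)

/-- The algebra `A_α(G, S)`. -/
abbrev algebra := TwistedAlgebra (cocycle φ hV)

/-- The action of `A_α(G, S)` on the direct sum: `σ ⊗ e(M_i)` acts by `φ(σ, M_i)` on `M_i` and
by `0` on the other summands. -/
def totalAct : algebra φ hV →ₗ[ℂ] Module.End ℂ S.Total :=
  (TwistedAlgebra.basis (cocycle φ hV)).constr ℂ fun p => op φ p.1 p.2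

/-- The action of `V^G` on the direct sum. -/
def totalMode (S : StableFamily.{u, v} V G) : ModeFamily ℤ (fixedPoints G) S.Total := fun n =>
  { toFun := fun a => DirectSum.lmap fun i => restrictFixed G (S.Y i) n a
    map_add' := fun a b => by
      apply DirectSum.linearMap_ext
      intro i; ext x : 1
      simp [DirectSum.lmap_lof]
    map_smul' := fun c a => by
      apply DirectSum.linearMap_ext
      intro i; ext x : 1
      simp [DirectSum.lmap_lof] }

/-- The algebra `S(M_i) = ℂ^{α_i}[G_i]`, where `G_i` is the group of all `σ ∈ G` with
`M_i · σ ≅ M_i`. -/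
abbrev stabAlgebra (i : S.ι) := TwistedAlgebra.StabAlgebra (cocycle φ hV) i

/-- The action of `ℂ^{α_i}[G_i]` on `M_i`: `σ` acts by `φ(σ, M_i) : M_i → M_{σ • i} = M_i`. -/
def stabAct (i : S.ι) : stabAlgebra φ hV i →ₗ[ℂ] Module.End ℂ (S.M i) :=
  (TwistedAlgebra.basis ((cocycle φ hV).restrict i)).constr ℂ fun p =>
    DirectSum.component ℂ S.ι S.M i ∘ₗ op φ (p.1 : G) i ∘ₗ DirectSum.lof ℂ S.ι S.M i

theorem stabAct_mode (i : S.ι) (s : stabAlgebra φ hV i) (n : ℤ) (a : fixedPoints G) (x : S.M i) :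
    stabAct φ hV i s (restrictFixed G (S.Y i) n a x) =
      restrictFixed G (S.Y i) n a (stabAct φ hV i s x) := by
  induction s using TwistedAlgebra.induction with
  | h0 => simp
  | hadd s t hs ht => simp [hs, ht]
  | hsmul c s hs => simp [hs]
  | hb p =>
    have key : ∀ (k : S.ι) (y : S.M k),
        DirectSum.component ℂ S.ι S.M i (DirectSum.lof ℂ S.ι S.M k (S.Y k n (a : V) y)) =
        S.Y i n (a : V) (DirectSum.component ℂ S.ι S.M i (DirectSum.lof ℂ S.ι S.M k y)) := by
      intro k y
      by_cases hk : k = i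
      · subst hk
        rw [DirectSum.component.lof_self, DirectSum.component.lof_self]
      · rw [DirectSum.component.of, DirectSum.component.of, dif_neg hk, dif_neg hk, map_zero]
    have hlof : ∀ y : S.M i, (DirectSum.lof ℂ S.ι S.M i y) i = y :=
      DirectSum.component.lof_self ℂ i
    rw [stabAct, Module.Basis.constr_basis]
    change DirectSum.component ℂ S.ι S.M i (op φ (p.1 : G) i _) =
      S.Y i n (a : V) (DirectSum.component ℂ S.ι S.M i (op φ (p.1 : G) i _))
    rw [op_apply, op_apply, hlof, hlof, ← key]
    have h := φ.intertwines (p.1 : G) i n (a : V) x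
    rw [show (p.1 : G) • (a : V) = a from a.2 _] at h
    rw [← h]
    rfl

section Multiplicity

variable (i : S.ι) (W : Type u₁) [AddCommGroup W] [Module ℂ W] [Module (stabAlgebra φ hV i) W]

/-- The multiplicity space `Hom_{ℂ^{α_i}[G_i]}(W, M_i)`. -/
def multSpace : Submodule ℂ (W →ₗ[ℂ] S.M i) where
  carrier := {f | ∀ (s : stabAlgebra φ hV i) (w : W), f (s • w) = stabAct φ hV i s (f w)}
  add_mem' hf hg s w := by simp [hf s w, hg s w]
  zero_mem' s w := by simp
  smul_mem' c f hf s w := by simp [hf s w]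

/-- The action of `V^G` on the multiplicity space: `(a_n f)(w) = a_n (f w)`. -/
def multMode : ModeFamily ℤ (fixedPoints G) (multSpace φ hV i W) := fun n =>
  LinearMap.mk₂ ℂ
    (fun a f => ⟨restrictFixed G (S.Y i) n a ∘ₗ f.1, fun s w => by
      rw [LinearMap.comp_apply, f.2 s w, ← stabAct_mode, LinearMap.comp_apply]⟩)
    (fun _ _ _ => Subtype.ext (by ext; simp)) (fun _ _ _ => Subtype.ext (by ext; simp))
    (fun _ _ _ => Subtype.ext (by ext; simp)) (fun _ _ _ => Subtype.ext (by ext; simp))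

end Multiplicity

end StableFamily

end SchurWeyl

end

open SchurWeyl
open scoped DirectSum TensorProduct

-- The proof is a double commutant argument between 𝒜 and V^G on ℳ.
--
-- On the side of 𝒜: it is the algebra of a finite groupoid twisted by a cocycle, so it is
-- finite-dimensional, and averaging makes it semisimple (`TwistedAlgebra.isSemisimpleModule`). Its
-- corner e(x)𝒜e(x) is the twisted group algebra of the stabilizer of x. The idempotents e(y) that
-- act nontrivially on a simple module are those of a single orbit, and the module is induced from
-- its corner at any point of that orbit. This classifies the simple modules
-- (`TwistedAlgebra.isCompleteIrreducible_induced`). Frobenius reciprocity identifies M^j_λ with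
-- Hom_𝒜(W^j_λ, ℳ), so that the decomposition is the isotypic decomposition of a semisimple module
-- (`evalMap_injective`, `evalMap_surjective`).
--
-- Two facts connect this with V.
--
-- Density (`StableFamily.exists_totalMode_approx`): an operator T commuting with 𝒜 agrees on any
-- finite set of vectors with a linear combination of single modes of V^G. Schur's lemma and
-- inequivalence make the V-endomorphisms of ℳ combinations of the projections e(M), so T commutes
-- with them and Jacobson density supplies a noncommutative polynomial in modes of V. On finitely
-- many given vectors this polynomial can be replaced by a linear combination of single modes
-- (`IsAssociativeFamily.mode_mode_mem_modeSpan`). Averaging over G then lands in the modes of V^G,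
-- which it would not do for products of modes. Given density, irreducibility, inequivalence and
-- complete reducibility all follow by extending an 𝒜-homomorphism with semisimplicity and
-- approximating it.
--
-- Faithfulness (`StableFamily.totalAct_injective`): the φ(σ, M) are linearly independent, so every
-- simple 𝒜-module occurs in ℳ. The relations ∑ (v_σ)_n φ(σ, M) = 0 form a subspace of a power of V
-- stable under left and right products. A minimal nonzero part of it is a copy of V embedded by
-- scalars, and this forces distinct group elements to act equally on V
-- (`eq_zero_of_sum_smul_intertwiner_eq_zero`).
--
-- Both facts rest on one form of associativity that does not mention the twisting automorphism and
-- so passes to products of modules with different twists (`IsAssociativeFamily`): the coefficients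
-- of (y - x)^N Y(a, y)Y(b, x) determine the modes of all a_l b, and interpolation in the rational
-- exponents shows the converse.
--
-- The last clause of the theorem applies density to the family of all inequivalent twists of one
-- module.

universe u₂ u₃

noncomputable section

open scoped DirectSum TensorProduct

namespace SchurWeyl

open VertexAlgebra

/-! ### Iterated differences of sequences that vanish far to the left -/

section Difference

variable {M : Type v} [AddCommGroup M] [Module ℂ M]

/-- The coefficients of `x^{-l} (1 - x)^l ∑ c_z x^z`, for an integer `l`. -/
def genDiff (c : ℤ → M) (l z : ℤ) : M :=
  ∑ᶠ j : ℕ, ((-1 : ℂ) ^ j * ((Ring.choose l j : ℤ) : ℂ)) • c (l + z - j)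

theorem genDiff_eq_sum {c : ℤ → M} {P : ℤ} (hc : ∀ z < P, c z = 0) (l z : ℤ) (J : ℕ)
    (hJ : l + z - J < P) :
    genDiff c l z =
      ∑ j ∈ Finset.range J, ((-1 : ℂ) ^ j * ((Ring.choose l j : ℤ) : ℂ)) • c (l + z - j) := by
  refine finsum_eq_sum_of_support_subset _ fun j hj => ?_
  by_contra h
  refine hj ?_
  have : (J : ℤ) ≤ j := by simpa using h
  change _ • c _ = 0
  rw [hc _ (by lia), smul_zero]

theorem genDiff_eq_zero {c : ℤ → M} {P : ℤ} (hc : ∀ z < P, c z = 0) {l z : ℤ}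
    (h : l + z < P) : genDiff c l z = 0 := by
  rw [genDiff_eq_sum hc l z 0 (by simpa using h), Finset.sum_range_zero]

/-- Raising `l` by one multiplies the series by x⁻¹(1 - x); on coefficients this is Pascal's rule.
The vanishing of `c` to the left makes all sums finite when `l` is negative. -/
theorem genDiff_succ {c : ℤ → M} {P : ℤ} (hc : ∀ z < P, c z = 0) (l z : ℤ) :
    genDiff c (l + 1) z = genDiff c l (z + 1) - genDiff c l z := by
  obtain ⟨J, hJ⟩ : ∃ J : ℕ, l + z + 1 - J < P := ⟨(l + z + 2 - P).toNat, by lia⟩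
  rw [genDiff_eq_sum hc (l + 1) z (J + 1) (by push_cast; lia),
    genDiff_eq_sum hc l (z + 1) (J + 1) (by push_cast; lia),
    genDiff_eq_sum hc l z J (by lia), Finset.sum_range_succ', Finset.sum_range_succ',
    add_sub_right_comm (Finset.sum _ _), ← Finset.sum_sub_distrib]
  congr 1
  · refine Finset.sum_congr rfl fun j _ => ?_
    rw [Ring.choose_succ_succ, show l + 1 + z - ((j + 1 : ℕ) : ℤ) = l + z - j by push_cast; ring,
      show l + (z + 1) - ((j + 1 : ℕ) : ℤ) = l + z - j by push_cast; ring, ← sub_smul]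
    congr 1
    push_cast
    ring
  · simp only [pow_zero, Ring.choose_zero_right, Nat.cast_zero, sub_zero]
    congr 2
    ring

/-- This is division by (x⁻¹(1 - x))^(k+1): the coefficient of x^d in x^(k+1)(1 - x)^(-k-1) is
C(d-1, k). The difference equation is solved by k + 1 successive summations, all starting at `P -
N`, where every term is still zero. -/
theorem genDiff_eq_sum_choose {c : ℤ → M} {P : ℤ} (hc : ∀ z < P, c z = 0) (N : ℤ) (k : ℕ)
    (z : ℤ) (hz : P - N ≤ z) : genDiff c (N - 1 - k) z =
      ∑ x ∈ Finset.Ico (P - N) z, ((z - x - 1).toNat.choose k : ℂ) • genDiff c N x := by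
  induction k generalizing z with
  | zero =>
    induction z, hz using Int.leInduction with
    | base => rw [genDiff_eq_zero hc (by simp), Finset.Ico_self, Finset.sum_empty]
    | succ z hz ih =>
      have h := genDiff_succ hc (N - 1) z
      rw [sub_add_cancel] at h
      simp only [Nat.cast_zero, sub_zero, Nat.choose_zero_right, Nat.cast_one, one_smul] at ih ⊢
      rw [← Finset.insert_Ico_right_eq_Ico_add_one hz,
        Finset.sum_insert (by simp), ← ih, h]
      abel
  | succ k ih' =>
    induction z, hz using Int.leInduction with
    | base => rw [genDiff_eq_zero hc (by push_cast; lia), Finset.Ico_self, Finset.sum_empty]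
    | succ z hz ih =>
      have h := genDiff_succ hc (N - 1 - (k + 1 : ℕ)) z
      rw [show N - 1 - ((k + 1 : ℕ) : ℤ) + 1 = N - 1 - k by push_cast; ring, ih' z hz, ih] at h
      rw [eq_comm, sub_eq_iff_eq_add] at h
      rw [h, ← Finset.insert_Ico_right_eq_Ico_add_one hz,
        Finset.sum_insert (by simp)]
      simp only [add_sub_cancel_left, sub_self, Int.toNat_zero, Nat.choose_zero_succ,
        Nat.cast_zero, zero_smul, zero_add]
      rw [← Finset.sum_add_distrib]
      refine Finset.sum_congr rfl fun x hx => ?_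
      rw [Finset.mem_Ico] at hx
      rw [← add_smul, show (z + 1 - x - 1).toNat = (z - x - 1).toNat + 1 by lia,
        Nat.choose_succ_succ]
      push_cast
      rfl

end Difference

/-! ### Decomposition into sectors -/

section Sectors

variable {V : Type u} [AddCommGroup V] [Module ℂ V] [VertexAlgebra V]

/-- The component of `a` in the sector `V^{(g, r)}`. -/
def sectorPart (g : Aut V) (r : ℕ) (a : V) : V :=
  (orderOf g : ℂ)⁻¹ • ∑ s ∈ Finset.range (orderOf g),
    Complex.exp (2 * Real.pi * Complex.I / orderOf g) ^ (r * s) • (g ^ s • a)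

theorem aut_smul_smul (g : Aut V) (c : ℂ) (a : V) : g • (c • a) = c • (g • a) :=
  map_smul (g : V ≃ₗ[ℂ] V) c a

/-- Applying `g` shifts the summation index by one, and the sum closes up cyclically because both
ζ^(r|g|) and g^|g| are trivial. -/
theorem sectorPart_mem {g : Aut V} (hg : 0 < orderOf g) (r : ℕ) (a : V) :
    sectorPart g r a ∈ twistedSector g r := by
  set ζ := Complex.exp (2 * Real.pi * Complex.I / orderOf g) with hζ
  have hprim : IsPrimitiveRoot ζ (orderOf g) := Complex.isPrimitiveRoot_exp _ hg.ne'
  have hexp : Complex.exp (-2 * Real.pi * Complex.I * r / orderOf g) = (ζ ^ r)⁻¹ := by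
    rw [hζ, ← Complex.exp_nat_mul, ← Complex.exp_neg]
    congr 1
    ring
  have h0 : ζ ≠ 0 := Complex.exp_ne_zero _
  change g • sectorPart g r a = _ • sectorPart g r a
  rw [hexp, sectorPart, aut_smul_smul, smul_comm _ (orderOf g : ℂ)⁻¹]
  congr 1
  rw [Finset.smul_sum, Finset.smul_sum]
  have hF : ∀ s, g • (ζ ^ (r * s) • (g ^ s • a)) =
      (fun s => (ζ ^ r)⁻¹ • ζ ^ (r * s) • (g ^ s • a)) (s + 1) := fun s => by
    simp only [aut_smul_smul, smul_smul, ← pow_succ']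
    congr 1
    rw [mul_add, pow_add, mul_one]
    field_simp
  rw [Finset.sum_congr rfl fun s _ => hF s]
  have h1 := Finset.sum_range_succ' (fun s => (ζ ^ r)⁻¹ • ζ ^ (r * s) • (g ^ s • a)) (orderOf g)
  rw [Finset.sum_range_succ] at h1
  have h2 : ζ ^ (r * orderOf g) = 1 := by rw [mul_comm, pow_mul, hprim.pow_eq_one, one_pow]
  simp only [h2, pow_orderOf_eq_one, mul_zero, pow_zero] at h1
  exact (add_right_cancel h1).symm

/-- Orthogonality of characters: for 0 < s < |g| the numbers ζ^(rs) sum to zero over r, so only the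
term s = 0 survives. -/
theorem sum_sectorPart {g : Aut V} (hg : 0 < orderOf g) (a : V) :
    ∑ r ∈ Finset.range (orderOf g), sectorPart g r a = a := by
  have hprim : IsPrimitiveRoot (Complex.exp (2 * Real.pi * Complex.I / orderOf g)) (orderOf g) :=
    Complex.isPrimitiveRoot_exp _ hg.ne'
  simp only [sectorPart]
  set ζ := Complex.exp (2 * Real.pi * Complex.I / orderOf g)
  rw [← Finset.smul_sum, Finset.sum_comm]
  have key : ∀ s ∈ Finset.range (orderOf g), s ≠ 0 →
      ∑ r ∈ Finset.range (orderOf g), ζ ^ (r * s) • (g ^ s • a) = 0 := fun s hs h0 => by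
    rw [← Finset.sum_smul]
    have h1 : ζ ^ s ≠ 1 := fun h =>
      absurd (Nat.le_of_dvd (Nat.pos_of_ne_zero h0) (hprim.dvd_of_pow_eq_one s h))
        (not_le.mpr (Finset.mem_range.mp hs))
    have h2 := geom_sum_eq h1 (orderOf g)
    simp only [← pow_mul] at h2
    simp only [mul_comm _ s]
    rw [h2, mul_comm s, pow_mul, hprim.pow_eq_one, one_pow, sub_self, zero_div, zero_smul]
  rw [Finset.sum_eq_single_of_mem 0 (Finset.mem_range.mpr hg) key]
  simp only [mul_zero, pow_zero, one_smul, Finset.sum_const, Finset.card_range]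
  rw [← Nat.cast_smul_eq_nsmul ℂ, inv_smul_smul₀ (by exact_mod_cast hg.ne')]

/-- The sector components are combinations of the g^s a, so a bound that holds along the orbit of
`a` holds for each component. This is why locality bounds are later required for all σ a with σ ∈ G.
-/
theorem mode_sectorPart {g : Aut V} {N : ℕ} {a b : V}
    (h : ∀ s : ℕ, ∀ n : ℤ, N ≤ n → mode n (g ^ s • a) b = 0) (r : ℕ) (n : ℤ) (hn : N ≤ n) :
    mode n (sectorPart g r a) b = 0 := by
  rw [sectorPart, LinearMap.map_smul₂, map_sum, LinearMap.sum_apply]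
  rw [Finset.sum_eq_zero, smul_zero]
  intro s _
  rw [LinearMap.map_smul₂, h s n hn, smul_zero]

end Sectors

/-! ### Associativity of twisted modules -/

section Associativity

variable {V : Type u} [AddCommGroup V] [Module ℂ V] {M : Type v} [AddCommGroup M] [Module ℂ M]

/-- The coefficient of `y^{-p-1} x^{-q-1}` in `(y - x)^N Y(a, y) Y(b, x)`. -/
def assocCoeff (Y : ModeFamily ℚ V M) (N : ℕ) (a b : V) (p q : ℚ) : M →ₗ[ℂ] M :=
  ∑ i ∈ Finset.range (N + 1),
    ((-1 : ℂ) ^ i * (N.choose i : ℂ)) • (Y (N + p - i) a ∘ₗ Y (q + i) b)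

/-- The coefficient of `y^{-p-1} x^{-q-1}` in `(y - x)^N Y(b, x) Y(a, y)`. -/
def assocCoeffSwap (Y : ModeFamily ℚ V M) (N : ℕ) (a b : V) (p q : ℚ) : M →ₗ[ℂ] M :=
  (-1 : ℂ) ^ N • ∑ i ∈ Finset.range (N + 1),
    ((-1 : ℂ) ^ i * (N.choose i : ℂ)) • (Y (N + q - i) b ∘ₗ Y (p + i) a)

theorem assocCoeff_apply (Y : ModeFamily ℚ V M) (N : ℕ) (a b : V) (p q : ℚ) (w : M) :
    assocCoeff Y N a b p q w = ∑ i ∈ Finset.range (N + 1),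
      ((-1 : ℂ) ^ i * (N.choose i : ℂ)) • Y (N + p - i) a (Y (q + i) b w) := by
  simp [assocCoeff, LinearMap.sum_apply]

theorem assocCoeffSwap_apply (Y : ModeFamily ℚ V M) (N : ℕ) (a b : V) (p q : ℚ) (w : M) :
    assocCoeffSwap Y N a b p q w = (-1 : ℂ) ^ N • ∑ i ∈ Finset.range (N + 1),
      ((-1 : ℂ) ^ i * (N.choose i : ℂ)) • Y (N + q - i) b (Y (p + i) a w) := by
  simp [assocCoeffSwap, LinearMap.sum_apply]

theorem assocCoeff_sum {κ : Type*} (Y : ModeFamily ℚ V M) (N : ℕ) (s : Finset κ) (a : κ → V)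
    (b : V) (p q : ℚ) (w : M) :
    assocCoeff Y N (∑ r ∈ s, a r) b p q w = ∑ r ∈ s, assocCoeff Y N (a r) b p q w := by
  simp only [assocCoeff_apply, map_sum, LinearMap.sum_apply, Finset.smul_sum]
  exact Finset.sum_comm

theorem assocCoeffSwap_sum {κ : Type*} (Y : ModeFamily ℚ V M) (N : ℕ) (s : Finset κ) (a : κ → V)
    (b : V) (p q : ℚ) (w : M) :
    assocCoeffSwap Y N (∑ r ∈ s, a r) b p q w = ∑ r ∈ s, assocCoeffSwap Y N (a r) b p q w := by
  simp only [assocCoeffSwap_apply, map_sum, LinearMap.sum_apply, Finset.smul_sum]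
  exact Finset.sum_comm

/-- In generating functions the hypothesis says (1 + z)^m d = e, so d = (1 + z)^(-m) e;
Vandermonde's identity expresses the product of the two powers. -/
theorem sum_antidiagonal_choose_inv (m : ℚ) (d e : ℕ → M)
    (h : ∀ k, ∑ x ∈ Finset.HasAntidiagonal.antidiagonal k, ((Ring.choose m x.1 : ℚ) : ℂ) • d x.2 = e k) (k : ℕ) :
    d k = ∑ x ∈ Finset.HasAntidiagonal.antidiagonal k, ((Ring.choose (-m) x.1 : ℚ) : ℂ) • e x.2 := by
  have h1 : ∑ x ∈ Finset.HasAntidiagonal.antidiagonal k, ((Ring.choose (-m) x.1 : ℚ) : ℂ) • e x.2 =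
      ∑ x ∈ Finset.HasAntidiagonal.antidiagonal k, ((Ring.choose (-m + m) x.1 : ℚ) : ℂ) • d x.2 := by
    simp only [← h, Finset.smul_sum, smul_smul, Ring.add_choose_eq _ (Commute.all (-m) m),
      Rat.cast_sum, Rat.cast_mul, Finset.sum_smul]
    rw [Finset.sum_sigma', Finset.sum_sigma']
    refine Finset.sum_nbij' (fun x => ⟨(x.1.1 + x.2.1, x.2.2), (x.1.1, x.2.1)⟩)
      (fun x => ⟨(x.2.1, x.2.2 + x.1.2), (x.2.2, x.1.2)⟩) ?_ ?_ ?_ ?_ ?_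
    · rintro ⟨⟨i, j⟩, ⟨p, q⟩⟩ hx
      simp only [Finset.mem_sigma, Finset.HasAntidiagonal.mem_antidiagonal] at hx ⊢
      lia
    · rintro ⟨⟨i, j⟩, ⟨p, q⟩⟩ hx
      simp only [Finset.mem_sigma, Finset.HasAntidiagonal.mem_antidiagonal] at hx ⊢
      lia
    · rintro ⟨⟨i, j⟩, ⟨p, q⟩⟩ hx
      simp only [Finset.mem_sigma, Finset.HasAntidiagonal.mem_antidiagonal] at hx
      obtain ⟨-, rfl⟩ := hx
      rfl
    · rintro ⟨⟨i, j⟩, ⟨p, q⟩⟩ hx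
      simp only [Finset.mem_sigma, Finset.HasAntidiagonal.mem_antidiagonal] at hx
      obtain ⟨-, rfl⟩ := hx
      rfl
    · rintro ⟨⟨i, j⟩, ⟨p, q⟩⟩ hx
      rfl
  rw [h1, neg_add_cancel, Finset.sum_eq_single_of_mem (0, k) (by simp)]
  · simp
  · rintro ⟨i, j⟩ hij hne
    have : i ≠ 0 := by
      rintro rfl
      exact hne (by simpa using hij)
    rw [Ring.choose_zero_pos ℚ (Nat.pos_of_ne_zero this)]
    simp

end Associativity

section Twisted

variable {V : Type u} [AddCommGroup V] [Module ℂ V] [VertexAlgebra V]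
  {M : Type v} [AddCommGroup M] [Module ℂ M] {g : Aut V} {Y : ModeFamily ℚ V M}

theorem assocCoeff_eq_zero_of_sector (hY : IsTwistedModule g Y) {r : ℕ} (hr : r < orderOf g)
    {a : V} (ha : a ∈ twistedSector g r) (N : ℕ) (b : V) {p : ℚ} (q : ℚ)
    (hp : ¬ ∃ k : ℤ, p = (r : ℚ) / orderOf g + k) (w : M) : assocCoeff Y N a b p q w = 0 := by
  rw [assocCoeff_apply]
  refine Finset.sum_eq_zero fun i _ => ?_
  rw [hY.support r hr a ha, LinearMap.zero_apply, smul_zero]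
  rintro ⟨k, hk⟩
  exact hp ⟨k - N + i, by push_cast; linarith⟩

theorem assocCoeffSwap_eq_zero_of_sector (hY : IsTwistedModule g Y) {r : ℕ} (hr : r < orderOf g)
    {a : V} (ha : a ∈ twistedSector g r) (N : ℕ) (b : V) {p : ℚ} (q : ℚ)
    (hp : ¬ ∃ k : ℤ, p = (r : ℚ) / orderOf g + k) (w : M) : assocCoeffSwap Y N a b p q w = 0 := by
  rw [assocCoeffSwap_apply, Finset.sum_eq_zero, smul_zero]
  intro i _
  rw [hY.support r hr a ha (p + i), LinearMap.zero_apply, map_zero, smul_zero]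
  rintro ⟨k, hk⟩
  exact hp ⟨k - i, by push_cast; linarith⟩

/-- This is the Borcherds identity at l = N, where every product a_{N+i} b on the left vanishes. If
`p` lies outside r/|g| + ℤ the identity is not available, but then both sides are zero for lack of
modes. -/
theorem assocCoeff_comm_of_sector (hY : IsTwistedModule g Y) {r : ℕ} (hr : r < orderOf g)
    {a b : V} (ha : a ∈ twistedSector g r) {N : ℕ} (hN : ∀ n : ℤ, N ≤ n → mode n a b = 0)
    (p q : ℚ) (w : M) : assocCoeff Y N a b p q w = assocCoeffSwap Y N a b p q w := by
  by_cases hp : ∃ k : ℤ, p = (r : ℚ) / orderOf g + k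
  swap
  · rw [assocCoeff_eq_zero_of_sector hY hr ha N b q hp,
      assocCoeffSwap_eq_zero_of_sector hY hr ha N b q hp]
  have h := hY.borcherds r hr a ha b w N p q hp
  rw [finsum_eq_zero_of_forall_eq_zero fun i => by
    rw [hN _ (by lia), map_zero, LinearMap.zero_apply, smul_zero],
    finsum_eq_sum_of_support_subset (s := Finset.range (N + 1))] at h
  · simp only [smul_sub, Finset.sum_sub_distrib, eq_comm (a := (0 : M)), sub_eq_zero] at h
    rw [assocCoeff_apply, assocCoeffSwap_apply, Finset.smul_sum]
    simp only [Ring.choose_natCast, Int.cast_natCast, zpow_natCast] at h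
    rw [h]
    exact Finset.sum_congr rfl fun i _ => smul_comm _ _ _
  · intro i hi
    by_contra hi'
    refine hi ?_
    have h0 : N.choose i = 0 := Nat.choose_eq_zero_of_lt (by simpa using hi')
    simp [Ring.choose_natCast, h0]

/-- Associativity: x₀^N Y(Y(a, x₀)b, x) is obtained from (y - x)^N Y(a, y)Y(b, x) by the
substitution y = x + x₀, and the binomials are those of (x + x₀)^(-p-1). Here it is read off in one
total degree `t`, where only finitely many coefficients are nonzero. The number r no longer occurs
in the formula, so it can be summed over sectors. -/
theorem exists_assoc_of_sector (hY : IsTwistedModule g Y) {r : ℕ} (hr : r < orderOf g)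
    {a b : V} (ha : a ∈ twistedSector g r) {N : ℕ} (hN : ∀ n : ℤ, N ≤ n → mode n a b = 0)
    (t : ℚ) (w : M) : ∃ F : Finset ℚ, (∀ p ∉ F, assocCoeff Y N a b p (t - p) w = 0) ∧
      ∀ k : ℕ, Y (t + k + 1) (mode (N - 1 - k) a b) w =
        ∑ p ∈ F, ((Ring.choose (-p - 1) k : ℚ) : ℂ) • assocCoeff Y N a b p (t - p) w := by
  obtain ⟨K, hK⟩ := hY.trunc a w
  obtain ⟨Q, hQ⟩ := hY.trunc b w
  -- The exponent must lie in the coset of the sector and be so large that a_{m+i} w = 0 for all i ≥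
  -- 0; this removes the terms in which `a` acts first.
  let m : ℚ := (r : ℚ) / orderOf g + ⌈K - (r : ℚ) / orderOf g⌉
  have hmK : K ≤ m := by
    have := Int.le_ceil (K - (r : ℚ) / orderOf g)
    simp only [m]
    linarith
  have hmc : ∃ k : ℤ, m = (r : ℚ) / orderOf g + k := ⟨_, rfl⟩
  let c : ℤ → M := fun z => Y (m + z) a (Y (N + t - m - z) b w)
  -- The bound by `N` ensures P - N ≤ 0, so that the summation formula can be used at z = 0.
  let P : ℤ := min N ⌊(N + t - m - Q : ℚ)⌋
  have hc : ∀ z < P, c z = 0 := fun z hz => by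
    have h1 : (z : ℚ) ≤ N + t - m - Q :=
      (Int.le_floor.mp (hz.le.trans (min_le_right _ _)))
    simp only [c]
    rw [hQ _ (by linarith), map_zero]
  have hG : ∀ z : ℤ, genDiff c N z = assocCoeff Y N a b (m + z) (t - (m + z)) w := fun z => by
    rw [assocCoeff_apply, genDiff, finsum_eq_sum_of_support_subset (s := Finset.range (N + 1))]
    · refine Finset.sum_congr rfl fun i _ => ?_
      simp only [c, Ring.choose_natCast, Int.cast_natCast]
      congr 1
      rw [show (m : ℚ) + ((N + z - i : ℤ) : ℚ) = N + (m + z) - i by push_cast; ring,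
        show (N : ℚ) + t - m - ((N + z - i : ℤ) : ℚ) = t - (m + z) + i by push_cast; ring]
    · intro i hi
      by_contra hi'
      refine hi ?_
      have h0 : N.choose i = 0 := Nat.choose_eq_zero_of_lt (by simpa using hi')
      simp [Ring.choose_natCast, h0]
  -- After commuting, `a` acts first with index at least `m`. So the coefficients also vanish to the
  -- right, and only those with P - N ≤ z < 0 remain.
  have hG0 : ∀ z : ℤ, 0 ≤ z → genDiff c N z = 0 := fun z hz => by
    rw [hG, assocCoeff_comm_of_sector hY hr ha hN, assocCoeffSwap_apply, Finset.sum_eq_zero,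
      smul_zero]
    intro i _
    have h1 : (0 : ℚ) ≤ z := by exact_mod_cast hz
    have h2 : (0 : ℚ) ≤ i := by positivity
    rw [hK (m + z + i) (by linarith), map_zero, smul_zero]
  have hinj : Function.Injective fun z : ℤ => m + (z : ℚ) := fun x y h => by simpa using h
  refine ⟨(Finset.Ico (P - N) 0).map ⟨_, hinj⟩, fun p hp => ?_, fun k => ?_⟩
  · by_cases hpc : ∃ k : ℤ, p = (r : ℚ) / orderOf g + k
    swap
    · exact assocCoeff_eq_zero_of_sector hY hr ha N b _ hpc w
    obtain ⟨k, hk⟩ := hpc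
    obtain ⟨z, rfl⟩ : ∃ z : ℤ, p = m + z :=
      ⟨k - ⌈K - (r : ℚ) / orderOf g⌉, by simp only [m]; push_cast; linarith⟩
    rw [← hG]
    rcases le_or_gt 0 z with hz | hz
    · exact hG0 z hz
    · refine genDiff_eq_zero hc ?_
      by_contra hcon
      exact hp (Finset.mem_map.mpr ⟨z, by simp only [Finset.mem_Ico]; lia, rfl⟩)
  -- In the Borcherds identity at l = N - 1 - k the left side stops at i = k because a_N b = 0. The
  -- right side is a difference of order N - 1 - k of `c`, hence an iterated sum of the differences
  -- of order N.
  · have key : ∀ k : ℕ, ∑ x ∈ Finset.HasAntidiagonal.antidiagonal k, ((Ring.choose m x.1 : ℚ) : ℂ) •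
        Y (t + x.2 + 1) (mode (N - 1 - x.2) a b) w =
        ∑ x ∈ Finset.Ico (P - N) 0, ((-x - 1).toNat.choose k : ℂ) • genDiff c N x := fun k => by
      have h1 := genDiff_eq_sum_choose hc N k 0 (by simp [P])
      simp only [zero_sub] at h1
      rw [← h1]
      have h := hY.borcherds r hr a ha b w (N - 1 - k) m (t + k + 1 - m) hmc
      rw [finsum_eq_sum_of_support_subset (s := Finset.range (k + 1))] at h
      · rw [Finset.Nat.sum_antidiagonal_eq_sum_range_succ_mk]
        simp only
        convert h using 1
        · refine Finset.sum_congr rfl fun i hi => ?_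
          have hi' : i ≤ k := by simpa [Nat.lt_succ_iff] using hi
          rw [show m + (t + k + 1 - m) - i = t + ((k - i : ℕ) : ℚ) + 1 by
              push_cast [Nat.cast_sub hi']; ring,
            show (N : ℤ) - 1 - k + i = N - 1 - ((k - i : ℕ) : ℤ) by
              push_cast [Nat.cast_sub hi']; ring]
        · rw [genDiff]
          refine finsum_congr fun i => ?_
          have h2 : (0 : ℚ) ≤ i := by positivity
          rw [hK (m + i) (by linarith), map_zero, smul_zero, sub_zero]
          simp only [c]
          congr 1
          rw [show (m : ℚ) + ((N - 1 - k + 0 - i : ℤ) : ℚ) = ((N - 1 - k : ℤ) : ℚ) + m - i by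
              push_cast; ring,
            show (N : ℚ) + t - m - ((N - 1 - k + 0 - i : ℤ) : ℚ) = t + k + 1 - m + i by
              push_cast; ring]
      · intro i hi
        by_contra hi'
        refine hi ?_
        have hi'' : k < i := by simpa using hi'
        change _ • _ = _
        rw [hN _ (by lia), map_zero, LinearMap.zero_apply, smul_zero]
    -- The factor (1 + z)^m is removed, and Vandermonde combines C(-m, i) with C(-z-1, k-i) to
    -- C(-p-1, k) for p = m + z.
    rw [sum_antidiagonal_choose_inv m
      (fun k => Y (t + k + 1) (mode (N - 1 - k) a b) w) _ key k, Finset.sum_map]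
    simp only [Finset.smul_sum, Function.Embedding.coeFn_mk, ← hG, smul_smul]
    rw [Finset.sum_comm]
    refine Finset.sum_congr rfl fun z hz => ?_
    rw [← Finset.sum_smul]
    congr 1
    have hz0 : z < 0 := (Finset.mem_Ico.mp hz).2
    have h3 : -(m + (z : ℚ)) - 1 = -m + ((-z - 1).toNat : ℚ) := by
      have : ((-z - 1).toNat : ℤ) = -z - 1 := Int.toNat_of_nonneg (by lia)
      rw [← Int.cast_natCast, this]
      push_cast
      ring
    rw [h3, Ring.add_choose_eq _ (Commute.all _ _)]
    push_cast
    refine Finset.sum_congr rfl fun x _ => ?_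
    rw [Ring.choose_natCast]
    simp

end Twisted

/-! ### Families of twisted modules for several automorphisms -/

section Pi

variable {V : Type u} [AddCommGroup V] [Module ℂ V]

/-- The componentwise modes on a product. -/
def piMode {Γ : Type*} {I : Type w} {M : I → Type v} [∀ i, AddCommGroup (M i)]
    [∀ i, Module ℂ (M i)] (Y : ∀ i, ModeFamily Γ V (M i)) : ModeFamily Γ V (∀ i, M i) := fun n =>
  LinearMap.mk₂ ℂ (fun a x i => Y i n a (x i))
    (fun _ _ _ => by ext; simp) (fun _ _ _ => by ext; simp)
    (fun _ _ _ => by ext; simp) (fun _ _ _ => by ext; simp)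

theorem piMode_apply {Γ : Type*} {I : Type w} {M : I → Type v} [∀ i, AddCommGroup (M i)]
    [∀ i, Module ℂ (M i)] (Y : ∀ i, ModeFamily Γ V (M i)) (n : Γ) (a : V) (x : ∀ i, M i) (i : I) :
    piMode Y n a x i = Y i n a (x i) := rfl

theorem assocCoeff_piMode {I : Type w} {M : I → Type v} [∀ i, AddCommGroup (M i)]
    [∀ i, Module ℂ (M i)] (Y : ∀ i, ModeFamily ℚ V (M i)) (N : ℕ) (a b : V) (p q : ℚ)
    (x : ∀ i, M i) (i : I) :
    assocCoeff (piMode Y) N a b p q x i = assocCoeff (Y i) N a b p q (x i) := by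
  simp [assocCoeff_apply, Finset.sum_apply, piMode_apply]

theorem assocCoeffSwap_piMode {I : Type w} {M : I → Type v} [∀ i, AddCommGroup (M i)]
    [∀ i, Module ℂ (M i)] (Y : ∀ i, ModeFamily ℚ V (M i)) (N : ℕ) (a b : V) (p q : ℚ)
    (x : ∀ i, M i) (i : I) :
    assocCoeffSwap (piMode Y) N a b p q x i = assocCoeffSwap (Y i) N a b p q (x i) := by
  simp [assocCoeffSwap_apply, Finset.sum_apply, piMode_apply]

end Pi

section AssociativeFamily

variable {V : Type u} [AddCommGroup V] [Module ℂ V] [VertexAlgebra V]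

theorem exists_locality_bound (G : Subgroup (Aut V)) [Finite G] (a b : V) :
    ∃ N : ℕ, ∀ σ ∈ G, ∀ n : ℤ, N ≤ n → mode n (σ • a) b = 0 := by
  choose N hN using fun σ : G => trunc ((σ : Aut V) • a) b
  have := Fintype.ofFinite G
  refine ⟨Finset.univ.sup fun σ => (N σ).toNat, fun σ hσ n hn => hN ⟨σ, hσ⟩ n ?_⟩
  have h : (N ⟨σ, hσ⟩).toNat ≤ Finset.univ.sup fun σ => (N σ).toNat :=
    Finset.le_sup (f := fun σ => (N σ).toNat) (Finset.mem_univ (⟨σ, hσ⟩ : G))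
  lia

/-- The consequences of the Borcherds identity that are shared by the direct sums of twisted
modules for different elements of `G`. -/
structure IsAssociativeFamily (G : Subgroup (Aut V)) {M : Type v} [AddCommGroup M] [Module ℂ M]
    (Y : ModeFamily ℚ V M) : Prop where
  trunc : ∀ (a : V) (x : M), ∃ N : ℚ, ∀ n : ℚ, N ≤ n → Y n a x = 0
  vac : ∀ (n : ℚ) (x : M), Y n vac x = if n = -1 then x else 0
  comm : ∀ (a b : V) (N : ℕ), (∀ σ ∈ G, ∀ n : ℤ, N ≤ n → mode n (σ • a) b = 0) →
    ∀ (p q : ℚ) (w : M), assocCoeff Y N a b p q w = assocCoeffSwap Y N a b p q w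
  assoc : ∀ (a b : V) (N : ℕ), (∀ σ ∈ G, ∀ n : ℤ, N ≤ n → mode n (σ • a) b = 0) →
    ∀ (t : ℚ) (w : M), ∃ F : Finset ℚ, (∀ p ∉ F, assocCoeff Y N a b p (t - p) w = 0) ∧
      ∀ k : ℕ, Y (t + k + 1) (mode (N - 1 - k) a b) w =
        ∑ p ∈ F, ((Ring.choose (-p - 1) k : ℚ) : ℂ) • assocCoeff Y N a b p (t - p) w

/-- Both identities are linear in `a` and have the same shape in each sector, so they can be summed
over the components of `a`. The finite sets of exponents are merged, which only adds zero terms. -/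
theorem IsTwistedModule.isAssociativeFamily {G : Subgroup (Aut V)} [Finite G] {M : Type v}
    [AddCommGroup M] [Module ℂ M] {Y : ModeFamily ℚ V M} {g : Aut V} (hg : g ∈ G)
    (hY : IsTwistedModule g Y) : IsAssociativeFamily G Y := by
  classical
  have hord : 0 < orderOf g := by
    have h := orderOf_pos (⟨g, hg⟩ : G)
    rwa [← Subgroup.orderOf_coe] at h
  have hN' : ∀ {a b : V} {N : ℕ}, (∀ σ ∈ G, ∀ n : ℤ, N ≤ n → mode n (σ • a) b = 0) →
      ∀ (r : ℕ) (n : ℤ), N ≤ n → mode n (sectorPart g r a) b = 0 := fun hN r n hn =>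
    mode_sectorPart (fun s n hn => hN _ (pow_mem hg s) n hn) r n hn
  refine ⟨hY.trunc, hY.vac, fun a b N hN p q w => ?_, fun a b N hN t w => ?_⟩
  · rw [← sum_sectorPart hord a, assocCoeff_sum, assocCoeffSwap_sum]
    exact Finset.sum_congr rfl fun r hr => assocCoeff_comm_of_sector hY (Finset.mem_range.mp hr)
      (sectorPart_mem hord r a) (hN' hN r) p q w
  · choose! F hF0 hF using fun r (hr : r < orderOf g) => exists_assoc_of_sector hY hr
      (sectorPart_mem hord r a) (hN' hN r) t w
    have ha : ∀ p, assocCoeff Y N a b p (t - p) w = ∑ r ∈ Finset.range (orderOf g),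
        assocCoeff Y N (sectorPart g r a) b p (t - p) w := fun p => by
      rw [← assocCoeff_sum, sum_sectorPart hord a]
    refine ⟨(Finset.range (orderOf g)).biUnion F, fun p hp => ?_, fun k => ?_⟩
    · rw [ha]
      refine Finset.sum_eq_zero fun r hr => hF0 r (Finset.mem_range.mp hr) p fun h => hp ?_
      exact Finset.mem_biUnion.mpr ⟨r, hr, h⟩
    · simp only [ha, Finset.smul_sum]
      rw [Finset.sum_comm]
      conv_lhs => rw [← sum_sectorPart hord a]
      rw [map_sum, LinearMap.sum_apply, map_sum, LinearMap.sum_apply]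
      refine Finset.sum_congr rfl fun r hr => ?_
      rw [hF r (Finset.mem_range.mp hr) k]
      refine Finset.sum_subset (fun p hp => Finset.mem_biUnion.mpr ⟨r, hr, hp⟩) fun p _ hp => ?_
      rw [hF0 r (Finset.mem_range.mp hr) p hp, smul_zero]

/-- Factors twisted by different automorphisms are allowed: all identities hold componentwise with
the same numerical coefficients. Finiteness of the index set gives a common truncation bound and a
common finite set of exponents. -/
theorem IsAssociativeFamily.pi {G : Subgroup (Aut V)} {I : Type w} [Finite I] {M : I → Type v}
    [∀ i, AddCommGroup (M i)] [∀ i, Module ℂ (M i)] {Y : ∀ i, ModeFamily ℚ V (M i)}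
    (hY : ∀ i, IsAssociativeFamily G (Y i)) : IsAssociativeFamily G (piMode Y) := by
  classical
  have := Fintype.ofFinite I
  refine ⟨fun a x => ?_, fun n x => ?_, fun a b N hN p q w => ?_, fun a b N hN t w => ?_⟩
  · choose K hK using fun i => (hY i).trunc a (x i)
    obtain ⟨B, hB⟩ := Finite.exists_le K
    exact ⟨B, fun n hn => funext fun i => hK i n ((hB i).trans hn)⟩
  · funext i
    rw [piMode_apply, (hY i).vac]
    split_ifs <;> rfl
  · funext i
    rw [assocCoeff_piMode, assocCoeffSwap_piMode, (hY i).comm a b N hN]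
  · choose F hF0 hF using fun i => (hY i).assoc a b N hN t (w i)
    refine ⟨Finset.univ.biUnion F, fun p hp => funext fun i => ?_, fun k => funext fun i => ?_⟩
    · rw [assocCoeff_piMode]
      exact hF0 i p fun h => hp (Finset.mem_biUnion.mpr ⟨i, Finset.mem_univ i, h⟩)
    · rw [piMode_apply, hF i k, Finset.sum_apply]
      simp only [Pi.smul_apply, assocCoeff_piMode]
      refine Finset.sum_subset
        (fun p hp => Finset.mem_biUnion.mpr ⟨i, Finset.mem_univ i, hp⟩) fun p _ hp => ?_
      rw [hF0 i p hp, smul_zero]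

end AssociativeFamily

/-! ### Recovering single coefficients, and the span of single modes -/

section Interpolation

variable {M : Type v} [AddCommGroup M] [Module ℂ M]

theorem mul_choose_eq (x : ℚ) (k : ℕ) :
    x * Ring.choose x k = (k + 1) * Ring.choose x (k + 1) + k * Ring.choose x k := by
  have h := Ring.choose_smul_choose x (Nat.le_add_right k 1)
  rw [Nat.add_sub_cancel_left, Ring.choose_one_right, Nat.choose_succ_self_right, nsmul_eq_mul] at h
  push_cast at h
  linear_combination -h

open Polynomial in
-- Since x·C(x, k) is a combination of C(x, k+1) and C(x, k), the weights C(-p-1, k) can be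
-- multiplied by any polynomial in -p-1. A polynomial that vanishes at all nodes but one isolates
-- the corresponding coefficient.
theorem mem_of_sum_choose_smul_mem (U : Submodule ℂ M) (F : Finset ℚ) (c : ℚ → M)
    (h : ∀ k : ℕ, ∑ p ∈ F, ((Ring.choose (-p - 1) k : ℚ) : ℂ) • c p ∈ U) :
    ∀ p ∈ F, c p ∈ U := by
  classical
  have key : ∀ (P : ℚ[X]) (k : ℕ),
      ∑ p ∈ F, ((P.eval (-p - 1) * Ring.choose (-p - 1) k : ℚ) : ℂ) • c p ∈ U := fun P => by
    induction P using Polynomial.induction_on' with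
    | add P Q hP hQ =>
      intro k
      have := U.add_mem (hP k) (hQ k)
      rw [← Finset.sum_add_distrib] at this
      convert this using 2 with p
      rw [eval_add, add_mul, ← add_smul, Rat.cast_add]
    | monomial n t =>
      induction n with
      | zero =>
        intro k
        have := U.smul_mem (t : ℂ) (h k)
        rw [Finset.smul_sum] at this
        convert this using 2 with p
        rw [smul_smul, monomial_zero_left, eval_C, Rat.cast_mul]
      | succ n ih =>
        intro k
        have := U.add_mem (U.smul_mem ((k : ℂ) + 1) (ih (k + 1))) (U.smul_mem (k : ℂ) (ih k))
        rw [Finset.smul_sum, Finset.smul_sum, ← Finset.sum_add_distrib] at this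
        convert this using 2 with p
        rw [smul_smul, smul_smul, ← add_smul, eval_monomial, eval_monomial, pow_succ, mul_assoc,
          mul_assoc, mul_choose_eq]
        congr 1
        push_cast
        ring
  intro p hp
  let P : ℚ[X] := ∏ x ∈ F.erase p, (X - C (-x - 1))
  have h1 := key P 0
  rw [Finset.sum_eq_single_of_mem p hp] at h1
  · refine (U.smul_mem_iff ?_).mp h1
    rw [Ring.choose_zero_right, mul_one, Rat.cast_ne_zero, eval_prod, Finset.prod_ne_zero_iff]
    intro x hx
    have := Finset.ne_of_mem_erase hx
    simp only [eval_sub, eval_X, eval_C]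
    intro h0
    exact this (by linarith)
  · intro x hx hne
    rw [eval_prod, Finset.prod_eq_zero (Finset.mem_erase.mpr ⟨hne, hx⟩), zero_mul, Rat.cast_zero,
      zero_smul]
    simp

end Interpolation

/-- The span of all `a_n x`. -/
def modeSpan {V : Type u} [AddCommGroup V] [Module ℂ V] {M : Type v} [AddCommGroup M] [Module ℂ M]
    (Y : ModeFamily ℚ V M) (x : M) : Submodule ℂ M :=
  Submodule.span ℂ (Set.range fun p : ℚ × V => Y p.1 p.2 x)

theorem mode_mem_modeSpan {V : Type u} [AddCommGroup V] [Module ℂ V] {M : Type v} [AddCommGroup M]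
    [Module ℂ M] (Y : ModeFamily ℚ V M) (x : M) (n : ℚ) (a : V) :
    Y n a x ∈ modeSpan Y x := Submodule.subset_span ⟨(n, a), rfl⟩

section Span

variable {V : Type u} [AddCommGroup V] [Module ℂ V] [VertexAlgebra V] {G : Subgroup (Aut V)}
  {M : Type v} [AddCommGroup M] [Module ℂ M] {Y : ModeFamily ℚ V M}

theorem IsAssociativeFamily.self_mem_modeSpan (hY : IsAssociativeFamily G Y) (x : M) :
    x ∈ modeSpan Y x := by
  have h := mode_mem_modeSpan Y x (-1) (VertexAlgebra.vac : V)
  rwa [hY.vac, if_pos rfl] at h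

/-- Associativity writes the modes of the products a_l b as binomial sums of coefficients of (y -
x)^N Y(a, y)Y(b, x), and interpolation puts each such coefficient into the span. The factor (y -
x)^N is then removed one mode at a time. -/
theorem IsAssociativeFamily.mode_mode_mem_modeSpan [Finite G] (hY : IsAssociativeFamily G Y)
    (x : M) (a b : V) (p q : ℚ) : Y p a (Y q b x) ∈ modeSpan Y x := by
  obtain ⟨N, hN⟩ := exists_locality_bound G a b
  obtain ⟨Q, hQ⟩ := hY.trunc b x
  have hmem : ∀ p q : ℚ, assocCoeff Y N a b p q x ∈ modeSpan Y x := fun p q => by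
    obtain ⟨F, hF0, hF⟩ := hY.assoc a b N hN (p + q) x
    have h := mem_of_sum_choose_smul_mem (modeSpan Y x) F _ fun k => by
      rw [← hF k]
      exact mode_mem_modeSpan Y x _ _
    by_cases hp : p ∈ F
    · simpa using h p hp
    · have h0 := hF0 p hp
      rw [add_sub_cancel_left] at h0
      rw [h0]
      exact zero_mem _
  -- Descending induction on `q`, starting where b_q x = 0. In the coefficient at (p - N, q) the
  -- term i = 0 is a_p b_q x, and all others involve b_{q+i} x with i > 0.
  have key : ∀ (j : ℕ) (q : ℚ), Q - j ≤ q → ∀ p, Y p a (Y q b x) ∈ modeSpan Y x := fun j => by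
    induction j with
    | zero =>
      intro q hq p
      rw [hQ q (by simpa using hq), map_zero]
      exact zero_mem _
    | succ j ih =>
      intro q hq p
      have h := hmem (p - N) q
      rw [assocCoeff_apply, Finset.sum_range_succ'] at h
      have h1 := (Submodule.add_mem_iff_right _ (Submodule.sum_mem _ fun i _ =>
        Submodule.smul_mem _ _ (ih (q + ((i + 1 : ℕ) : ℚ)) ?_ _))).mp h
      · simpa using h1
      · push_cast at hq ⊢
        have : (0 : ℚ) ≤ i := by positivity
        linarith
  obtain ⟨j, hj⟩ := exists_nat_ge (Q - q)
  exact key j q (by linarith) p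

theorem IsAssociativeFamily.isInvariant_modeSpan [Finite G] (hY : IsAssociativeFamily G Y)
    (x : M) : IsInvariant Y (modeSpan Y x) := by
  intro n a y hy
  induction hy using Submodule.span_induction with
  | zero => rw [map_zero]; exact zero_mem _
  | add y z _ _ hy hz => rw [map_add]; exact add_mem hy hz
  | smul c y _ hy => rw [map_smul]; exact Submodule.smul_mem _ _ hy
  | mem y hy =>
    obtain ⟨⟨q, b⟩, rfl⟩ := hy
    exact hY.mode_mode_mem_modeSpan x a b n q

end Span

/-! ### Linear independence of intertwining maps -/

section TwoSided

variable {V : Type u} [AddCommGroup V] [Module ℂ V] [VertexAlgebra V]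

/-- The left and right multiplications of a vertex algebra. -/
def twoSidedMode (V : Type u) [AddCommGroup V] [Module ℂ V] [VertexAlgebra V] :
    ModeFamily (ℤ ⊕ ℤ) V V :=
  Sum.elim (fun n => mode n) fun n => (mode n).flip

theorem VertexAlgebra.IsSimple.isIrreducibleModule (h : VertexAlgebra.IsSimple V) :
    IsIrreducibleModule (twoSidedMode V) :=
  ⟨h.1, fun N hN => h.2 N fun n a b hb => ⟨hN (Sum.inl n) a b hb, hN (Sum.inr n) a b hb⟩⟩

end TwoSided

section Relations

variable {V : Type u} [AddCommGroup V] [Module ℂ V] [VertexAlgebra V] {G : Subgroup (Aut V)}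
  {M : Type v} [AddCommGroup M] [Module ℂ M] {L : Type w} [AddCommGroup L] [Module ℂ L]
  {H : Type u₁} [Fintype H]

/-- The relations `∑ (v_σ)_n ψ_σ = 0`, valid for all `n`. -/
def modeRelations (Y : ModeFamily ℚ V M) (ψ : H → L →ₗ[ℂ] M) : Submodule ℂ (H → V) where
  carrier := {v | ∀ (n : ℚ) (x : L), ∑ σ, Y n (v σ) (ψ σ x) = 0}
  add_mem' hv hv' n x := by simp [Finset.sum_add_distrib, hv n x, hv' n x]
  zero_mem' n x := by simp
  smul_mem' c v hv n x := by simp [← Finset.smul_sum, hv n x]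

variable {Y : ModeFamily ℚ V M}

/-- The weights in the associativity formula depend only on the exponent and on `l`, not on `i`.
Over a common finite set of exponents the sum over `i` can therefore be taken first. -/
theorem IsAssociativeFamily.sum_mode_mode_eq_zero (hY : IsAssociativeFamily G Y) {a b : H → V}
    {x : H → M} {N : ℕ} (hN : ∀ i, ∀ σ ∈ G, ∀ n : ℤ, N ≤ n → mode n (σ • a i) (b i) = 0)
    (h : ∀ p q : ℚ, ∑ i, assocCoeff Y N (a i) (b i) p q (x i) = 0) (l : ℤ) (n : ℚ) :
    ∑ i, Y n (mode l (a i) (b i)) (x i) = 0 := by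
  classical
  rcases le_or_gt (N : ℤ) l with hl | hl
  · refine Finset.sum_eq_zero fun i _ => ?_
    have h1 := hN i 1 (one_mem G) l hl
    rw [one_smul] at h1
    rw [h1, map_zero, LinearMap.zero_apply]
  · obtain ⟨k, hk⟩ : ∃ k : ℕ, l = N - 1 - k := ⟨(N - 1 - l).toNat, by lia⟩
    obtain ⟨t, ht⟩ : ∃ t : ℚ, n = t + k + 1 := ⟨n - k - 1, by ring⟩
    subst hk ht
    choose F hF0 hF using fun i => hY.assoc (a i) (b i) N (hN i) t (x i)
    have h1 : ∀ i, Y (t + k + 1) (mode (N - 1 - k) (a i) (b i)) (x i) =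
        ∑ p ∈ Finset.univ.biUnion F,
          ((Ring.choose (-p - 1) k : ℚ) : ℂ) • assocCoeff Y N (a i) (b i) p (t - p) (x i) :=
      fun i => by
        rw [hF i k]
        refine Finset.sum_subset
          (fun p hp => Finset.mem_biUnion.mpr ⟨i, Finset.mem_univ i, hp⟩) fun p _ hp => ?_
        rw [hF0 i p hp, smul_zero]
    rw [Finset.sum_congr rfl fun i _ => h1 i, Finset.sum_comm]
    refine Finset.sum_eq_zero fun p _ => ?_
    rw [← Finset.smul_sum, h, smul_zero]

theorem exists_uniform_locality_bound [Finite G] (a b : H → V) :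
    ∃ N : ℕ, ∀ i, ∀ σ ∈ G, ∀ n : ℤ, N ≤ n → mode n (σ • a i) (b i) = 0 := by
  choose N hN using fun i => exists_locality_bound G (a i) (b i)
  refine ⟨Finset.univ.sup N, fun i σ hσ n hn => hN i σ hσ n ?_⟩
  have : N i ≤ Finset.univ.sup N := Finset.le_sup (Finset.mem_univ i)
  lia

/-- In Y(a, y)Y(v_σ, x)ψ_σ the relation can be applied innermost, so all coefficients already sum to
zero. -/
theorem IsAssociativeFamily.mode_left_mem_modeRelations [Finite G]
    (hY : IsAssociativeFamily G Y) {ψ : H → L →ₗ[ℂ] M} {v : H → V} (hv : v ∈ modeRelations Y ψ)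
    (l : ℤ) (a : V) : (fun σ => mode l a (v σ)) ∈ modeRelations Y ψ := fun n x => by
  obtain ⟨N, hN⟩ := exists_uniform_locality_bound (G := G) (fun _ => a) v
  refine hY.sum_mode_mode_eq_zero hN (fun p q => ?_) l n
  simp only [assocCoeff_apply]
  rw [Finset.sum_comm]
  refine Finset.sum_eq_zero fun i _ => ?_
  rw [← Finset.smul_sum, ← map_sum, hv, map_zero, smul_zero]

/-- Now v_σ stands on the outside; commutativity moves it inside, where the relation applies. -/
theorem IsAssociativeFamily.mode_right_mem_modeRelations [Finite G]
    (hY : IsAssociativeFamily G Y) {ψ : H → L →ₗ[ℂ] M} {v : H → V} (hv : v ∈ modeRelations Y ψ)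
    (l : ℤ) (a : V) : (fun σ => mode l (v σ) a) ∈ modeRelations Y ψ := fun n x => by
  obtain ⟨N, hN⟩ := exists_uniform_locality_bound (G := G) v fun _ => a
  refine hY.sum_mode_mode_eq_zero hN (fun p q => ?_) l n
  rw [Finset.sum_congr rfl fun i _ => hY.comm (v i) a N (hN i) p q (ψ i x)]
  simp only [assocCoeffSwap_apply]
  rw [← Finset.smul_sum, Finset.sum_comm, Finset.sum_eq_zero, smul_zero]
  intro i _
  rw [← Finset.smul_sum, ← map_sum, hv, map_zero, smul_zero]

/-- An analogue of Dedekind's independence of characters. A linear dependence is a relation with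
entries multiples of the vacuum, so the two-sided stable space of relations is nonzero. A relation
of minimal support is analysed with simplicity of V and Schur's lemma, and the intertwining property
then reduces its support to one element. -/
theorem eq_zero_of_sum_smul_intertwiner_eq_zero (hsimple : VertexAlgebra.IsSimple V)
    (hV : Module.rank ℂ V ≤ Cardinal.aleph0) [Finite G] [Nontrivial L]
    (hY : IsAssociativeFamily G Y) {YL : ModeFamily ℚ V L} {s : H → Aut V}
    (hs : Function.Injective s) {ψ : H → L →ₗ[ℂ] M} (hψ : ∀ σ, Function.Injective (ψ σ))
    (hint : ∀ σ n a x, ψ σ (YL n a x) = Y n (s σ • a) (ψ σ x)) {c : H → ℂ}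
    (hc : ∀ x, ∑ σ, c σ • ψ σ x = 0) : c = 0 := by
  classical
  by_contra hc0
  have hV0 := hsimple.1
  have hvac : (vac : V) ≠ 0 := by
    intro h
    obtain ⟨a, ha⟩ := exists_ne (0 : V)
    have h1 := vac_mode (-1) a
    rw [h, map_zero, LinearMap.zero_apply, if_pos rfl] at h1
    exact ha h1.symm
  have hvacrel : ∀ d : H → ℂ, (fun σ => d σ • (vac : V)) ∈ modeRelations Y ψ ↔
      ∀ x, ∑ σ, d σ • ψ σ x = 0 := fun d => by
    refine ⟨fun h x => ?_, fun h n x => ?_⟩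
    · have := h (-1) x
      simpa only [LinearMap.map_smul₂, hY.vac, if_pos] using this
    · simp only [LinearMap.map_smul₂, hY.vac]
      split_ifs
      · exact h x
      · simp
  let supp : (H → V) → Finset H := fun v => Finset.univ.filter fun σ => v σ ≠ 0
  obtain ⟨v₀, ⟨hv₀, hv₀0⟩, hmin⟩ := WellFounded.has_min
    (InvImage.wf (fun v => (supp v).card) (Nat.lt_wfRel.wf))
    {v | v ∈ modeRelations Y ψ ∧ v ≠ 0} ⟨fun σ => c σ • (vac : V), (hvacrel c).mpr hc, fun h => by
      refine hc0 (funext fun σ => ?_)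
      have := congrFun h σ
      simpa [hvac] using this⟩
  let K : Submodule ℂ (H → V) := modeRelations Y ψ ⊓
    { carrier := {v | ∀ σ, v₀ σ = 0 → v σ = 0}
      add_mem' := fun h h' σ hσ => by rw [Pi.add_apply, h σ hσ, h' σ hσ, add_zero]
      zero_mem' := fun _ _ => rfl
      smul_mem' := fun c v h σ hσ => by rw [Pi.smul_apply, h σ hσ, smul_zero] }
  -- By minimality, a relation supported in the support of `v₀` that vanishes at one more place is
  -- zero. So the projection of `K` to such a coordinate is injective; its image is a nonzero ideal,
  -- hence all of V.
  have hinj : ∀ σ, v₀ σ ≠ 0 → ∀ v ∈ K, v σ = 0 → v = 0 := fun σ hσ v hv h0 => by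
    by_contra hne
    refine hmin v ⟨hv.1, hne⟩ (Finset.card_lt_card ?_)
    rw [Finset.ssubset_iff_of_subset]
    · exact ⟨σ, by simpa [supp] using hσ, by simpa [supp] using h0⟩
    · intro ρ hρ
      simp only [supp, Finset.mem_filter, Finset.mem_univ, true_and] at hρ ⊢
      exact fun h => hρ (hv.2 ρ h)
  have hKl : ∀ v ∈ K, ∀ l a, (fun σ => mode l a (v σ)) ∈ K := fun v hv l a =>
    ⟨hY.mode_left_mem_modeRelations hv.1 l a, fun σ hσ => by
      change mode l a (v σ) = 0
      rw [hv.2 σ hσ, map_zero]⟩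
  have hKr : ∀ v ∈ K, ∀ l a, (fun σ => mode l (v σ) a) ∈ K := fun v hv l a =>
    ⟨hY.mode_right_mem_modeRelations hv.1 l a, fun σ hσ => by
      change mode l (v σ) a = 0
      rw [hv.2 σ hσ, map_zero, LinearMap.zero_apply]⟩
  obtain ⟨τ, hτ⟩ : ∃ τ, v₀ τ ≠ 0 := by
    by_contra hcon
    push Not at hcon
    exact hv₀0 (funext hcon)
  have hv₀K : v₀ ∈ K := ⟨hv₀, fun _ h => h⟩
  let pr : H → K →ₗ[ℂ] V := fun σ => LinearMap.proj σ ∘ₗ K.subtype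
  have hprinj : Function.Injective (pr τ) := by
    rw [← LinearMap.ker_eq_bot, LinearMap.ker_eq_bot']
    exact fun v hv => Subtype.ext (hinj τ hτ v v.2 hv)
  have hprsurj : Function.Surjective (pr τ) := by
    rw [← LinearMap.range_eq_top]
    refine (hsimple.2 (LinearMap.range (pr τ)) ?_).resolve_left fun h => ?_
    · rintro n a _ ⟨v, rfl⟩
      exact ⟨⟨⟨_, hKl v v.2 n a⟩, rfl⟩, ⟨⟨_, hKr v v.2 n a⟩, rfl⟩⟩
    · exact hτ ((LinearMap.range_eq_bot.mp h) ▸ rfl : pr τ ⟨v₀, hv₀K⟩ = 0)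
  let e := LinearEquiv.ofBijective (pr τ) ⟨hprinj, hprsurj⟩
  -- Passing from the coordinate τ to the coordinate σ is an endomorphism of V commuting with left
  -- and right products, hence a scalar. So `K` consists of the vectors (d_σ a) with a ∈ V.
  have hschur : ∀ σ, ∃ d : ℂ, ∀ a, pr σ (e.symm a) = d • a := fun σ => by
    refine hsimple.isIrreducibleModule.schur hV (pr σ ∘ₗ e.symm.toLinearMap) ?_
    rintro (n | n) a b
    · have h1 : e.symm (mode n a b) = ⟨_, hKl (e.symm b) (e.symm b).2 n a⟩ := by
        rw [LinearEquiv.symm_apply_eq]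
        change _ = mode n a (e (e.symm b))
        rw [e.apply_symm_apply]
      change pr σ (e.symm (mode n a b)) = mode n a (pr σ (e.symm b))
      rw [h1]
      rfl
    · have h1 : e.symm (mode n b a) = ⟨_, hKr (e.symm b) (e.symm b).2 n a⟩ := by
        rw [LinearEquiv.symm_apply_eq]
        change _ = mode n (e (e.symm b)) a
        rw [e.apply_symm_apply]
      change pr σ (e.symm (mode n b a)) = mode n (pr σ (e.symm b)) a
      rw [h1]
      rfl
  choose d hd using hschur
  have hK : ∀ v ∈ K, ∀ σ, v σ = d σ • v τ := fun v hv σ => by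
    have h1 : e.symm (v τ) = ⟨v, hv⟩ := by
      rw [LinearEquiv.symm_apply_eq]
      rfl
    rw [← hd, h1]
    rfl
  have hd0 : ∀ σ, v₀ σ = 0 → d σ = 0 := fun σ hσ => by
    have h := hK v₀ hv₀K σ
    rw [hσ] at h
    exact (smul_eq_zero.mp h.symm).resolve_right hτ
  have hdτ : d τ = 1 := by
    have h := hK v₀ hv₀K τ
    exact (smul_left_injective ℂ hτ ((one_smul ℂ _).trans h)).symm
  have hdrel : ∀ x, ∑ σ, d σ • ψ σ x = 0 := by
    rw [← hvacrel]
    have h : (fun σ => d σ • (vac : V)) = (e.symm vac : H → V) := funext fun σ => (hd σ vac).symm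
    rw [h]
    exact (e.symm vac).2.1
  -- Applying ∑ d_σ ψ_σ = 0 to a_n x gives the relation (d_σ s_σ a). Since it lies in `K`,
  -- comparison with the coordinate τ yields d_σ s_σ a = d_σ s_τ a for every `a`.
  have heq : ∀ σ, v₀ σ ≠ 0 → σ = τ := fun σ hσ => by
    refine hs (Subtype.ext (LinearEquiv.ext fun a => ?_))
    have hmem : (fun ρ => d ρ • (s ρ • a)) ∈ K := by
      refine ⟨fun n x => ?_, fun ρ hρ => ?_⟩
      · have h := hdrel (YL n a x)
        simpa only [hint, LinearMap.map_smul₂] using h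
      · change d ρ • (s ρ • a) = 0
        rw [hd0 ρ hρ, zero_smul]
    have h := hK _ hmem σ
    simp only [hdτ, one_smul] at h
    refine (smul_right_injective V (fun h0 => hσ ?_) h :)
    rw [hK v₀ hv₀K σ, h0, zero_smul]
  obtain ⟨x, hx⟩ := exists_ne (0 : L)
  have h := hdrel x
  rw [Finset.sum_eq_single_of_mem τ (Finset.mem_univ τ), hdτ, one_smul] at h
  · exact hx (hψ τ (h.trans (map_zero _).symm))
  · intro σ _ hne
    rw [hd0 σ (by_contra fun h => hne (heq σ h)), zero_smul]

end Relations

/-! ### Modules over the algebra of a finite `G`-set and a `2`-cocycle -/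

namespace TwistedAlgebra

section Basics

variable {G : Type u} {X : Type w} [Group G] [MulAction G X] [Fintype X] (α : Cocycle G X)

open Classical in
theorem basis_mul_basis (σ τ : G) (x y : X) : basis α (σ, x) * basis α (τ, y) =
    if x = τ • y then (α.toFun y σ τ : ℂ) • basis α (σ * τ, y) else 0 :=
  mulLin_basis α (σ, x) (τ, y)

theorem basis_mul_basis_of_eq {σ τ : G} {x y : X} (h : x = τ • y) :
    basis α (σ, x) * basis α (τ, y) = (α.toFun y σ τ : ℂ) • basis α (σ * τ, y) := by
  rw [basis_mul_basis, if_pos h]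

theorem basis_mul_basis_of_ne {σ τ : G} {x y : X} (h : x ≠ τ • y) :
    basis α (σ, x) * basis α (τ, y) = 0 := by
  rw [basis_mul_basis, if_neg h]

/-- The idempotent `e(x)`. -/
def idem (x : X) : TwistedAlgebra α := ((α.toFun x 1 1)⁻¹ : ℂˣ).val • basis α (1, x)

theorem sum_idem : ∑ x, idem α x = 1 := rfl

theorem idem_mul_basis_self (σ : G) (x : X) : idem α (σ • x) * basis α (σ, x) = basis α (σ, x) := by
  rw [idem, smul_mul_assoc, basis_mul_basis_of_eq α rfl, one_mul, cocycle_one_left, smul_smul]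
  simp

theorem idem_mul_basis_of_ne {σ : G} {x y : X} (h : y ≠ σ • x) :
    idem α y * basis α (σ, x) = 0 := by
  rw [idem, smul_mul_assoc, basis_mul_basis_of_ne α h, smul_zero]

theorem basis_mul_idem_self (σ : G) (x : X) : basis α (σ, x) * idem α x = basis α (σ, x) := by
  rw [idem, mul_smul_comm, basis_mul_basis_of_eq α (one_smul G x).symm, mul_one,
    cocycle_one_right α x σ, smul_smul]
  simp

theorem basis_mul_idem_of_ne {σ : G} {x y : X} (h : x ≠ y) : basis α (σ, x) * idem α y = 0 := by
  rw [idem, mul_smul_comm, basis_mul_basis_of_ne α (by rwa [one_smul]), smul_zero]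

/-- The inverse of `σ ⊗ e(x)` in the groupoid sense. -/
def basisInv (σ : G) (x : X) : TwistedAlgebra α :=
  ((α.toFun x σ⁻¹ σ * α.toFun x 1 1)⁻¹ : ℂˣ).val • basis α (σ⁻¹, σ • x)

theorem basisInv_mul_basis (σ : G) (x : X) : basisInv α σ x * basis α (σ, x) = idem α x := by
  rw [basisInv, smul_mul_assoc, basis_mul_basis_of_eq α rfl, smul_smul, inv_mul_cancel, idem]
  congr 1
  simp

theorem basis_mul_basisInv (σ : G) (x : X) :
    basis α (σ, x) * basisInv α σ x = idem α (σ • x) := by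
  have h := α.cocycle x σ σ⁻¹ σ
  rw [inv_mul_cancel, mul_inv_cancel, cocycle_one_right, ← cocycle_one_left] at h
  rw [basisInv, mul_smul_comm, basis_mul_basis_of_eq α (inv_smul_smul σ x).symm, smul_smul,
    mul_inv_cancel, idem, mul_comm (α.toFun x σ⁻¹ σ), ← h]
  congr 1
  rw [← Units.val_mul]
  congr 1
  group

theorem idem_mul_basisInv (σ : G) (x : X) : idem α x * basisInv α σ x = basisInv α σ x := by
  have h := idem_mul_basis_self α σ⁻¹ (σ • x)
  rw [inv_smul_smul] at h
  rw [basisInv, mul_smul_comm, h]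

theorem basisInv_mul_idem (σ : G) (x : X) :
    basisInv α σ x * idem α (σ • x) = basisInv α σ x := by
  rw [basisInv, smul_mul_assoc, basis_mul_idem_self]

theorem basis_mul_basisInv_of_ne {σ τ : G} {x y : X} (h : y ≠ x) :
    basis α (τ, y) * basisInv α σ x = 0 := by
  rw [basisInv, mul_smul_comm, basis_mul_basis_of_ne α (by rwa [inv_smul_smul]), smul_zero]

/-- This is τ(στ)⁻¹ = σ⁻¹ with its cocycle factor. The same factor arises from (σ ⊗ e(τy))(τ ⊗
e(y)), so the substitution σ ↦ στ in the average is consistent. -/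
theorem basis_mul_basisInv_mul (σ τ : G) (y : X) :
    basis α (τ, y) * basisInv α (σ * τ) y =
      (α.toFun y σ τ : ℂ) • basisInv α σ (τ • y) := by
  have h1 : basisInv α σ (τ • y) * (basis α (σ, τ • y) * basis α (τ, y)) = basis α (τ, y) := by
    rw [← mul_assoc, basisInv_mul_basis, idem_mul_basis_self]
  rw [basis_mul_basis_of_eq α rfl, mul_smul_comm] at h1
  rw [← h1, smul_mul_assoc, mul_assoc, basis_mul_basisInv, mul_smul, basisInv_mul_idem]

instance [Finite G] : Module.Finite ℂ (TwistedAlgebra α) := Module.Finite.of_basis (basis α)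

end Basics

/-! ### Semisimplicity by averaging over the groupoid -/

section Maschke

variable {G : Type u} {X : Type w} [Group G] [MulAction G X] [Fintype X] (α : Cocycle G X)
  {N : Type v} [AddCommGroup N] [Module ℂ N] [Module (TwistedAlgebra α) N]

/-- The average of a linear map over the groupoid. -/
def average [Fintype G] (f : N →ₗ[ℂ] N) (n : N) : N :=
  (Fintype.card G : ℂ)⁻¹ • ∑ x : X, ∑ σ : G, basisInv α σ x • f (basis α (σ, x) • n)

theorem average_add [Fintype G] (f : N →ₗ[ℂ] N) (m n : N) :
    average α f (m + n) = average α f m + average α f n := by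
  simp only [average, smul_add, map_add, Finset.sum_add_distrib]

variable [IsScalarTower ℂ (TwistedAlgebra α) N]

theorem average_smul [Fintype G] (f : N →ₗ[ℂ] N) (a : TwistedAlgebra α) (n : N) :
    average α f (a • n) = a • average α f n := by
  have hcomm : SMulCommClass ℂ (TwistedAlgebra α) N := IsScalarTower.to_smulCommClass
  induction a using induction with
  | h0 => simp [average]
  | hadd a b ha hb => rw [add_smul, average_add, ha, hb, add_smul]
  | hsmul c a ha =>
    rw [smul_assoc, smul_assoc, ← ha]
    simp only [average, smul_comm _ c, map_smul, ← Finset.smul_sum]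
  | hb p =>
    obtain ⟨τ, y⟩ := p
    simp only [average]
    rw [smul_comm (basis α (τ, y))]
    congr 1
    rw [Finset.sum_eq_single_of_mem (τ • y) (Finset.mem_univ _), Finset.smul_sum,
      Finset.sum_eq_single_of_mem y (Finset.mem_univ _), Finset.smul_sum]
    · refine Fintype.sum_equiv (Equiv.mulRight τ) _ _ fun σ => ?_
      rw [Equiv.coe_mulRight, ← mul_smul (basis α (τ, y)), basis_mul_basisInv_mul, ← mul_smul,
        basis_mul_basis_of_eq α rfl, smul_assoc, smul_assoc, map_smul, smul_comm]
    · intro x _ hx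
      rw [Finset.smul_sum]
      refine Finset.sum_eq_zero fun σ _ => ?_
      rw [← mul_smul, basis_mul_basisInv_of_ne α hx.symm, zero_smul]
    · intro x _ hx
      refine Finset.sum_eq_zero fun σ _ => ?_
      rw [← mul_smul, basis_mul_basis_of_ne α hx, zero_smul, map_zero, smul_zero]

/-- Maschke's argument: the average of a ℂ-linear projection onto a submodule is an 𝒜-linear
projection. On the submodule each σ contributes ∑ e(x) = 1, which the factor 1/|G| normalizes. -/
theorem isSemisimpleModule [Finite G] : IsSemisimpleModule (TwistedAlgebra α) N := by
  have := Fintype.ofFinite G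
  suffices ComplementedLattice (Submodule (TwistedAlgebra α) N) from { }
  refine ⟨fun P => ?_⟩
  obtain ⟨f, hf⟩ := (P.restrictScalars ℂ).subtype.exists_leftInverse_of_injective
    (Submodule.ker_subtype _)
  let f' : N →ₗ[ℂ] N := (P.restrictScalars ℂ).subtype ∘ₗ f
  have hf' : ∀ n ∈ P, f' n = n := fun n hn =>
    congrArg Subtype.val (LinearMap.congr_fun hf ⟨n, hn⟩)
  have hmem : ∀ n, average α f' n ∈ P := fun n => by
    refine (P.restrictScalars ℂ).smul_mem _ (Submodule.sum_mem _ fun x _ =>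
      Submodule.sum_mem _ fun σ _ => P.smul_mem _ (f _).2)
  have hid : ∀ n ∈ P, average α f' n = n := fun n hn => by
    rw [average]
    have h1 : ∀ x : X, ∀ σ : G, basisInv α σ x • f' (basis α (σ, x) • n) = idem α x • n :=
      fun x σ => by
        rw [hf' _ (P.smul_mem _ hn), ← mul_smul, basisInv_mul_basis]
    simp only [h1, Finset.sum_const, ← Finset.smul_sum]
    rw [← Finset.sum_smul, sum_idem, one_smul, Finset.card_univ, ← Nat.cast_smul_eq_nsmul ℂ,
      inv_smul_smul₀]
    exact_mod_cast Fintype.card_ne_zero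
  exact ⟨_, LinearMap.isCompl_of_proj (f := (
    { toFun := fun n => ⟨average α f' n, hmem n⟩
      map_add' := fun m n => Subtype.ext (average_add α f' m n)
      map_smul' := fun a n => Subtype.ext (average_smul α f' a n) } :
        N →ₗ[TwistedAlgebra α] P)) fun n => Subtype.ext (hid n n.2)⟩

instance [Finite G] : IsSemisimpleRing (TwistedAlgebra α) := isSemisimpleModule α

end Maschke

end TwistedAlgebra

namespace TwistedAlgebra

/-! ### Corners and induced modules -/

section Corner

theorem stabInclusion_basis {G : Type u} {X : Type w} [Group G] [MulAction G X] (α : Cocycle G X) (x : X)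
    (σ : MulAction.stabilizer G x) :
    stabInclusion α x (basis (α.restrict x) (σ, PUnit.unit)) = basis α ((σ : G), x) := by
  rw [stabInclusion, Module.Basis.constr_basis]

variable {G : Type u} {X : Type w} [Group G] [MulAction G X] [Fintype X] (α : Cocycle G X) (x : X)

theorem stabInclusion_mul (s t : StabAlgebra α x) :
    stabInclusion α x (s * t) = stabInclusion α x s * stabInclusion α x t := by
  induction s using induction with
  | h0 => simp
  | hadd s s' h h' => simp [add_mul, h, h']
  | hsmul c s h => simp [h]
  | hb p =>
  induction t using induction with
  | h0 => simp
  | hadd s s' h h' => simp [mul_add, h, h']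
  | hsmul c s h => simp [h]
  | hb q =>
  obtain ⟨σ, ⟨⟩⟩ := p
  obtain ⟨τ, ⟨⟩⟩ := q
  rw [basis_mul_basis_of_eq _ rfl, map_smul, stabInclusion_basis, stabInclusion_basis,
    stabInclusion_basis, basis_mul_basis_of_eq α (MulAction.mem_stabilizer_iff.mp τ.2).symm]
  rfl

theorem stabInclusion_one : stabInclusion α x 1 = idem α x := by
  rw [← sum_idem, Fintype.sum_unique, idem, map_smul, stabInclusion_basis]
  rfl

open Classical in
/-- The projection of `A_α(G, X)` to `S(x)` that kills the other basis elements. -/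
def stabProjection : TwistedAlgebra α →ₗ[ℂ] StabAlgebra α x :=
  (basis α).constr ℂ fun p =>
    if h : p.1 ∈ MulAction.stabilizer G x ∧ p.2 = x then
      basis (α.restrict x) (⟨p.1, h.1⟩, PUnit.unit) else 0

theorem stabProjection_basis {σ : G} (h : σ ∈ MulAction.stabilizer G x) :
    stabProjection α x (basis α (σ, x)) = basis (α.restrict x) (⟨σ, h⟩, PUnit.unit) := by
  rw [stabProjection, Module.Basis.constr_basis, dif_pos ⟨h, rfl⟩]

theorem stabProjection_basis_of_not {σ : G} {y : X}
    (h : ¬ (σ ∈ MulAction.stabilizer G x ∧ y = x)) : stabProjection α x (basis α (σ, y)) = 0 := by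
  rw [stabProjection, Module.Basis.constr_basis, dif_neg h]

theorem stabProjection_stabInclusion (s : StabAlgebra α x) :
    stabProjection α x (stabInclusion α x s) = s := by
  induction s using induction with
  | h0 => simp
  | hadd s s' h h' => simp [h, h']
  | hsmul c s h => simp [h]
  | hb p =>
    obtain ⟨σ, ⟨⟩⟩ := p
    rw [stabInclusion_basis, stabProjection_basis α x σ.2]

/-- This is the equality of e(x)𝒜e(x) with the twisted group algebra: compression by e(x) keeps
exactly the σ ⊗ e(x) with σx = x. -/
theorem idem_mul_mul_idem (a : TwistedAlgebra α) :
    idem α x * a * idem α x = stabInclusion α x (stabProjection α x a) := by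
  induction a using induction with
  | h0 => simp
  | hadd s s' h h' => simp [mul_add, add_mul, h, h']
  | hsmul c s h => simp [h]
  | hb p =>
    obtain ⟨σ, y⟩ := p
    by_cases hy : y = x
    · subst hy
      rw [mul_assoc, basis_mul_idem_self]
      by_cases hσ : σ ∈ MulAction.stabilizer G y
      · have h := idem_mul_basis_self α σ y
        rw [MulAction.mem_stabilizer_iff.mp hσ] at h
        rw [stabProjection_basis α y hσ, stabInclusion_basis, h]
      · rw [stabProjection_basis_of_not α y fun h => hσ h.1, map_zero]
        exact idem_mul_basis_of_ne α fun h => hσ (MulAction.mem_stabilizer_iff.mpr h.symm)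
    · rw [mul_assoc, basis_mul_idem_of_ne α hy, mul_zero,
        stabProjection_basis_of_not α x fun h => hy h.2, map_zero]

theorem idem_mul_stabInclusion (s : StabAlgebra α x) :
    idem α x * stabInclusion α x s = stabInclusion α x s := by
  rw [← stabInclusion_one, ← stabInclusion_mul, one_mul]

theorem stabInclusion_mul_idem (s : StabAlgebra α x) :
    stabInclusion α x s * idem α x = stabInclusion α x s := by
  rw [← stabInclusion_one, ← stabInclusion_mul, mul_one]

theorem stabProjection_mul_stabInclusion (a : TwistedAlgebra α) (s : StabAlgebra α x) :
    stabProjection α x (a * stabInclusion α x s) = stabProjection α x a * s := by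
  have hinj : Function.Injective (stabInclusion α x) :=
    Function.LeftInverse.injective (stabProjection_stabInclusion α x)
  apply hinj
  rw [← idem_mul_mul_idem, stabInclusion_mul, ← idem_mul_mul_idem, mul_assoc (_ * a),
    idem_mul_stabInclusion, mul_assoc, mul_assoc, stabInclusion_mul_idem, mul_assoc]

theorem idem_mem_leftIdeal : idem α x ∈ leftIdeal α x := by
  rw [← stabInclusion_one]
  exact stabInclusion_mem α x 1

theorem leftIdeal_induction {P : TwistedAlgebra α → Prop} {d : TwistedAlgebra α}
    (hd : d ∈ leftIdeal α x) (hb : ∀ σ, P (basis α (σ, x))) (h0 : P 0)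
    (hadd : ∀ a b, P a → P b → P (a + b)) (hsmul : ∀ (c : ℂ) a, P a → P (c • a)) : P d := by
  change d ∈ Submodule.span ℂ (Set.range fun σ : G => basis α (σ, x)) at hd
  induction hd using Submodule.span_induction with
  | mem y hy => obtain ⟨σ, rfl⟩ := hy; exact hb σ
  | zero => exact h0
  | add a b _ _ ha hb => exact hadd a b ha hb
  | smul c a _ ha => exact hsmul c a ha

theorem mul_idem_of_mem_leftIdeal {d : TwistedAlgebra α} (hd : d ∈ leftIdeal α x) :
    d * idem α x = d := by
  refine leftIdeal_induction α x (P := fun d => d * idem α x = d) hd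
    (fun σ => basis_mul_idem_self α σ x) (zero_mul _) ?_ ?_
  · intro a b ha hb
    rw [add_mul, ha, hb]
  · intro c a ha
    rw [smul_mul_assoc, ha]

theorem idem_mul_of_mem_leftIdeal {d : TwistedAlgebra α} (hd : d ∈ leftIdeal α x) {y : X}
    (hy : y ∉ MulAction.orbit G x) : idem α y * d = 0 := by
  refine leftIdeal_induction α x (P := fun d => idem α y * d = 0) hd
    (fun σ => idem_mul_basis_of_ne α ?_) (mul_zero _) ?_ ?_
  · rintro rfl
    exact hy ⟨σ, rfl⟩
  · intro a b ha hb
    rw [mul_add, ha, hb, add_zero]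
  · intro c a ha
    rw [mul_smul_comm, ha, smul_zero]

section

variable {N : Type v} [AddCommGroup N] [Module (TwistedAlgebra α) N]

theorem exists_idem_smul_ne_zero {n : N} (hn : n ≠ 0) : ∃ y, idem α y • n ≠ 0 := by
  by_contra h
  push Not at h
  refine hn ?_
  rw [← one_smul (TwistedAlgebra α) n, ← sum_idem, Finset.sum_smul]
  exact Finset.sum_eq_zero fun y _ => h y

theorem basisInv_smul_ne_zero {σ : G} {n : N} (hn : idem α (σ • x) • n ≠ 0) :
    basisInv α σ x • n ≠ 0 := fun h => by
  refine hn ?_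
  rw [← basis_mul_basisInv, mul_smul, h, smul_zero]

end

variable (N : Type v) [AddCommGroup N] [Module ℂ N] [Module (TwistedAlgebra α) N]
  [IsScalarTower ℂ (TwistedAlgebra α) N]

/-- The subspace `e(x) N` of an `A_α(G, X)`-module `N`. -/
def corner : Submodule ℂ N where
  carrier := {n | idem α x • n = n}
  add_mem' := fun {m n} hm hn => by
    change _ • (m + n) = m + n
    rw [smul_add, hm, hn]
  zero_mem' := smul_zero (idem α x)
  smul_mem' c n hn := by
    have hcomm : SMulCommClass ℂ (TwistedAlgebra α) N := IsScalarTower.to_smulCommClass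
    change _ • c • n = c • n
    rw [smul_comm, hn]

variable {N}

theorem mem_corner {n : N} : n ∈ corner α x N ↔ idem α x • n = n := Iff.rfl

theorem stabInclusion_smul_mem_corner (s : StabAlgebra α x) (n : N) :
    stabInclusion α x s • n ∈ corner α x N := by
  rw [mem_corner, ← mul_smul, idem_mul_stabInclusion]

instance : Module (StabAlgebra α x) (corner α x N) where
  smul s n := ⟨stabInclusion α x s • (n : N), stabInclusion_smul_mem_corner α x s (n : N)⟩
  one_smul n := Subtype.ext (by
    change stabInclusion α x 1 • (n : N) = n
    rw [stabInclusion_one]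
    exact n.2)
  mul_smul s t n := Subtype.ext (by
    change stabInclusion α x (s * t) • (n : N) = stabInclusion α x s • stabInclusion α x t • (n : N)
    rw [stabInclusion_mul, mul_smul])
  smul_zero s := Subtype.ext (smul_zero (stabInclusion α x s))
  smul_add s m n := Subtype.ext (smul_add (stabInclusion α x s) (m : N) n)
  add_smul s t n := Subtype.ext (by
    change stabInclusion α x (s + t) • (n : N) =
      stabInclusion α x s • (n : N) + stabInclusion α x t • (n : N)
    rw [map_add, add_smul])
  zero_smul n := Subtype.ext (by
    change stabInclusion α x 0 • (n : N) = 0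
    rw [map_zero, zero_smul])

theorem coe_stab_smul (s : StabAlgebra α x) (n : corner α x N) :
    ((s • n : corner α x N) : N) = stabInclusion α x s • (n : N) := rfl

/-- An isomorphism of `A_α(G, X)`-modules restricts to the corners. -/
def cornerCongr {N' : Type u₁} [AddCommGroup N'] [Module ℂ N'] [Module (TwistedAlgebra α) N']
    [IsScalarTower ℂ (TwistedAlgebra α) N'] (e : N ≃ₗ[TwistedAlgebra α] N') :
    corner α x N ≃ₗ[StabAlgebra α x] corner α x N' where
  toFun n := ⟨e n, by rw [mem_corner, ← map_smul, n.2]⟩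
  invFun n := ⟨e.symm n, by rw [mem_corner, ← map_smul, n.2]⟩
  map_add' m n := Subtype.ext (map_add e _ _)
  map_smul' s n := Subtype.ext (map_smul e _ _)
  left_inv n := Subtype.ext (e.symm_apply_apply _)
  right_inv n := Subtype.ext (e.apply_symm_apply _)

/-- If n = a m with m and n fixed by e(x), then also n = e(x)a e(x) m, and e(x)a e(x) lies in the
stabilizer algebra. -/
theorem isSimpleModule_corner [IsSimpleModule (TwistedAlgebra α) N]
    [Nontrivial (corner α x N)] : IsSimpleModule (StabAlgebra α x) (corner α x N) := by
  rw [isSimpleModule_iff_toSpanSingleton_surjective]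
  refine ⟨inferInstance, fun m hm n => ?_⟩
  obtain ⟨a, ha⟩ := IsSimpleModule.toSpanSingleton_surjective (TwistedAlgebra α)
    (show (m : N) ≠ 0 from fun h => hm (Subtype.ext h)) (n : N)
  refine ⟨stabProjection α x a, Subtype.ext ?_⟩
  rw [LinearMap.toSpanSingleton_apply] at ha ⊢
  rw [coe_stab_smul, ← idem_mul_mul_idem, mul_smul, m.2, mul_smul, ha, n.2]

theorem basisInv_smul_mem_corner (σ : G) (n : N) : basisInv α σ x • n ∈ corner α x N := by
  rw [mem_corner, ← mul_smul, idem_mul_basisInv]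

end Corner

section Induced

variable {G : Type u} {X : Type w} [Group G] [MulAction G X] [Fintype X] (α : Cocycle G X) (x : X)
  (W : Type u₁) [AddCommGroup W] [Module ℂ W] [Module (StabAlgebra α x) W]

/-- The element `e(x)` of `D(x)`. -/
def leftIdealOne : leftIdeal α x := ⟨idem α x, idem_mem_leftIdeal α x⟩

/-- The class of `d ⊗ w`. -/
def inducedMk : leftIdeal α x →ₗ[TwistedAlgebra α] W →ₗ[ℂ] Induced α x W :=
  TensorProduct.AlgebraTensorModule.curry (inducedRel α x W).mkQ

variable {W}

theorem inducedMk_apply (d : leftIdeal α x) (w : W) :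
    inducedMk α x W d w = (inducedRel α x W).mkQ (d ⊗ₜ[ℂ] w) := rfl

theorem inducedMk_rightMul (d : leftIdeal α x) (s : StabAlgebra α x) (w : W) :
    inducedMk α x W (rightMul α x d s) w = inducedMk α x W d (s • w) := by
  rw [inducedMk_apply, inducedMk_apply, ← sub_eq_zero, ← map_sub, Submodule.mkQ_apply,
    Submodule.Quotient.mk_eq_zero]
  exact Submodule.subset_span ⟨d, s, w, rfl⟩

theorem smul_inducedMk (a : TwistedAlgebra α) (d : leftIdeal α x) (w : W) :
    a • inducedMk α x W d w = inducedMk α x W (a • d) w := by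
  rw [map_smul]; rfl

theorem inducedMk_eq_smul (d : leftIdeal α x) (w : W) :
    inducedMk α x W d w = (d : TwistedAlgebra α) • inducedMk α x W (leftIdealOne α x) w := by
  rw [smul_inducedMk]
  congr 2
  exact Subtype.ext (mul_idem_of_mem_leftIdeal α x d.2).symm

theorem stabInclusion_smul_inducedMk (s : StabAlgebra α x) (w : W) :
    stabInclusion α x s • inducedMk α x W (leftIdealOne α x) w =
      inducedMk α x W (leftIdealOne α x) (s • w) := by
  rw [smul_inducedMk, ← inducedMk_rightMul]
  congr 2
  refine Subtype.ext ?_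
  change stabInclusion α x s * idem α x = idem α x * stabInclusion α x s
  rw [idem_mul_stabInclusion, stabInclusion_mul_idem]

theorem induced_induction {P : Induced α x W → Prop} (t : Induced α x W)
    (hmk : ∀ d w, P (inducedMk α x W d w)) (hadd : ∀ a b, P a → P b → P (a + b)) : P t := by
  obtain ⟨t, rfl⟩ := (inducedRel α x W).mkQ_surjective t
  induction t using TensorProduct.induction_on with
  | zero =>
    have h := hmk 0 0
    rw [map_zero] at h
    rw [map_zero]
    exact h
  | tmul d w => exact hmk d w
  | add a b ha hb => rw [map_add]; exact hadd _ _ ha hb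

theorem idem_smul_induced (t : Induced α x W) :
    ∃ w, idem α x • t = inducedMk α x W (leftIdealOne α x) w := by
  induction t using induced_induction with
  | hmk d w =>
    refine ⟨stabProjection α x d • w, ?_⟩
    rw [← stabInclusion_smul_inducedMk, ← idem_mul_mul_idem, mul_assoc,
      mul_idem_of_mem_leftIdeal α x d.2, mul_smul, ← inducedMk_eq_smul]
  | hadd a b ha hb =>
    obtain ⟨w, hw⟩ := ha
    obtain ⟨w', hw'⟩ := hb
    exact ⟨w + w', by rw [smul_add, hw, hw', map_add]⟩

theorem idem_smul_induced_eq_zero {y : X} (hy : y ∉ MulAction.orbit G x) (t : Induced α x W) :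
    idem α y • t = 0 := by
  induction t using induced_induction with
  | hmk d w =>
    rw [inducedMk_eq_smul, ← mul_smul, idem_mul_of_mem_leftIdeal α x d.2 hy, zero_smul]
  | hadd a b ha hb => rw [smul_add, ha, hb, add_zero]

theorem induced_hom_ext {N : Type v} [AddCommGroup N] [Module (TwistedAlgebra α) N]
    {F F' : Induced α x W →ₗ[TwistedAlgebra α] N}
    (h : ∀ w, F (inducedMk α x W (leftIdealOne α x) w) =
      F' (inducedMk α x W (leftIdealOne α x) w)) : F = F' := by
  refine LinearMap.ext fun t => ?_
  induction t using induced_induction with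
  | hmk d w => rw [inducedMk_eq_smul, map_smul, map_smul, h]
  | hadd a b ha hb => rw [map_add, map_add, ha, hb]

variable [IsScalarTower ℂ (StabAlgebra α x) W]

/-- A left inverse is d ⊗ w ↦ (the stabilizer part of d)·w, which respects the tensor relations
because projecting to the stabilizer algebra is right linear over it. -/
theorem inducedMk_leftIdealOne_injective :
    Function.Injective (inducedMk α x W (leftIdealOne α x)) := by
  have hcomm : SMulCommClass ℂ (StabAlgebra α x) W := IsScalarTower.to_smulCommClass
  let π : leftIdeal α x ⊗[ℂ] W →ₗ[ℂ] W := TensorProduct.lift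
    (LinearMap.mk₂ ℂ (fun (d : leftIdeal α x) w => stabProjection α x d • w)
      (fun d d' w => by simp [add_smul]) (fun c d w => by
        change stabProjection α x (c • (d : TwistedAlgebra α)) • w = _
        rw [map_smul, smul_assoc])
      (fun d w w' => smul_add _ _ _) (fun c d w => smul_comm _ _ _))
  have hπ : ∀ d w, π (d ⊗ₜ w) = stabProjection α x d • w := fun d w => rfl
  -- The relations are spanned over 𝒜, while `π` is only ℂ-linear; the vanishing has to be proved
  -- for all multiples a•t at once.
  have hker : ∀ t ∈ inducedRel α x W, ∀ a : TwistedAlgebra α, π (a • t) = 0 := fun t ht => by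
    induction ht using Submodule.span_induction with
    | zero => simp
    | add s t _ _ hs ht => intro a; rw [smul_add, map_add, hs, ht, add_zero]
    | smul b t _ ht => intro a; rw [← mul_smul]; exact ht _
    | mem t ht =>
      obtain ⟨d, s, w, rfl⟩ := ht
      intro a
      rw [smul_sub, map_sub, TensorProduct.smul_tmul', TensorProduct.smul_tmul', hπ, hπ]
      change stabProjection α x (a * ((d : TwistedAlgebra α) * stabInclusion α x s)) • w -
        stabProjection α x (a * d) • s • w = 0
      rw [← mul_assoc, stabProjection_mul_stabInclusion, mul_smul, sub_self]
  rw [← LinearMap.ker_eq_bot, LinearMap.ker_eq_bot']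
  intro w hw
  rw [inducedMk_apply, Submodule.mkQ_apply, Submodule.Quotient.mk_eq_zero] at hw
  have h := hker _ hw 1
  rw [one_smul, hπ] at h
  change stabProjection α x (idem α x) • w = 0 at h
  rwa [← stabInclusion_one, stabProjection_stabInclusion, one_smul] at h

/-- The corner `e(x) (D(x) ⊗ W)` is `W`. -/
def inducedCorner : W ≃ₗ[StabAlgebra α x] corner α x (Induced α x W) :=
  LinearEquiv.ofBijective
    { toFun := fun w => ⟨inducedMk α x W (leftIdealOne α x) w, by
        exact (inducedMk_eq_smul α x (leftIdealOne α x) w).symm⟩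
      map_add' := fun w w' => Subtype.ext (map_add _ _ _)
      map_smul' := fun s w => Subtype.ext (stabInclusion_smul_inducedMk α x s w).symm }
    ⟨fun w w' h => inducedMk_leftIdealOne_injective α x (congrArg Subtype.val h), fun t => by
      obtain ⟨w, hw⟩ := idem_smul_induced α x (t : Induced α x W)
      exact ⟨w, Subtype.ext (hw.symm.trans t.2)⟩⟩

/-- A nonzero vector has a nonzero component under some e(y) with y in the orbit of x. Transport
along the groupoid moves it into the corner at x, which is the simple module `W`; from there
everything is generated. -/
theorem isSimpleModule_induced [IsSimpleModule (StabAlgebra α x) W] :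
    IsSimpleModule (TwistedAlgebra α) (Induced α x W) := by
  have hW : Nontrivial W := IsSimpleModule.nontrivial (StabAlgebra α x) W
  have hnt : Nontrivial (Induced α x W) := (inducedMk_leftIdealOne_injective α x).nontrivial
  rw [isSimpleModule_iff_toSpanSingleton_surjective]
  refine ⟨hnt, fun m hm => ?_⟩
  rw [← LinearMap.range_eq_top, eq_top_iff]
  set P := LinearMap.range (LinearMap.toSpanSingleton (TwistedAlgebra α) (Induced α x W) m)
  have hmP : m ∈ P := ⟨1, by simp⟩
  obtain ⟨y, hy⟩ := exists_idem_smul_ne_zero α hm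
  have hyx : y ∈ MulAction.orbit G x := by
    by_contra h
    exact hy (idem_smul_induced_eq_zero α x h m)
  obtain ⟨σ, rfl⟩ := hyx
  have h1 := basisInv_smul_ne_zero α x hy
  have h2 : basisInv α σ x • m ∈ P := P.smul_mem _ hmP
  obtain ⟨w, hw⟩ := idem_smul_induced α x (basisInv α σ x • m)
  rw [basisInv_smul_mem_corner α x σ m] at hw
  have hw0 : w ≠ 0 := by
    rintro rfl
    rw [map_zero] at hw
    exact h1 hw
  rw [hw] at h2
  have h3 : ∀ w', inducedMk α x W (leftIdealOne α x) w' ∈ P := fun w' => by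
    obtain ⟨s, rfl⟩ := IsSimpleModule.toSpanSingleton_surjective (StabAlgebra α x) hw0 w'
    rw [LinearMap.toSpanSingleton_apply, ← stabInclusion_smul_inducedMk]
    exact P.smul_mem _ h2
  rintro t -
  induction t using induced_induction with
  | hmk d w' =>
    rw [inducedMk_eq_smul]
    exact P.smul_mem _ (h3 w')
  | hadd a b ha hb => exact P.add_mem ha hb

end Induced

/-! ### Frobenius reciprocity for induced modules -/

section Frobenius

variable {G : Type u} {X : Type w} [Group G] [MulAction G X] [Fintype X] (α : Cocycle G X) (x : X)
  {W : Type u₁} [AddCommGroup W] [Module ℂ W] [Module (StabAlgebra α x) W]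
  {N : Type v} [AddCommGroup N] [Module ℂ N] [Module (TwistedAlgebra α) N]
  [IsScalarTower ℂ (TwistedAlgebra α) N]

/-- The homomorphism `d ⊗ w ↦ d f(w)`. -/
def inducedLift [SMulCommClass ℂ (TwistedAlgebra α) N] [SMulCommClass (TwistedAlgebra α) ℂ N]
    (f : W →ₗ[ℂ] N)
    (hf : ∀ (s : StabAlgebra α x) w, f (s • w) = stabInclusion α x s • f w) :
    Induced α x W →ₗ[TwistedAlgebra α] N :=
  (inducedRel α x W).liftQ
    (TensorProduct.AlgebraTensorModule.lift
      { toFun := fun d => (d : TwistedAlgebra α) • f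
        map_add' := fun d d' => by ext w; simp [add_smul]
        map_smul' := fun a d => by ext w; simp [mul_smul] }) <| by
    rw [inducedRel, Submodule.span_le]
    rintro _ ⟨d, s, w, rfl⟩
    simp only [SetLike.mem_coe, LinearMap.mem_ker, map_sub,
      TensorProduct.AlgebraTensorModule.lift_tmul, LinearMap.coe_mk, AddHom.coe_mk,
      LinearMap.smul_apply, hf, sub_eq_zero]
    exact mul_smul _ _ _

theorem inducedLift_mk [SMulCommClass ℂ (TwistedAlgebra α) N]
    [SMulCommClass (TwistedAlgebra α) ℂ N] (f : W →ₗ[ℂ] N)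
    (hf : ∀ (s : StabAlgebra α x) w, f (s • w) = stabInclusion α x s • f w) (d : leftIdeal α x)
    (w : W) : inducedLift α x f hf (inducedMk α x W d w) = (d : TwistedAlgebra α) • f w := rfl

theorem inducedLift_add [SMulCommClass ℂ (TwistedAlgebra α) N]
    [SMulCommClass (TwistedAlgebra α) ℂ N] {f g k : W →ₗ[ℂ] N} (hf hg hk)
    (h : ∀ w, k w = f w + g w) (t : Induced α x W) :
    inducedLift α x k hk t = inducedLift α x f hf t + inducedLift α x g hg t := by
  induction t using induced_induction with
  | hmk d w => rw [inducedLift_mk, inducedLift_mk, inducedLift_mk, h, smul_add]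
  | hadd a b ha hb => rw [map_add, map_add, map_add, ha, hb, add_add_add_comm]

theorem inducedLift_smul [SMulCommClass ℂ (TwistedAlgebra α) N]
    [SMulCommClass (TwistedAlgebra α) ℂ N] {f k : W →ₗ[ℂ] N} (hf hk) (c : ℂ)
    (h : ∀ w, k w = c • f w) (t : Induced α x W) :
    inducedLift α x k hk t = c • inducedLift α x f hf t := by
  induction t using induced_induction with
  | hmk d w => rw [inducedLift_mk, inducedLift_mk, h, smul_comm]
  | hadd a b ha hb => rw [map_add, map_add, ha, hb, smul_add]

end Frobenius

end TwistedAlgebra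

/-! ### The irreducible modules of `A_α(G, X)` -/

namespace TwistedAlgebra

theorem isCompleteIrreducible_induced {G X : Type u} [Group G] [Finite G] [MulAction G X]
    [Fintype X] (α : Cocycle G X) (rep : MulAction.orbitRel.Quotient G X → X)
    (hrep : ∀ j, rep j ∈ j.orbit) {Λ : MulAction.orbitRel.Quotient G X → Type w}
    {W : ∀ j, Λ j → Type u₁} [∀ j l, AddCommGroup (W j l)] [∀ j l, Module ℂ (W j l)]
    [∀ j l, Module (StabAlgebra α (rep j)) (W j l)]
    [∀ j l, IsScalarTower ℂ (StabAlgebra α (rep j)) (W j l)]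
    (hW : ∀ j, IsCompleteIrreducible (StabAlgebra α (rep j)) (W j)) :
    IsCompleteIrreducible (TwistedAlgebra α)
      (fun p : Σ j, Λ j => Induced α (rep p.1) (W p.1 p.2)) := by
  have hrep' : ∀ j, Quotient.mk'' (rep j) = j := fun j =>
    MulAction.orbitRel.Quotient.mem_orbit.mp (hrep j)
  refine ⟨fun p => ?_, ?_, ?_⟩
  · have := (hW p.1).simple p.2
    exact isSimpleModule_induced α (rep p.1)
  · rintro ⟨j, l⟩ ⟨j', l'⟩ ⟨e⟩
    -- The idempotent at `rep j` acts nontrivially on a module induced from that point, but kills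
    -- every module induced from another orbit.
    have hj : j = j' := by
      have := (hW j).simple l
      have hnt : Nontrivial (W j l) := IsSimpleModule.nontrivial (StabAlgebra α (rep j)) _
      obtain ⟨w, hw⟩ := exists_ne (0 : W j l)
      by_contra hne
      have horb : rep j ∉ MulAction.orbit G (rep j') := fun h => hne <| by
        rw [← hrep' j, ← hrep' j']
        exact Quotient.sound' h
      have h1 := idem_smul_induced_eq_zero α (rep j') horb
        (e (inducedMk α (rep j) (W j l) (leftIdealOne α (rep j)) w))
      rw [← map_smul, EmbeddingLike.map_eq_zero_iff,
        show idem α (rep j) • inducedMk α (rep j) (W j l) (leftIdealOne α (rep j)) w = _ from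
          (inducedMk_eq_smul α (rep j) (leftIdealOne α (rep j)) w).symm] at h1
      exact hw (inducedMk_leftIdealOne_injective α (rep j) (h1.trans (map_zero _).symm))
    subst hj
    -- An isomorphism of induced modules restricts to their corners, which are the original
    -- stabilizer modules.
    have h : l = l' := (hW j).inequivalent l l' ⟨(inducedCorner α (rep j)).trans
      ((cornerCongr α (rep j) e).trans (inducedCorner α (rep j)).symm)⟩
    rw [h]
  · intro N _ _ hN
    let : Module ℂ N := Module.compHom N (algebraMap ℂ (TwistedAlgebra α))
    have : IsScalarTower ℂ (TwistedAlgebra α) N := IsScalarTower.of_compHom _ _ _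
    have : SMulCommClass ℂ (TwistedAlgebra α) N := IsScalarTower.to_smulCommClass
    have : SMulCommClass (TwistedAlgebra α) ℂ N := IsScalarTower.to_smulCommClass'
    have hnt : Nontrivial N := IsSimpleModule.nontrivial (TwistedAlgebra α) N
    obtain ⟨n, hn⟩ := exists_ne (0 : N)
    obtain ⟨y, hy⟩ := exists_idem_smul_ne_zero α hn
    set j : MulAction.orbitRel.Quotient G X := Quotient.mk'' y
    obtain ⟨σ, hσ⟩ : ∃ σ : G, σ • rep j = y :=
      (Quotient.exact' ((hrep' j).symm : (Quotient.mk'' y : MulAction.orbitRel.Quotient G X) = _) :)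
    -- Some e(y) acts nontrivially on `N`, and the groupoid inverse of σ carries e(y)N to the corner
    -- at the chosen representative. That corner is then simple, and its inclusion induces a nonzero
    -- map between simple modules.
    have hc : Nontrivial (corner α (rep j) N) := by
      refine ⟨⟨⟨basisInv α σ (rep j) • n, basisInv_smul_mem_corner α (rep j) σ n⟩, 0, fun h => ?_⟩⟩
      exact basisInv_smul_ne_zero α (rep j) (hσ ▸ hy) (congrArg Subtype.val h)
    obtain ⟨l, ⟨e⟩⟩ := (hW j).complete (corner α (rep j) N) (isSimpleModule_corner α (rep j))
    have hℂ : ∀ (c : ℂ) (m : corner α (rep j) N),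
        c • m = (algebraMap ℂ (StabAlgebra α (rep j)) c) • m := fun c m => Subtype.ext <| by
      rw [coe_stab_smul, Algebra.algebraMap_eq_smul_one, map_smul, stabInclusion_one, smul_assoc,
        m.2]
      rfl
    let f : W j l →ₗ[ℂ] N :=
      { toFun := fun w => (e.symm w : N)
        map_add' := fun w w' => by rw [map_add]; rfl
        map_smul' := fun c w => by
          rw [← algebraMap_smul (StabAlgebra α (rep j)) c w, map_smul, ← hℂ]
          rfl }
    let F := inducedLift α (rep j) f fun s w => by
      change ((e.symm (s • w) : corner α (rep j) N) : N) = _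
      rw [map_smul, coe_stab_smul]
      rfl
    have := (hW j).simple l
    have := isSimpleModule_induced α (rep j) (W := W j l)
    have hF : F ≠ 0 := by
      obtain ⟨m, hm⟩ := exists_ne (0 : corner α (rep j) N)
      intro h
      have h1 := LinearMap.congr_fun h (inducedMk α (rep j) (W j l) (leftIdealOne α (rep j)) (e m))
      rw [inducedLift_mk, LinearMap.zero_apply] at h1
      change idem α (rep j) • (e.symm (e m) : N) = 0 at h1
      rw [e.symm_apply_apply, m.2] at h1
      exact hm (Subtype.ext h1)
    exact ⟨⟨j, l⟩, ⟨(LinearEquiv.ofBijective F (LinearMap.bijective_of_ne_zero hF)).symm⟩⟩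

end TwistedAlgebra

/-! ### Isotypic decomposition -/

section Isotypic

variable {A : Type u} [Ring A] {K : Type w} {X : K → Type u₁}
  [∀ k, AddCommGroup (X k)] [∀ k, Module ℂ (X k)] [∀ k, Module A (X k)]
  {N : Type v} [AddCommGroup N] [Module ℂ N] [Module A N]
  {H : K → Type u₂} [∀ k, AddCommGroup (H k)] [∀ k, Module ℂ (H k)]

/-- The map `⨁ X_k ⊗ H_k → N`, `x ⊗ h ↦ h(x)`. -/
def evalMap [DecidableEq K] (ε : ∀ k, H k →ₗ[ℂ] X k →ₗ[ℂ] N) :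
    (⨁ k, X k ⊗[ℂ] H k) →ₗ[ℂ] N :=
  DirectSum.toModule ℂ K N fun k => TensorProduct.lift (ε k).flip

theorem evalMap_lof [DecidableEq K] (ε : ∀ k, H k →ₗ[ℂ] X k →ₗ[ℂ] N) (k : K) (x : X k) (h : H k) :
    evalMap ε (DirectSum.lof ℂ K (fun k => X k ⊗[ℂ] H k) k (x ⊗ₜ h)) = ε k h x := by
  rw [evalMap, DirectSum.toModule_lof, TensorProduct.lift.tmul, LinearMap.flip_apply]

theorem directSum_tensor_induction [DecidableEq K] {P : (⨁ k, X k ⊗[ℂ] H k) → Prop} (t)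
    (h0 : P 0) (hmk : ∀ k (x : X k) (h : H k),
      P (DirectSum.lof ℂ K (fun k => X k ⊗[ℂ] H k) k (x ⊗ₜ h)))
    (hadd : ∀ a b, P a → P b → P (a + b)) : P t := by
  induction t using DirectSum.induction_on with
  | zero => exact h0
  | add a b ha hb => exact hadd a b ha hb
  | of k y =>
    induction y using TensorProduct.induction_on with
    | zero => rw [map_zero]; exact h0
    | tmul x h => exact hmk k x h
    | add a b ha hb => rw [map_add]; exact hadd _ _ ha hb

theorem smul_lof_tmul [DecidableEq K] [∀ k, SMulCommClass ℂ A (X k)] (a : A) (k : K) (x : X k)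
    (h : H k) : a • DirectSum.lof ℂ K (fun k => X k ⊗[ℂ] H k) k (x ⊗ₜ h) =
      DirectSum.lof ℂ K (fun k => X k ⊗[ℂ] H k) k ((a • x) ⊗ₜ h) := by
  refine DFinsupp.ext fun i => ?_
  rw [DirectSum.smul_apply]
  by_cases hi : k = i
  · subst hi
    change a • (DirectSum.lof ℂ K (fun k => X k ⊗[ℂ] H k) k (x ⊗ₜ h)) k =
      (DirectSum.lof ℂ K (fun k => X k ⊗[ℂ] H k) k ((a • x) ⊗ₜ h)) k
    rw [DirectSum.lof_apply, DirectSum.lof_apply, TensorProduct.smul_tmul']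
  · rw [DirectSum.lof_eq_of, DirectSum.lof_eq_of, DirectSum.of_eq_of_ne _ _ _ (Ne.symm hi),
      DirectSum.of_eq_of_ne _ _ _ (Ne.symm hi), smul_zero]

theorem evalMap_smul [DecidableEq K] [∀ k, SMulCommClass ℂ A (X k)]
    (ε : ∀ k, H k →ₗ[ℂ] X k →ₗ[ℂ] N) (hε : ∀ k h (a : A) x, ε k h (a • x) = a • ε k h x) (a : A)
    (t : ⨁ k, X k ⊗[ℂ] H k) : evalMap ε (a • t) = a • evalMap ε t := by
  induction t using directSum_tensor_induction with
  | h0 => simp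
  | hmk k x h => rw [smul_lof_tmul, evalMap_lof, evalMap_lof, hε]
  | hadd s t hs ht => rw [smul_add, map_add, hs, ht, map_add, smul_add]

theorem evalMap_lmap_lTensor [DecidableEq K] (ε : ∀ k, H k →ₗ[ℂ] X k →ₗ[ℂ] N)
    (T : ∀ k, H k →ₗ[ℂ] H k) (U : N →ₗ[ℂ] N) (hT : ∀ k h x, ε k (T k h) x = U (ε k h x))
    (t : ⨁ k, X k ⊗[ℂ] H k) :
    evalMap ε (DirectSum.lmap (fun k => (T k).lTensor (X k)) t) = U (evalMap ε t) := by
  induction t using directSum_tensor_induction with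
  | h0 => simp
  | hmk k x h => rw [DirectSum.lmap_lof, LinearMap.lTensor_tmul, evalMap_lof, evalMap_lof, hT]
  | hadd s t hs ht => rw [map_add, map_add, map_add, map_add, hs, ht]

/-- A semisimple module is the sum of its simple submodules. The inclusion of each of these is a
homomorphism from some X_k, so it is evaluation at an element of H_k. -/
theorem evalMap_surjective [DecidableEq K] [IsSemisimpleRing A]
    [∀ k, SMulCommClass ℂ A (X k)] (hX : IsCompleteIrreducible A X)
    (ε : ∀ k, H k →ₗ[ℂ] X k →ₗ[ℂ] N) (hε : ∀ k h (a : A) x, ε k h (a • x) = a • ε k h x)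
    (hsurj : ∀ k (f : X k →ₗ[A] N), ∃ h, ∀ x, ε k h x = f x) :
    Function.Surjective (evalMap ε) := by
  let Θ : (⨁ k, X k ⊗[ℂ] H k) →ₗ[A] N :=
    { evalMap ε with map_smul' := evalMap_smul ε hε }
  suffices h : LinearMap.range Θ = ⊤ from
    (LinearMap.range_eq_top (f := Θ)).mp h
  rw [eq_top_iff, ← IsSemisimpleModule.sSup_simples_eq_top, sSup_le_iff]
  intro S hS
  have hS' : IsSimpleModule A S := hS
  -- The simple submodule is replaced by a quotient of `A`, since completeness of the list speaks
  -- about modules in the universe of `A`.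
  obtain ⟨I, hI, ⟨e⟩⟩ := isSimpleModule_iff_quot_maximal.mp hS'
  have : IsSimpleModule A (A ⧸ I) :=
    isSimpleModule_iff_isCoatom.mpr (Ideal.isMaximal_def.mp hI)
  obtain ⟨k, ⟨e'⟩⟩ := hX.complete (A ⧸ I) this
  obtain ⟨h, hh⟩ := hsurj k (S.subtype ∘ₗ (e.trans e').symm.toLinearMap)
  intro n hn
  refine ⟨DirectSum.lof ℂ K (fun k => X k ⊗[ℂ] H k) k ((e.trans e') ⟨n, hn⟩ ⊗ₜ h), ?_⟩
  change evalMap ε _ = n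
  rw [evalMap_lof, hh]
  simp

variable [Algebra ℂ A] [∀ k, IsScalarTower ℂ A (X k)]

/-- In coordinates with respect to bases of the H_k', a homomorphism is a family of maps X_k → X_k'.
Schur's lemma makes them zero for k' ≠ k and scalars for k' = k, and the scalars are the coordinates
of `h`. -/
theorem exists_tmul_of_hom [DecidableEq K] [Module.Finite ℂ A]
    [∀ k, SMulCommClass ℂ A (X k)] (hX : IsCompleteIrreducible A X) (k : K)
    (g : X k →ₗ[A] ⨁ k, X k ⊗[ℂ] H k) :
    ∃ h : H k, ∀ x, g x = DirectSum.lof ℂ K (fun k => X k ⊗[ℂ] H k) k (x ⊗ₜ h) := by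
  classical
  have hsimple := hX.simple
  let b := fun k => Module.Basis.ofVectorSpace ℂ (H k)
  let E := fun k => TensorProduct.equivFinsuppOfBasisRight (M := X k) (b k)
  have hE : ∀ k (a : A) t i, E k (a • t) i = a • E k t i := fun k a t i => by
    induction t using TensorProduct.induction_on with
    | zero => simp
    | tmul x h =>
      rw [TensorProduct.smul_tmul', TensorProduct.equivFinsuppOfBasisRight_apply_tmul_apply,
        TensorProduct.equivFinsuppOfBasisRight_apply_tmul_apply, smul_comm]
    | add s t hs ht =>
      rw [smul_add, map_add, map_add, Finsupp.add_apply, Finsupp.add_apply, hs, ht, smul_add]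
  let q : ∀ k' (i : _), X k →ₗ[A] X k' := fun k' i =>
    { toFun := fun x => E k' (g x k') i
      map_add' := fun x y => by
        rw [map_add, DirectSum.add_apply, map_add, Finsupp.add_apply]
      map_smul' := fun a x => by
        rw [map_smul, DirectSum.smul_apply, hE]
        rfl }
  have hq : ∀ k' ≠ k, ∀ i, q k' i = 0 := fun k' hk i => by
    rcases LinearMap.bijective_or_eq_zero (q k' i) with h | h
    · exact absurd (hX.inequivalent _ _ ⟨LinearEquiv.ofBijective _ h⟩) hk.symm
    · exact h
  have hfin : Module.Finite ℂ (X k) := by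
    have : Module.Finite A (X k) := inferInstance
    exact Module.Finite.trans A (X k)
  have hscalar : ∀ i, ∃ c : ℂ, ∀ x, q k i x = c • x := fun i => by
    obtain ⟨c, hc⟩ := (IsSimpleModule.algebraMap_end_bijective_of_isAlgClosed (A := A) (V := X k)
      ℂ).2 (q k i)
    exact ⟨c, fun x => by rw [← hc]; rfl⟩
  choose c hc using hscalar
  have hnt : Nontrivial (X k) := IsSimpleModule.nontrivial A _
  obtain ⟨x₀, hx₀⟩ := exists_ne (0 : X k)
  -- The scalars are seen on a single nonzero vector x₀, whose image has only finitely many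
  -- coordinates.
  have hfs : (Function.support c).Finite := by
    refine (E k (g x₀ k)).hasFiniteSupport.subset fun i hi => ?_
    change q k i x₀ ≠ 0
    rw [hc]
    exact smul_ne_zero hi hx₀
  refine ⟨(b k).repr.symm (Finsupp.ofSupportFinite c hfs), fun x => DFinsupp.ext fun k' => ?_⟩
  by_cases hk : k' = k
  · subst hk
    change g x k' = (DirectSum.lof ℂ K (fun k => X k ⊗[ℂ] H k) k' (x ⊗ₜ _)) k'
    rw [DirectSum.lof_apply]
    apply (E k').injective
    ext i
    rw [TensorProduct.equivFinsuppOfBasisRight_apply_tmul_apply, LinearEquiv.apply_symm_apply]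
    exact hc i x
  · rw [DirectSum.lof_eq_of, DirectSum.of_eq_of_ne _ _ _ hk]
    apply (E k').injective
    ext i
    rw [map_zero, Finsupp.zero_apply]
    exact LinearMap.congr_fun (hq k' hk i) x

/-- A nonzero kernel would contain a simple submodule. Its inclusion has the form x ↦ x ⊗ h with h
evaluating to zero, so h = 0, which is a contradiction. -/
theorem evalMap_injective [DecidableEq K] [Module.Finite ℂ A] [IsSemisimpleRing A]
    [∀ k, SMulCommClass ℂ A (X k)] (hX : IsCompleteIrreducible A X)
    (ε : ∀ k, H k →ₗ[ℂ] X k →ₗ[ℂ] N) (hε : ∀ k h (a : A) x, ε k h (a • x) = a • ε k h x)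
    (hinj : ∀ k, Function.Injective (ε k)) : Function.Injective (evalMap ε) := by
  let Θ : (⨁ k, X k ⊗[ℂ] H k) →ₗ[A] N :=
    { evalMap ε with map_smul' := evalMap_smul ε hε }
  suffices h : LinearMap.ker Θ = ⊥ from (LinearMap.ker_eq_bot (f := Θ)).mp h
  refine (IsSemisimpleModule.eq_bot_or_exists_simple_le (LinearMap.ker Θ)).resolve_right ?_
  rintro ⟨S, hS, (hS' : IsSimpleModule A S)⟩
  obtain ⟨I, hI, ⟨e⟩⟩ := isSimpleModule_iff_quot_maximal.mp hS'
  have : IsSimpleModule A (A ⧸ I) :=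
    isSimpleModule_iff_isCoatom.mpr (Ideal.isMaximal_def.mp hI)
  obtain ⟨k, ⟨e'⟩⟩ := hX.complete (A ⧸ I) this
  obtain ⟨h, hh⟩ := exists_tmul_of_hom hX k (S.subtype ∘ₗ (e.trans e').symm.toLinearMap)
  have h0 : h = 0 := hinj k <| LinearMap.ext fun x => by
    rw [map_zero, LinearMap.zero_apply, ← evalMap_lof ε, ← hh]
    exact hS ((e.trans e').symm x).2
  have hnt : Nontrivial S := IsSimpleModule.nontrivial A S
  obtain ⟨s, hs⟩ := exists_ne (0 : S)
  have h1 := hh ((e.trans e') s)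
  rw [h0, TensorProduct.tmul_zero, map_zero] at h1
  refine hs (Subtype.ext ?_)
  simpa using h1

end Isotypic

/-! ### Families of modes as modules over a free algebra -/

section FreeModule

variable {Γ : Type u₂} {V : Type u} [AddCommGroup V] [Module ℂ V]
  {M : Type v} [AddCommGroup M] [Module ℂ M]

/-- The space `M` as a module over the free algebra on the modes. -/
def FreeModule (_Y : ModeFamily Γ V M) : Type v := M

variable (Y : ModeFamily Γ V M)

instance : AddCommGroup (FreeModule Y) := inferInstanceAs (AddCommGroup M)

instance : Module ℂ (FreeModule Y) := inferInstanceAs (Module ℂ M)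

/-- The representation of the free algebra on the modes. -/
def freeAct : FreeAlgebra ℂ (Γ × V) →ₐ[ℂ] Module.End ℂ M :=
  FreeAlgebra.lift ℂ fun p => Y p.1 p.2

instance : Module (FreeAlgebra ℂ (Γ × V)) (FreeModule Y) :=
  Module.compHom M (freeAct Y).toRingHom

theorem freeModule_smul (r : FreeAlgebra ℂ (Γ × V)) (x : FreeModule Y) :
    r • x = (freeAct Y r (x : M) : M) := rfl

theorem freeModule_ι_smul (n : Γ) (a : V) (x : FreeModule Y) :
    FreeAlgebra.ι ℂ (n, a) • x = (Y n a (x : M) : M) := by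
  rw [freeModule_smul, freeAct, FreeAlgebra.lift_ι_apply]

instance : IsScalarTower ℂ (FreeAlgebra ℂ (Γ × V)) (FreeModule Y) :=
  ⟨fun c r x => by rw [freeModule_smul, freeModule_smul, map_smul]; rfl⟩

variable {Y}

theorem IsInvariant.freeAct_mem {P : Submodule ℂ M} (hP : IsInvariant Y P)
    (r : FreeAlgebra ℂ (Γ × V)) : ∀ x ∈ P, freeAct Y r x ∈ P := by
  induction r using FreeAlgebra.induction with
  | grade0 c =>
    intro x hx
    rw [AlgHom.commutes, Module.algebraMap_end_apply]
    exact P.smul_mem c hx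
  | grade1 p =>
    intro x hx
    rw [freeAct, FreeAlgebra.lift_ι_apply]
    exact hP p.1 p.2 x hx
  | mul a b ha hb =>
    intro x hx
    rw [map_mul, Module.End.mul_apply]
    exact ha _ (hb x hx)
  | add a b ha hb =>
    intro x hx
    rw [map_add, LinearMap.add_apply]
    exact P.add_mem (ha x hx) (hb x hx)

/-- An invariant subspace as a submodule over the free algebra. -/
def IsInvariant.toSubmodule {P : Submodule ℂ M} (hP : IsInvariant Y P) :
    Submodule (FreeAlgebra ℂ (Γ × V)) (FreeModule Y) where
  carrier := {x | (show M from x) ∈ P}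
  add_mem' := P.add_mem
  zero_mem' := P.zero_mem
  smul_mem' r x hx := hP.freeAct_mem r x hx

/-- The subspace underlying a submodule over the free algebra. -/
def toSubspace (P : Submodule (FreeAlgebra ℂ (Γ × V)) (FreeModule Y)) : Submodule ℂ M :=
  P.restrictScalars ℂ

theorem isInvariant_toSubspace (P : Submodule (FreeAlgebra ℂ (Γ × V)) (FreeModule Y)) :
    IsInvariant Y (toSubspace P) := fun n a x hx => by
  have h := P.smul_mem (FreeAlgebra.ι ℂ (n, a)) (show (show FreeModule Y from x) ∈ P from hx)
  rw [freeModule_ι_smul] at h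
  exact h

variable (Y) in
/-- Submodules over the free algebra are the same as invariant subspaces. -/
def subspaceEmbedding : Submodule (FreeAlgebra ℂ (Γ × V)) (FreeModule Y) ↪o Submodule ℂ M :=
  Submodule.restrictScalarsEmbedding ℂ _ (FreeModule Y)

theorem toSubspace_injective : Function.Injective (toSubspace (Y := Y)) :=
  (subspaceEmbedding Y).injective

theorem IsIrreducibleModule.isSimpleModule (hY : IsIrreducibleModule Y) :
    IsSimpleModule (FreeAlgebra ℂ (Γ × V)) (FreeModule Y) := by
  have hnt : Nontrivial (FreeModule Y) := hY.1
  refine { eq_bot_or_eq_top := fun P => ?_ }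
  exact (hY.2 _ (isInvariant_toSubspace P)).imp
    (fun h => toSubspace_injective h) (fun h => toSubspace_injective h)

/-- A homomorphism of modules over the free algebra as a linear map. -/
def freeHom {M' : Type w} [AddCommGroup M'] [Module ℂ M'] {Y' : ModeFamily Γ V M'}
    (f : FreeModule Y →ₗ[FreeAlgebra ℂ (Γ × V)] FreeModule Y') : M →ₗ[ℂ] M' :=
  f.restrictScalars ℂ

theorem freeHom_mode {M' : Type w} [AddCommGroup M'] [Module ℂ M'] {Y' : ModeFamily Γ V M'}
    (f : FreeModule Y →ₗ[FreeAlgebra ℂ (Γ × V)] FreeModule Y') (n : Γ) (a : V) (x : M) :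
    freeHom f (Y n a x) = Y' n a (freeHom f x) := by
  have h := f.map_smul (FreeAlgebra.ι ℂ (n, a)) (show FreeModule Y from x)
  rw [freeModule_ι_smul, freeModule_ι_smul] at h
  exact h

theorem freeAct_piMode {I : Type w} {M : I → Type v} [∀ i, AddCommGroup (M i)]
    [∀ i, Module ℂ (M i)] (Y : ∀ i, ModeFamily Γ V (M i)) (r : FreeAlgebra ℂ (Γ × V)) :
    ∀ (x : ∀ i, M i) (i : I), freeAct (piMode Y) r x i = freeAct (Y i) r (x i) := by
  induction r using FreeAlgebra.induction with
  | grade0 c =>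
    intro x i
    rw [AlgHom.commutes, AlgHom.commutes]
    rfl
  | grade1 p =>
    intro x i
    rw [freeAct, freeAct, FreeAlgebra.lift_ι_apply, FreeAlgebra.lift_ι_apply]
    rfl
  | mul a b ha hb =>
    intro x i
    rw [map_mul, map_mul, Module.End.mul_apply, Module.End.mul_apply, ha, hb]
  | add a b ha hb =>
    intro x i
    rw [map_add, map_add, LinearMap.add_apply, LinearMap.add_apply, Pi.add_apply, ha, hb]

/-- Invariant subspaces are the submodules over the free algebra, so a sum of irreducible ones makes
the module semisimple, and an independent subfamily with the same sum exists. -/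
theorem isCompletelyReducible_of_sSup_eq_top {s : Set (Submodule ℂ M)}
    (hs : ∀ N ∈ s, IsIrreducibleSubmodule Y N) (htop : sSup s = ⊤) : IsCompletelyReducible Y := by
  let R := FreeAlgebra ℂ (Γ × V)
  have hatom : ∀ P : Submodule R (FreeModule Y), IsSimpleModule R P ↔
      IsIrreducibleSubmodule Y (toSubspace P) := fun P => by
    rw [isSimpleModule_iff_isAtom]
    constructor
    · intro h
      refine ⟨isInvariant_toSubspace P, fun h0 => h.1 (toSubspace_injective h0), fun N hN hle => ?_⟩
      rcases eq_or_lt_of_le (show hN.toSubmodule ≤ P from hle) with h1 | h1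
      · exact Or.inr (congrArg toSubspace h1)
      · exact Or.inl (congrArg toSubspace (h.2 _ h1))
    · rintro ⟨-, h0, h⟩
      refine ⟨fun hb => h0 (congrArg toSubspace hb), fun Q hQ => ?_⟩
      rcases h (toSubspace Q) (isInvariant_toSubspace Q) hQ.le with h1 | h1
      · exact toSubspace_injective h1
      · exact absurd (toSubspace_injective h1) hQ.ne
  have hsemi : IsSemisimpleModule R (FreeModule Y) := by
    rw [← sSup_simples_eq_top_iff_isSemisimpleModule, eq_top_iff]
    have h1 : sSup s ≤ toSubspace (sSup {m : Submodule R (FreeModule Y) | IsSimpleModule R m}) := by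
      refine sSup_le fun N hN => ?_
      have hN' : IsSimpleModule R (hs N hN).1.toSubmodule := (hatom _).mpr (hs N hN)
      have h2 : (hs N hN).1.toSubmodule ≤ sSup {m : Submodule R (FreeModule Y) | IsSimpleModule R m} :=
        le_sSup (Set.mem_ofPred.mpr hN')
      exact h2
    rw [htop] at h1
    exact h1
  obtain ⟨t, ht, htop', hsimple⟩ := IsSemisimpleModule.exists_sSupIndep_sSup_simples_eq_top R
    (FreeModule Y)
  refine ⟨toSubspace '' t, ?_, ?_, ?_⟩
  · rintro _ ⟨P, hP, rfl⟩
    exact (hatom P).mp (hsimple P hP)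
  · rintro _ ⟨P, hP, rfl⟩
    have h := ht hP
    rw [← Submodule.disjoint_restrictScalars_iff ℂ, Submodule.restrictScalars_sSup] at h
    have h1 : toSubspace '' t \ {toSubspace P} = toSubspace '' (t \ {P}) := by
      rw [Set.image_sdiff toSubspace_injective, Set.image_singleton]
    rw [h1]
    exact h
  · have h := congrArg toSubspace htop'
    rw [toSubspace, Submodule.restrictScalars_sSup] at h
    exact h

end FreeModule

namespace StableFamily

variable {V : Type u} [AddCommGroup V] [Module ℂ V] [VertexAlgebra V] {G : Subgroup (Aut V)}
  {S : StableFamily.{u, v} V G}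

/-! ### The action of the twisted algebra on the direct sum -/

section TotalModule

/-- The projection of the direct sum to `M_i`, as an operator. -/
def totalProj (S : StableFamily.{u, v} V G) (i : S.ι) : Module.End ℂ S.Total :=
  DirectSum.lof ℂ S.ι S.M i ∘ₗ DirectSum.component ℂ S.ι S.M i

theorem totalProj_apply (i : S.ι) (t : S.Total) :
    totalProj S i t = DirectSum.lof ℂ S.ι S.M i (t i) := rfl

theorem lof_apply_self (i : S.ι) (x : S.M i) : (DirectSum.lof ℂ S.ι S.M i x) i = x :=
  DirectSum.component.lof_self ℂ i x

theorem lof_apply_of_ne {i k : S.ι} (h : i ≠ k) (x : S.M i) :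
    (DirectSum.lof ℂ S.ι S.M i x) k = 0 :=
  DirectSum.of_eq_of_ne _ _ _ h.symm

theorem lof_injective (i : S.ι) : Function.Injective (DirectSum.lof ℂ S.ι S.M i) := fun x y h => by
  rw [← lof_apply_self i x, h, lof_apply_self]

theorem totalProj_ne_zero (i : S.ι) : totalProj S i ≠ 0 := fun h => by
  have := (S.irreducible i).1
  obtain ⟨x, hx⟩ := exists_ne (0 : S.M i)
  have h1 := LinearMap.congr_fun h (DirectSum.lof ℂ S.ι S.M i x)
  rw [totalProj_apply, lof_apply_self, LinearMap.zero_apply] at h1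
  exact hx (lof_injective i (h1.trans (map_zero _).symm))

theorem totalProj_mul_totalProj (i : S.ι) : totalProj S i * totalProj S i = totalProj S i := by
  refine LinearMap.ext fun t => ?_
  rw [Module.End.mul_apply, totalProj_apply, totalProj_apply, lof_apply_self]

variable (φ : S.Intertwiners) (hV : Module.rank ℂ V ≤ Cardinal.aleph0)

/-- φ(1, M_i) is an automorphism of the irreducible M_i, hence a scalar c; squaring it gives c² =
α_i(1, 1)c. -/
theorem op_one (i : S.ι) : op φ 1 i = (alpha φ hV i 1 1 : ℂ) • totalProj S i := by
  obtain ⟨c, hc⟩ := Intertwines.exists_scalar hV (φ.intertwines 1 i)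
    (fun n a x => by rw [one_smul]; rfl : S.Intertwines 1 i i (LinearEquiv.refl ℂ _))
  have h1 : op φ 1 i = (c : ℂ) • totalProj S i := LinearMap.ext fun t => by
    rw [op_apply, hc, LinearMap.smul_apply, totalProj_apply]
    rfl
  have h2 := op_mul_op φ hV i 1 1
  rw [one_smul, mul_one, h1, smul_mul_smul_comm, totalProj_mul_totalProj, smul_smul] at h2
  have h3 := smul_left_injective ℂ (totalProj_ne_zero i) h2
  rw [h1, mul_right_cancel₀ c.ne_zero h3]

theorem op_mul_op_of_ne {σ τ : G} {i k : S.ι} (h : i ≠ τ • k) : op φ σ i * op φ τ k = 0 := by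
  refine LinearMap.ext fun t => ?_
  rw [Module.End.mul_apply, op_apply, op_apply, lof_apply_of_ne h.symm, map_zero, map_zero]
  rfl

theorem totalAct_basis (σ : G) (i : S.ι) :
    totalAct φ hV (TwistedAlgebra.basis (cocycle φ hV) (σ, i)) = op φ σ i := by
  rw [totalAct, Module.Basis.constr_basis]

theorem totalAct_idem (i : S.ι) :
    totalAct φ hV (TwistedAlgebra.idem (cocycle φ hV) i) = totalProj S i := by
  rw [TwistedAlgebra.idem, map_smul, totalAct_basis, op_one φ hV, smul_smul]
  change ((((alpha φ hV i 1 1)⁻¹ : ℂˣ) : ℂ) * (alpha φ hV i 1 1 : ℂ)) • totalProj S i = _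
  rw [Units.inv_mul, one_smul]

theorem totalProj_sum : ∑ i, totalProj S i = 1 := by
  refine LinearMap.ext fun t => DFinsupp.ext (β := S.M) fun k => ?_
  rw [LinearMap.sum_apply]
  simp only [totalProj_apply]
  have h : (DirectSum.component ℂ S.ι S.M k) (∑ i, DirectSum.lof ℂ S.ι S.M i (t i)) = t k := by
    rw [map_sum, Finset.sum_eq_single_of_mem k (Finset.mem_univ k)]
    · exact lof_apply_self k (t k)
    · intro i _ hi
      exact lof_apply_of_ne hi (t i)
  exact h

theorem totalAct_one : totalAct φ hV 1 = 1 := by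
  rw [← TwistedAlgebra.sum_idem, map_sum, Finset.sum_congr rfl fun i _ => totalAct_idem φ hV i,
    totalProj_sum]

theorem totalAct_mul (a b : algebra φ hV) :
    totalAct φ hV (a * b) = totalAct φ hV a * totalAct φ hV b := by
  induction a using TwistedAlgebra.induction with
  | h0 => simp
  | hadd a a' h h' => simp [add_mul, h, h']
  | hsmul c a h => simp [h]
  | hb p =>
  induction b using TwistedAlgebra.induction with
  | h0 => simp
  | hadd a a' h h' => simp [mul_add, h, h']
  | hsmul c a h => simp [h]
  | hb q =>
  obtain ⟨σ, i⟩ := p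
  obtain ⟨τ, k⟩ := q
  by_cases h : i = τ • k
  · subst h
    rw [TwistedAlgebra.basis_mul_basis_of_eq _ rfl, map_smul, totalAct_basis, totalAct_basis,
      totalAct_basis, op_mul_op φ hV]
    rfl
  · rw [TwistedAlgebra.basis_mul_basis_of_ne _ h, map_zero, totalAct_basis, totalAct_basis,
      op_mul_op_of_ne φ h]

/-- The action of `A_α(G, S)` on the direct sum, as a homomorphism. -/
def totalActHom : algebra φ hV →+* Module.End ℂ S.Total where
  toFun := totalAct φ hV
  map_one' := totalAct_one φ hV
  map_mul' := totalAct_mul φ hV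
  map_zero' := map_zero _
  map_add' := map_add _

instance totalModule : Module (algebra φ hV) S.Total :=
  Module.compHom S.Total (totalActHom φ hV)

theorem total_smul (a : algebra φ hV) (t : S.Total) : a • t = totalAct φ hV a t := rfl

instance : IsScalarTower ℂ (algebra φ hV) S.Total :=
  ⟨fun c a t => by rw [total_smul, total_smul, map_smul]; rfl⟩

instance : SMulCommClass ℂ (algebra φ hV) S.Total := IsScalarTower.to_smulCommClass

instance : SMulCommClass (algebra φ hV) ℂ S.Total := IsScalarTower.to_smulCommClass'

theorem stabInclusion_smul_lof (i : S.ι) (s : stabAlgebra φ hV i) (x : S.M i) :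
    TwistedAlgebra.stabInclusion (cocycle φ hV) i s • DirectSum.lof ℂ S.ι S.M i x =
      DirectSum.lof ℂ S.ι S.M i (stabAct φ hV i s x) := by
  rw [total_smul]
  induction s using TwistedAlgebra.induction with
  | h0 => simp
  | hadd a a' h h' => simp [h, h']
  | hsmul c a h => simp [h]
  | hb p =>
    obtain ⟨σ, ⟨⟩⟩ := p
    have key : ∀ (k : S.ι) (y : S.M k), k = i → DirectSum.lof ℂ S.ι S.M k y =
        DirectSum.lof ℂ S.ι S.M i
          (DirectSum.component ℂ S.ι S.M i (DirectSum.lof ℂ S.ι S.M k y)) := by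
      rintro k y rfl
      rw [DirectSum.component.lof_self]
    rw [TwistedAlgebra.stabInclusion_basis, totalAct_basis, stabAct, Module.Basis.constr_basis]
    change op φ σ i _ = DirectSum.lof ℂ S.ι S.M i (DirectSum.component ℂ S.ι S.M i (op φ σ i _))
    rw [op_apply, lof_apply_self]
    exact key _ _ (MulAction.mem_stabilizer_iff.mp σ.2)

end TotalModule

/-! ### Density -/

section Density

/-- The action of `V` on the direct sum. -/
def fullMode (S : StableFamily.{u, v} V G) (n : ℚ) (a : V) : Module.End ℂ S.Total :=
  DirectSum.lmap fun i => S.Y i n a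

theorem fullMode_apply (n : ℚ) (a : V) (t : S.Total) (i : S.ι) :
    fullMode S n a t i = S.Y i n a (t i) := rfl

theorem totalMode_eq_fullMode (n : ℤ) (a : fixedPoints G) :
    totalMode S n a = fullMode S n (a : V) := rfl

variable (φ : S.Intertwiners) (hV : Module.rank ℂ V ≤ Cardinal.aleph0)

theorem op_fullMode (σ : G) (i : S.ι) (n : ℚ) (a : V) (t : S.Total) :
    op φ σ i (fullMode S n a t) = fullMode S n (σ • a) (op φ σ i t) := by
  refine DFinsupp.ext fun k => ?_
  rw [fullMode_apply, op_apply, op_apply, fullMode_apply]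
  by_cases h : σ • i = k
  · subst h
    rw [lof_apply_self, lof_apply_self, φ.intertwines]
  · rw [lof_apply_of_ne h, lof_apply_of_ne h, map_zero]

theorem totalAct_totalMode (a : algebra φ hV) (n : ℤ) (b : fixedPoints G) (t : S.Total) :
    totalAct φ hV a (totalMode S n b t) = totalMode S n b (totalAct φ hV a t) := by
  induction a using TwistedAlgebra.induction with
  | h0 => simp
  | hadd a a' h h' => simp [h, h']
  | hsmul c a h => simp [h]
  | hb p =>
    obtain ⟨σ, i⟩ := p
    rw [totalAct_basis, totalMode_eq_fullMode, op_fullMode]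
    congr 2
    exact b.2 σ

/-- `σ`, as the operator `∑ φ(σ, M_i)`. -/
def groupOp (σ : G) : Module.End ℂ S.Total :=
  totalAct φ hV (∑ i, TwistedAlgebra.basis (cocycle φ hV) (σ, i))

/-- The inverse of `groupOp`. -/
def groupOpInv (σ : G) : Module.End ℂ S.Total :=
  totalAct φ hV (∑ i, TwistedAlgebra.basisInv (cocycle φ hV) σ i)

theorem groupOp_mul_groupOpInv (σ : G) : groupOp φ hV σ * groupOpInv φ hV σ = 1 := by
  rw [groupOp, groupOpInv, ← totalAct_mul, ← totalAct_one φ hV, Finset.sum_mul]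
  congr 1
  rw [← TwistedAlgebra.sum_idem,
    ← Equiv.sum_comp (MulAction.toPerm σ) (TwistedAlgebra.idem (cocycle φ hV))]
  refine Finset.sum_congr rfl fun i _ => ?_
  rw [Finset.mul_sum, Finset.sum_eq_single_of_mem i (Finset.mem_univ i),
    TwistedAlgebra.basis_mul_basisInv]
  · rfl
  · intro k _ hk
    exact TwistedAlgebra.basis_mul_basisInv_of_ne _ hk.symm

theorem groupOp_groupOpInv_apply (σ : G) (t : S.Total) :
    groupOp φ hV σ (groupOpInv φ hV σ t) = t :=
  LinearMap.congr_fun (groupOp_mul_groupOpInv φ hV σ) t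

theorem groupOp_fullMode (σ : G) (n : ℚ) (a : V) (t : S.Total) :
    groupOp φ hV σ (fullMode S n a t) = fullMode S n (σ • a) (groupOp φ hV σ t) := by
  simp only [groupOp, map_sum, LinearMap.sum_apply, totalAct_basis, op_fullMode]

/-- The average of `a` over `G`. -/
def groupAverage [Fintype G] (a : V) : fixedPoints G :=
  ⟨(Fintype.card G : ℂ)⁻¹ • ∑ σ : G, σ • a, fun τ => by
    change (τ : Aut V) • ((Fintype.card G : ℂ)⁻¹ • ∑ σ : G, σ • a) = _
    rw [aut_smul_smul, Finset.smul_sum]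
    congr 1
    exact Fintype.sum_equiv (Equiv.mulLeft τ) _ _ fun σ => (mul_smul τ σ a).symm⟩

/-- A vector fixed by G lies in the sector r = 0 of every g ∈ G, so only its integral modes can be
nonzero on any member of the family. -/
theorem fullMode_fixedPoints_eq_zero [Finite G] (a : fixedPoints G) {n : ℚ}
    (hn : ¬ ∃ k : ℤ, n = k) : fullMode S n (a : V) = 0 := by
  refine LinearMap.ext fun t => DFinsupp.ext fun i => ?_
  obtain ⟨g, hg, hY⟩ := S.twisted i
  have hord : 0 < orderOf g := by
    have h := orderOf_pos (⟨g, hg⟩ : G)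
    rwa [← Subgroup.orderOf_coe] at h
  rw [fullMode_apply, hY.support 0 hord]
  · rfl
  · change g • (a : V) = _
    rw [show g • (a : V) = a from a.2 ⟨g, hg⟩]
    simp
  · simpa using hn

/-- Jacobson density over the free algebra on the modes of V, followed by the replacement of a
polynomial in modes by a linear combination of single ones. -/
theorem exists_fullMode_approx [Finite G]
    (T : Module.End ℂ S.Total) (hT : ∀ a t, T (totalAct φ hV a t) = totalAct φ hV a (T t))
    (F : Finset S.Total) :
    ∃ e ∈ Submodule.span ℂ (Set.range fun p : ℚ × V => fullMode S p.1 p.2), ∀ t ∈ F, e t = T t := by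
  classical
  let R := FreeAlgebra ℂ (ℚ × V)
  let D := ⨁ i, FreeModule (S.Y i)
  have hsimple : ∀ i, IsSimpleModule R (FreeModule (S.Y i)) := fun i =>
    (S.irreducible i).isSimpleModule
  -- Components between different members vanish by inequivalence; diagonal ones are scalars by
  -- Schur's lemma.
  have hE : ∀ E : Module.End R D, ∃ c : S.ι → ℂ, ∀ t i, E t i = c i • t i := fun E => by
    let E' : ∀ i k, FreeModule (S.Y k) →ₗ[R] FreeModule (S.Y i) := fun i k =>
      DirectSum.component R S.ι (fun i => FreeModule (S.Y i)) i ∘ₗ E ∘ₗ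
        DirectSum.lof R S.ι (fun i => FreeModule (S.Y i)) k
    have h0 : ∀ i k, k ≠ i → E' i k = 0 := fun i k hk => by
      rcases LinearMap.bijective_or_eq_zero (E' i k) with h | h
      · exact absurd (S.inequivalent k i
          ⟨LinearEquiv.ofBijective (freeHom (E' i k)) h, freeHom_mode (E' i k)⟩) hk
      · exact h
    choose c hc using fun i =>
      (S.irreducible i).schur hV (freeHom (E' i i)) (freeHom_mode (E' i i))
    refine ⟨c, fun t i => ?_⟩
    have ht : E t i = ∑ k, E' i k (t k) := by
      conv_lhs => rw [← DirectSum.sum_univ_of t, map_sum]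
      exact DFinsupp.finsetSum_apply _ _ _
    rw [ht, Finset.sum_eq_single_of_mem i (Finset.mem_univ i)]
    · exact hc i (t i)
    · intro k _ hk
      rw [h0 i k hk, LinearMap.zero_apply]
  have hproj : ∀ i t, T (totalProj S i t) = totalProj S i (T t) := fun i t => by
    rw [← totalAct_idem φ hV, hT]
  -- Such an endomorphism is a combination of the projections to the summands. These are the actions
  -- of the e(M_i) ∈ 𝒜, so `T` commutes with it.
  have hcomp : ∀ (E : Module.End R D) (t : D), T (show D from E t) = E (T t) := fun E t => by
    obtain ⟨c, hc⟩ := hE E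
    have h1 : ∀ t : S.Total, (show D from E t : S.Total) = ∑ i, c i • totalProj S i t := fun t => by
      refine DFinsupp.ext (β := S.M) fun i => (hc t i).trans ?_
      have h2 : (∑ k, c k • totalProj S k t) i = ∑ k, (c k • totalProj S k t) i :=
        DFinsupp.finsetSum_apply _ _ _
      rw [h2, Finset.sum_eq_single_of_mem i (Finset.mem_univ i)]
      · rw [DirectSum.smul_apply, totalProj_apply, lof_apply_self]
        rfl
      · intro k _ hk
        rw [DirectSum.smul_apply, totalProj_apply, lof_apply_of_ne hk, smul_zero]
    refine (congrArg T (h1 t)).trans (Eq.trans ?_ (h1 (T t)).symm)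
    simp only [map_sum, map_smul]
    exact Finset.sum_congr rfl fun i _ => congrArg (c i • ·) (hproj i t)
  let f : Module.End (Module.End R D) D :=
    { toFun := T
      map_add' := map_add T
      map_smul' := hcomp }
  have : IsSemisimpleModule R D :=
    inferInstanceAs (IsSemisimpleModule R (Π₀ i, FreeModule (S.Y i)))
  obtain ⟨r, hr⟩ := jacobson_density f F
  -- All components of all vectors of `F` form one vector of a finite product, so one combination of
  -- single modes serves all of them simultaneously.
  let w : ∀ p : S.ι × F, S.M p.1 := fun p => (p.2 : S.Total) p.1
  have hassoc : IsAssociativeFamily G (piMode fun p : S.ι × F => S.Y p.1) :=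
    IsAssociativeFamily.pi fun p => by
      obtain ⟨g, hg, hY⟩ := S.twisted p.1
      exact hY.isAssociativeFamily hg
  have hmem := (hassoc.isInvariant_modeSpan w).freeAct_mem r w (hassoc.self_mem_modeSpan w)
  have key : ∀ w' ∈ modeSpan (piMode fun p : S.ι × F => S.Y p.1) w,
      ∃ e ∈ Submodule.span ℂ (Set.range fun p : ℚ × V => fullMode S p.1 p.2),
        ∀ p : S.ι × F, w' p = e p.2 p.1 := fun w' hw' => by
    induction hw' using Submodule.span_induction with
    | mem y hy =>
      obtain ⟨⟨n, a⟩, rfl⟩ := hy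
      exact ⟨fullMode S n a, Submodule.subset_span ⟨(n, a), rfl⟩, fun p => rfl⟩
    | zero => exact ⟨0, zero_mem _, fun p => rfl⟩
    | add y z _ _ hy hz =>
      obtain ⟨e, he, hey⟩ := hy
      obtain ⟨e', he', hez⟩ := hz
      exact ⟨e + e', add_mem he he', fun p => by
        rw [Pi.add_apply, hey, hez, LinearMap.add_apply, DirectSum.add_apply]⟩
    | smul c y _ hy =>
      obtain ⟨e, he, hey⟩ := hy
      exact ⟨c • e, Submodule.smul_mem _ c he, fun p => by
        rw [Pi.smul_apply, hey, LinearMap.smul_apply, DirectSum.smul_apply]⟩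
  obtain ⟨e, he, hew⟩ := key _ hmem
  refine ⟨e, he, fun t ht => DFinsupp.ext fun i => ?_⟩
  have h1 := hew (i, ⟨t, ht⟩)
  rw [freeAct_piMode] at h1
  rw [← h1]
  have h2 : T t = (r • (show D from t) : D) := hr t ht
  rw [h2]
  rfl

/-- Conjugation by the operator of σ turns a_n into (σa)_n, so averaging a combination of single
modes replaces each `a` by its mean over G. `T` is unchanged, because the operators of the group
come from 𝒜. -/
theorem exists_totalMode_approx [Finite G]
    (T : Module.End ℂ S.Total) (hT : ∀ a t, T (totalAct φ hV a t) = totalAct φ hV a (T t))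
    (F : Finset S.Total) :
    ∃ e ∈ Submodule.span ℂ (Set.range fun p : ℤ × fixedPoints G => totalMode S p.1 p.2),
      ∀ t ∈ F, e t = T t := by
  classical
  have := Fintype.ofFinite G
  -- For each conjugate of `e` to agree with `T` on `F`, the operator `e` must agree with `T` on all
  -- the translates σ⁻¹F.
  obtain ⟨e, he, heT⟩ := exists_fullMode_approx φ hV T hT
    (Finset.univ.biUnion fun σ : G => F.image (groupOpInv φ hV σ))
  refine ⟨(Fintype.card G : ℂ)⁻¹ • ∑ σ : G, groupOp φ hV σ * e * groupOpInv φ hV σ, ?_, ?_⟩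
  · clear heT
    induction he using Submodule.span_induction with
    | zero => simp
    | add y z _ _ hy hz =>
      simp only [mul_add, add_mul, Finset.sum_add_distrib, smul_add]
      exact add_mem hy hz
    | smul c y _ hy =>
      simp only [mul_smul_comm, smul_mul_assoc, ← Finset.smul_sum]
      rw [smul_comm]
      exact Submodule.smul_mem _ c hy
    | mem y hy =>
      obtain ⟨⟨n, a⟩, rfl⟩ := hy
      have h1 : (Fintype.card G : ℂ)⁻¹ • ∑ σ : G,
          groupOp φ hV σ * fullMode S n a * groupOpInv φ hV σ =
          fullMode S n (groupAverage a : fixedPoints G) := by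
        have h2 : ∀ σ : G, groupOp φ hV σ * fullMode S n a * groupOpInv φ hV σ =
            fullMode S n (σ • a) := fun σ => LinearMap.ext fun t => by
          rw [Module.End.mul_apply, Module.End.mul_apply, groupOp_fullMode,
            groupOp_groupOpInv_apply]
        rw [Finset.sum_congr rfl fun σ _ => h2 σ]
        refine LinearMap.ext fun t => DFinsupp.ext fun i => ?_
        rw [fullMode_apply, groupAverage, LinearMap.map_smul₂, map_sum, LinearMap.sum_apply,
          LinearMap.smul_apply, LinearMap.sum_apply, DirectSum.smul_apply]
        congr 1
        exact DFinsupp.finsetSum_apply _ _ _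
      change (Fintype.card G : ℂ)⁻¹ • ∑ σ : G,
          groupOp φ hV σ * fullMode S n a * groupOpInv φ hV σ ∈ _
      rw [h1]
      by_cases hn : ∃ k : ℤ, n = k
      · obtain ⟨k, rfl⟩ := hn
        exact Submodule.subset_span ⟨(k, groupAverage a), rfl⟩
      · rw [fullMode_fixedPoints_eq_zero _ hn]
        exact zero_mem _
  · intro t ht
    rw [LinearMap.smul_apply, LinearMap.sum_apply]
    have h1 : ∀ σ : G, (groupOp φ hV σ * e * groupOpInv φ hV σ) t = T t := fun σ => by
      rw [Module.End.mul_apply, Module.End.mul_apply, heT]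
      · rw [groupOpInv, hT, ← groupOpInv, groupOp_groupOpInv_apply]
      · exact Finset.mem_biUnion.mpr ⟨σ, Finset.mem_univ σ, Finset.mem_image_of_mem _ ht⟩
    rw [Finset.sum_congr rfl fun σ _ => h1 σ, Finset.sum_const, Finset.card_univ,
      ← Nat.cast_smul_eq_nsmul ℂ, inv_smul_smul₀]
    exact_mod_cast Fintype.card_ne_zero

end Density

end StableFamily

/-! ### Multiplicity spaces of a densely acting family of modes -/

section Multiplicity

theorem map_freeAct {Γ : Type u₂} {V : Type u} [AddCommGroup V] [Module ℂ V]
    {M : Type v} [AddCommGroup M] [Module ℂ M] {M' : Type w} [AddCommGroup M'] [Module ℂ M']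
    {Y : ModeFamily Γ V M} {Y' : ModeFamily Γ V M'} (f : M →ₗ[ℂ] M')
    (hf : ∀ n a x, f (Y n a x) = Y' n a (f x)) (r : FreeAlgebra ℂ (Γ × V)) :
    ∀ x, f (freeAct Y r x) = freeAct Y' r (f x) := by
  induction r using FreeAlgebra.induction with
  | grade0 c =>
    intro x
    rw [AlgHom.commutes, AlgHom.commutes, Module.algebraMap_end_apply,
      Module.algebraMap_end_apply, map_smul]
  | grade1 p =>
    intro x
    rw [freeAct, freeAct, FreeAlgebra.lift_ι_apply, FreeAlgebra.lift_ι_apply, hf]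
  | mul a b ha hb =>
    intro x
    rw [map_mul, map_mul, Module.End.mul_apply, Module.End.mul_apply, ha, hb]
  | add a b ha hb =>
    intro x
    rw [map_add, map_add, LinearMap.add_apply, LinearMap.add_apply, map_add, ha, hb]

theorem IsIrreducibleSubmodule.map {Γ : Type u₂} {V : Type u} [AddCommGroup V] [Module ℂ V]
    {M : Type v} [AddCommGroup M] [Module ℂ M] {M' : Type w} [AddCommGroup M'] [Module ℂ M']
    {Y : ModeFamily Γ V M} {Y' : ModeFamily Γ V M'} (f : M →ₗ[ℂ] M')
    (hf : ∀ n a x, f (Y n a x) = Y' n a (f x)) {P : Submodule ℂ M}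
    (hP : IsIrreducibleSubmodule Y P) (h0 : P.map f ≠ ⊥) :
    IsIrreducibleSubmodule Y' (P.map f) := by
  obtain ⟨hinv, -, hirr⟩ := hP
  refine ⟨?_, h0, fun Q hQ hle => ?_⟩
  · rintro n a _ ⟨x, hx, rfl⟩
    exact ⟨Y n a x, hinv n a x hx, hf n a x⟩
  · have h1 : IsInvariant Y (P ⊓ Q.comap f) := fun n a x hx =>
      ⟨hinv n a x hx.1, by
        rw [SetLike.mem_coe, Submodule.mem_comap, hf]
        exact hQ n a _ hx.2⟩
    rcases hirr _ h1 inf_le_left with h | h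
    · left
      rw [eq_bot_iff]
      intro y hy
      obtain ⟨x, hx, rfl⟩ := hle hy
      have hx0 : x ∈ P ⊓ Q.comap f := ⟨hx, hy⟩
      rw [h, Submodule.mem_bot] at hx0
      rw [hx0, map_zero]
      exact zero_mem _
    · right
      refine le_antisymm hle ?_
      rw [Submodule.map_le_iff_le_comap]
      exact inf_eq_left.mp h

variable {Γ : Type u₂} {U : Type u₃} [AddCommGroup U] [Module ℂ U]
  (A : Type u) [Ring A] {N : Type v} [AddCommGroup N] [Module ℂ N] [Module A N]

/-- On finite subsets of `N`, the modes generate all the operators that commute with `A`. -/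
def ActsDensely (Y : ModeFamily Γ U N) : Prop :=
  ∀ (T : N →ₗ[A] N) (F : Finset N), ∃ r : FreeAlgebra ℂ (Γ × U), ∀ t ∈ F, freeAct Y r t = T t

variable {A} {Y : ModeFamily Γ U N}

/-- For x generating a simple A-submodule, the orbit of x under the commutant of A is an irreducible
subspace for the modes. These orbits span because N is the sum of its simple A-submodules. -/
theorem ActsDensely.isCompletelyReducible [IsSemisimpleRing A] [SMulCommClass A ℂ N]
    (hdense : ActsDensely A Y) (hcomm : ∀ (a : A) n b t, a • Y n b t = Y n b (a • t)) :
    ∃ s : Set (Submodule ℂ N), (∀ P ∈ s, IsIrreducibleSubmodule Y P) ∧ sSup s = ⊤ := by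
  let D : N → Submodule ℂ N := fun x =>
    { carrier := {y | ∃ T : N →ₗ[A] N, T x = y}
      add_mem' := by
        rintro _ _ ⟨T, rfl⟩ ⟨T', rfl⟩
        exact ⟨T + T', rfl⟩
      zero_mem' := ⟨0, rfl⟩
      smul_mem' := by
        rintro c _ ⟨T, rfl⟩
        exact ⟨c • T, rfl⟩ }
  let mode : Γ → U → N →ₗ[A] N := fun n b =>
    { toFun := Y n b
      map_add' := map_add _
      map_smul' := fun a t => (hcomm a n b t).symm }
  refine ⟨D '' {x | x ≠ 0 ∧ IsSimpleModule A (Submodule.span A {x})}, ?_, ?_⟩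
  · rintro _ ⟨x, ⟨hx, hsimple⟩, rfl⟩
    refine ⟨?_, ?_, ?_⟩
    · rintro n b _ ⟨T, rfl⟩
      exact ⟨mode n b ∘ₗ T, rfl⟩
    · intro h
      have h1 : x ∈ D x := ⟨LinearMap.id, rfl⟩
      rw [h] at h1
      exact hx h1
    · intro P hP hle
      rw [or_iff_not_imp_left]
      intro hne
      refine le_antisymm hle ?_
      obtain ⟨y, hy, hy0⟩ := Submodule.exists_mem_ne_zero_of_ne_bot hne
      obtain ⟨T, hT⟩ := hle hy
      rintro _ ⟨T', rfl⟩
      have hxmem : x ∈ Submodule.span A {x} := Submodule.mem_span_singleton_self x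
      -- By simplicity `T` is injective on A x, so T x ↦ T' x extends to an A-endomorphism of N.
      -- Density realizes it at the one vector y = T x.
      have hinj : Function.Injective (T ∘ₗ (Submodule.span A {x}).subtype) := by
        refine LinearMap.injective_of_ne_zero fun h => hy0 ?_
        rw [← hT]
        exact LinearMap.congr_fun h ⟨x, hxmem⟩
      obtain ⟨T'', hT''⟩ := IsSemisimpleModule.extension_property _ hinj
        (T' ∘ₗ (Submodule.span A {x}).subtype)
      obtain ⟨r, hr⟩ := hdense T'' {y}
      have h1 : T'' (T x) = T' x := LinearMap.congr_fun hT'' ⟨x, hxmem⟩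
      rw [← h1, hT, ← hr y (Finset.mem_singleton_self y)]
      exact hP.freeAct_mem r y hy
  · rw [eq_top_iff]
    rintro t -
    have ht : t ∈ sSup {P : Submodule A N | IsSimpleModule A P} := by
      rw [IsSemisimpleModule.sSup_simples_eq_top]
      trivial
    rw [sSup_eq_iSup'] at ht
    refine Submodule.iSup_induction _
      (motive := fun t => t ∈ sSup (D '' {x | x ≠ 0 ∧ IsSimpleModule A (Submodule.span A {x})})) ht
      (fun P x hx => ?_) (zero_mem _) fun x y hx hy => add_mem hx hy
    · by_cases hx0 : x = 0
      · rw [hx0]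
        exact zero_mem _
      · have hspan : Submodule.span A {x} = P := by
          have hP : IsSimpleModule A (P : Submodule A N) := P.2
          refine ((isSimpleModule_iff_isAtom.mp hP).le_iff.mp
            ((Submodule.span_singleton_le_iff_mem x _).mpr hx)).resolve_left fun h => hx0 ?_
          exact Submodule.span_singleton_eq_bot.mp h
        have hDx : D x ∈ D '' {x | x ≠ 0 ∧ IsSimpleModule A (Submodule.span A {x})} :=
          Set.mem_image_of_mem D ⟨hx0, by rw [hspan]; exact P.2⟩
        exact le_sSup hDx ⟨LinearMap.id, rfl⟩

variable {X : Type u₁} [AddCommGroup X] [Module ℂ X]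
  {X' : Type u₁} [AddCommGroup X'] [Module ℂ X']
  {H : Type w} [AddCommGroup H] [Module ℂ H] {YH : ModeFamily Γ U H}
  {H' : Type w} [AddCommGroup H'] [Module ℂ H'] {YH' : ModeFamily Γ U H'}

theorem eval_freeAct {ε : H →ₗ[ℂ] X →ₗ[ℂ] N}
    (hmode : ∀ n b h x, ε (YH n b h) x = Y n b (ε h x)) (r : FreeAlgebra ℂ (Γ × U)) (h : H)
    (x : X) : ε (freeAct YH r h) x = freeAct Y r (ε h x) :=
  map_freeAct (LinearMap.applyₗ x ∘ₗ ε) (fun n b h => hmode n b h x) r h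

/-- As X and X' are finite-dimensional, an element of a multiplicity space is determined by finitely
many vectors of N, which is what density controls. Two spaces are treated with the same `r` for the
sake of the proof of inequivalence. -/
theorem ActsDensely.exists_freeAct_eq (hdense : ActsDensely A Y) [Module.Finite ℂ X]
    [Module.Finite ℂ X'] {ε : H →ₗ[ℂ] X →ₗ[ℂ] N}
    (hinj : Function.Injective ε)
    (hmode : ∀ n b h x, ε (YH n b h) x = Y n b (ε h x)) {ε' : H' →ₗ[ℂ] X' →ₗ[ℂ] N}
    (hinj' : Function.Injective ε')
    (hmode' : ∀ n b h x, ε' (YH' n b h) x = Y n b (ε' h x)) (T : N →ₗ[A] N) {f g : H}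
    (hfg : ∀ x, T (ε f x) = ε g x) {f' g' : H'} (hfg' : ∀ x, T (ε' f' x) = ε' g' x) :
    ∃ r, freeAct YH r f = g ∧ freeAct YH' r f' = g' := by
  classical
  let b := Module.finBasis ℂ X
  let b' := Module.finBasis ℂ X'
  obtain ⟨r, hr⟩ := hdense T
    (Finset.univ.image (fun i => ε f (b i)) ∪ Finset.univ.image (fun i => ε' f' (b' i)))
  refine ⟨r, hinj (b.ext fun i => ?_), hinj' (b'.ext fun i => ?_)⟩
  · rw [eval_freeAct hmode, hr _ (Finset.mem_union_left _
      (Finset.mem_image_of_mem _ (Finset.mem_univ i))), hfg]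
  · rw [eval_freeAct hmode', hr _ (Finset.mem_union_right _
      (Finset.mem_image_of_mem _ (Finset.mem_univ i))), hfg']

variable [Module A X] [Module A X']

/-- The homomorphism `X → N` given by an element of the multiplicity space. -/
def evalHom (ε : H →ₗ[ℂ] X →ₗ[ℂ] N) (hε : ∀ h (a : A) x, ε h (a • x) = a • ε h x) (h : H) :
    X →ₗ[A] N :=
  { ε h with map_smul' := hε h }

theorem evalHom_injective [IsSimpleModule A X] {ε : H →ₗ[ℂ] X →ₗ[ℂ] N}
    (hε : ∀ h (a : A) x, ε h (a • x) = a • ε h x) (hinj : Function.Injective ε) {h : H}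
    (hh : h ≠ 0) : Function.Injective (evalHom ε hε h) :=
  LinearMap.injective_of_ne_zero fun h0 => hh <| hinj <| LinearMap.ext fun x => by
    rw [map_zero]
    exact LinearMap.congr_fun h0 x

/-- A nonzero f embeds the simple X into N, so by semisimplicity any g factors as T ∘ f with T
commuting with A; a polynomial in the modes then carries f to g. -/
theorem ActsDensely.isIrreducibleModule (hdense : ActsDensely A Y) [IsSemisimpleRing A]
    [IsSimpleModule A X] [Module.Finite ℂ X] [Nontrivial H] {ε : H →ₗ[ℂ] X →ₗ[ℂ] N}
    (hε : ∀ h (a : A) x, ε h (a • x) = a • ε h x) (hinj : Function.Injective ε)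
    (hmode : ∀ n b h x, ε (YH n b h) x = Y n b (ε h x)) : IsIrreducibleModule YH := by
  refine ⟨inferInstance, fun P hP => or_iff_not_imp_left.mpr fun hne => ?_⟩
  obtain ⟨f, hf, hf0⟩ := Submodule.exists_mem_ne_zero_of_ne_bot hne
  rw [eq_top_iff]
  rintro g -
  obtain ⟨T, hT⟩ := IsSemisimpleModule.extension_property _ (evalHom_injective hε hinj hf0)
    (evalHom ε hε g)
  have hfg : ∀ x, T (ε f x) = ε g x := fun x => LinearMap.congr_fun hT x
  obtain ⟨r, hr, -⟩ := hdense.exists_freeAct_eq hinj hmode hinj hmode T hfg hfg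
  rw [← hr]
  exact hP.freeAct_mem r f hf

/-- The images of f and of its partner ψ f are non-isomorphic simple submodules, so some
A-endomorphism is the identity on one and zero on the other. Density gives a polynomial in modes
that fixes f and kills ψ f, which no isomorphism allows. -/
theorem ActsDensely.not_isomorphic (hdense : ActsDensely A Y) [IsSemisimpleRing A]
    [IsSimpleModule A X] [Module.Finite ℂ X] [IsSimpleModule A X'] [Module.Finite ℂ X']
    [Nontrivial H] {ε : H →ₗ[ℂ] X →ₗ[ℂ] N}
    (hε : ∀ h (a : A) x, ε h (a • x) = a • ε h x) (hinj : Function.Injective ε)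
    (hmode : ∀ n b h x, ε (YH n b h) x = Y n b (ε h x)) {ε' : H' →ₗ[ℂ] X' →ₗ[ℂ] N}
    (hε' : ∀ h (a : A) x, ε' h (a • x) = a • ε' h x) (hinj' : Function.Injective ε')
    (hmode' : ∀ n b h x, ε' (YH' n b h) x = Y n b (ε' h x)) (hXX' : IsEmpty (X ≃ₗ[A] X')) :
    ¬ Isomorphic YH YH' := by
  rintro ⟨ψ, hψ⟩
  obtain ⟨f, hf⟩ := exists_ne (0 : H)
  have hf' : ψ f ≠ 0 := fun h => hf (ψ.map_eq_zero_iff.mp h)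
  set p := evalHom ε hε f
  set p' := evalHom ε' hε' (ψ f)
  have hp : Function.Injective p := evalHom_injective hε hinj hf
  have hp' : Function.Injective p' := evalHom_injective hε' hinj' hf'
  let e := LinearEquiv.ofInjective p hp
  let e' := LinearEquiv.ofInjective p' hp'
  have hdisj : Disjoint (LinearMap.range p) (LinearMap.range p') := by
    refine IsAtom.disjoint_of_ne (isSimpleModule_iff_isAtom.mp (IsSimpleModule.congr e.symm))
      (isSimpleModule_iff_isAtom.mp (IsSimpleModule.congr e'.symm)) fun h => ?_
    exact hXX'.false (e.trans ((LinearEquiv.ofEq _ _ h).trans e'.symm))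
  have hcop : Function.Injective (p.coprod p') := by
    rw [← LinearMap.ker_eq_bot, LinearMap.ker_coprod_of_disjoint_range _ _ hdisj,
      LinearMap.ker_eq_bot.mpr hp, LinearMap.ker_eq_bot.mpr hp', Submodule.prod_bot]
  obtain ⟨T, hT⟩ := IsSemisimpleModule.extension_property _ hcop (p.coprod 0)
  have h1 : ∀ x, T (ε f x) = ε f x := fun x => by
    have h := LinearMap.congr_fun hT (x, 0)
    rw [LinearMap.comp_apply, LinearMap.coprod_apply, LinearMap.coprod_apply, map_zero,
      LinearMap.zero_apply, add_zero] at h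
    exact h
  have h2 : ∀ x, T (ε' (ψ f) x) = ε' 0 x := fun x => by
    have h := LinearMap.congr_fun hT (0, x)
    rw [LinearMap.comp_apply, LinearMap.coprod_apply, LinearMap.coprod_apply, map_zero,
      LinearMap.zero_apply, add_zero, zero_add] at h
    rw [map_zero, LinearMap.zero_apply]
    exact h
  obtain ⟨r, hr, hr'⟩ := hdense.exists_freeAct_eq hinj hmode hinj' hmode' T h1 h2
  have h3 := map_freeAct ψ.toLinearMap hψ r f
  rw [hr] at h3
  exact hf' (h3.trans hr')

/-- X is isomorphic to a left ideal of A. By faithfulness a nonzero element of this ideal moves some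
t ∈ N, and a ↦ a t restricts to a nonzero homomorphism from X. -/
theorem nontrivial_of_faithful [IsSemisimpleRing A] [IsSimpleModule A X]
    (hfaithful : ∀ a : A, (∀ t : N, a • t = 0) → a = 0) {ε : H →ₗ[ℂ] X →ₗ[ℂ] N}
    (hsurj : ∀ f : X →ₗ[A] N, ∃ h, ∀ x, ε h x = f x) : Nontrivial H := by
  obtain ⟨I, ⟨e⟩⟩ := IsSemisimpleRing.exists_linearEquiv_ideal_of_isSimpleModule A X
  have hnt : Nontrivial X := IsSimpleModule.nontrivial A X
  obtain ⟨x, hx⟩ := exists_ne (0 : X)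
  have hex : (e x : A) ≠ 0 := fun h => hx (e.map_eq_zero_iff.mp (Subtype.ext h))
  obtain ⟨t, ht⟩ : ∃ t : N, (e x : A) • t ≠ 0 := by
    by_contra! h
    exact hex (hfaithful _ h)
  obtain ⟨h, hh⟩ := hsurj (LinearMap.toSpanSingleton A N t ∘ₗ I.subtype ∘ₗ e.toLinearMap)
  refine ⟨h, 0, fun h0 => ht ?_⟩
  have h1 := hh x
  rw [h0, map_zero, LinearMap.zero_apply] at h1
  exact h1.symm

end Multiplicity

namespace StableFamily

variable {V : Type u} [AddCommGroup V] [Module ℂ V] [VertexAlgebra V] {G : Subgroup (Aut V)}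
  {S : StableFamily.{u, v} V G} (φ : S.Intertwiners) (hV : Module.rank ℂ V ≤ Cardinal.aleph0)

/-! ### Faithfulness and density -/

theorem actsDensely_totalMode [Finite G] : ActsDensely (algebra φ hV) (totalMode S) := fun T F => by
  obtain ⟨e, he, heT⟩ := exists_totalMode_approx φ hV (T.restrictScalars ℂ)
    (fun a t => T.map_smul a t) F
  have hle : Submodule.span ℂ (Set.range fun p : ℤ × fixedPoints G => totalMode S p.1 p.2) ≤
      LinearMap.range (freeAct (totalMode S)).toLinearMap := by
    rw [Submodule.span_le]
    rintro _ ⟨p, rfl⟩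
    exact ⟨FreeAlgebra.ι ℂ p, FreeAlgebra.lift_ι_apply _ _⟩
  obtain ⟨r, rfl⟩ := hle he
  exact ⟨r, heT⟩

theorem component_lof_mode (i k : S.ι) (n : ℚ) (a : V) (y : S.M k) :
    DirectSum.component ℂ S.ι S.M i (DirectSum.lof ℂ S.ι S.M k (S.Y k n a y)) =
      S.Y i n a (DirectSum.component ℂ S.ι S.M i (DirectSum.lof ℂ S.ι S.M k y)) := by
  by_cases hk : k = i
  · subst hk
    rw [DirectSum.component.lof_self, DirectSum.component.lof_self]
  · rw [DirectSum.component.of, DirectSum.component.of, dif_neg hk, dif_neg hk, map_zero]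

theorem totalAct_injective [Finite G] (hsimple : IsSimple V) :
    Function.Injective (totalAct φ hV) := by
  classical
  have := Fintype.ofFinite G
  rw [← LinearMap.ker_eq_bot, LinearMap.ker_eq_bot']
  intro a ha
  let c := fun p => (TwistedAlgebra.basis (cocycle φ hV)).repr a p
  -- Only operators with the same source i and the same target k = σ•i can cancel each other. Within
  -- such a block the intertwiners belong to distinct automorphisms of V.
  suffices h : ∀ (i k : S.ι) (σ : {σ : G // σ • i = k}), c (σ, i) = 0 by
    refine (TwistedAlgebra.basis (cocycle φ hV)).ext_elem fun p => ?_
    rw [map_zero]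
    exact h p.2 (p.1 • p.2) ⟨p.1, rfl⟩
  intro i k
  obtain ⟨g, hg, hY⟩ := S.twisted k
  have := (S.irreducible i).1
  let ψ : {σ : G // σ • i = k} → S.M i →ₗ[ℂ] S.M k := fun σ =>
    DirectSum.component ℂ S.ι S.M k ∘ₗ DirectSum.lof ℂ S.ι S.M ((σ : G) • i) ∘ₗ
      (φ.map σ i).toLinearMap
  have hψ : ∀ σ, Function.Injective (ψ σ) := fun σ => by
    have h : ∀ k', k' = k → Function.Injective
        (DirectSum.component ℂ S.ι S.M k ∘ₗ DirectSum.lof ℂ S.ι S.M k') := by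
      rintro k' rfl x y hxy
      rw [LinearMap.comp_apply, LinearMap.comp_apply, DirectSum.component.lof_self,
        DirectSum.component.lof_self] at hxy
      exact hxy
    exact (h _ σ.2).comp (φ.map σ i).injective
  have hint : ∀ (σ : {σ : G // σ • i = k}) n b x, ψ σ (S.Y i n b x) =
      S.Y k n (((σ : G) : Aut V) • b) (ψ σ x) := fun σ n b x => by
    refine Eq.trans ?_ (component_lof_mode k ((σ : G) • i) n ((σ : G) • b) (φ.map σ i x))
    rw [← φ.intertwines]
    rfl
  have hc : ∀ x, ∑ σ : {σ : G // σ • i = k}, c (σ, i) • ψ σ x = 0 := fun x => by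
    have h1 := congrArg (DirectSum.component ℂ S.ι S.M k)
      (LinearMap.congr_fun ha (DirectSum.lof ℂ S.ι S.M i x))
    rw [totalAct, Module.Basis.constr_apply_fintype, LinearMap.zero_apply, map_zero,
      Fintype.sum_prod_type, LinearMap.sum_apply, map_sum] at h1
    have h2 : ∀ σ : G, DirectSum.component ℂ S.ι S.M k
        (∑ l, (c (σ, l) • op φ σ l) (DirectSum.lof ℂ S.ι S.M i x)) =
        c (σ, i) • (DirectSum.lof ℂ S.ι S.M (σ • i) (φ.map σ i x)) k := fun σ => by
      rw [Finset.sum_eq_single_of_mem i (Finset.mem_univ i)]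
      · rw [LinearMap.smul_apply, map_smul, op_apply, lof_apply_self]
        rfl
      · intro l _ hl
        rw [LinearMap.smul_apply, op_apply, lof_apply_of_ne hl.symm, map_zero, map_zero, smul_zero]
    have h3 : ∑ σ : G, c (σ, i) • (DirectSum.lof ℂ S.ι S.M (σ • i) (φ.map σ i x)) k = 0 := by
      rw [← h1]
      refine Finset.sum_congr rfl fun σ _ => ?_
      rw [← h2, LinearMap.sum_apply]
      rfl
    rw [← h3]
    have h4 : ∀ σ : G, σ ∉ Finset.univ.filter (fun σ : G => σ • i = k) →
        c (σ, i) • (DirectSum.lof ℂ S.ι S.M (σ • i) (φ.map σ i x)) k = 0 := fun σ hσ => by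
      rw [lof_apply_of_ne (by simpa using hσ), smul_zero]
    rw [← Finset.sum_subset (Finset.subset_univ _) fun σ _ hσ => h4 σ hσ]
    exact (Finset.sum_subtype (Finset.univ.filter fun σ : G => σ • i = k) (by simp)
      fun σ => c (σ, i) • (DirectSum.lof ℂ S.ι S.M (σ • i) (φ.map σ i x)) k).symm
  exact congrFun (eq_zero_of_sum_smul_intertwiner_eq_zero hsimple hV (hY.isAssociativeFamily hg)
    (s := fun σ : {σ : G // σ • i = k} => ((σ : G) : Aut V))
    (Subtype.val_injective.comp Subtype.val_injective) hψ hint hc)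

theorem eq_zero_of_smul_eq_zero [Finite G] (hsimple : IsSimple V) (a : algebra φ hV)
    (ha : ∀ t : S.Total, a • t = 0) : a = 0 :=
  totalAct_injective φ hV hsimple ((LinearMap.ext ha).trans (map_zero _).symm)

theorem totalMode_lof (i : S.ι) (n : ℤ) (a : fixedPoints G) (x : S.M i) :
    totalMode S n a (DirectSum.lof ℂ S.ι S.M i x) =
      DirectSum.lof ℂ S.ι S.M i (restrictFixed G (S.Y i) n a x) :=
  DirectSum.lmap_lof _ _ _

/-! ### Multiplicity spaces as spaces of homomorphisms -/

section MultEval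

open TwistedAlgebra

variable (i : S.ι) (W : Type u₁) [AddCommGroup W] [Module ℂ W] [Module (stabAlgebra φ hV i) W]

theorem lof_comp_smul (f : multSpace φ hV i W) (s : stabAlgebra φ hV i) (w : W) :
    (DirectSum.lof ℂ S.ι S.M i ∘ₗ f.1) (s • w) =
      stabInclusion (cocycle φ hV) i s • (DirectSum.lof ℂ S.ι S.M i ∘ₗ f.1) w := by
  rw [LinearMap.comp_apply, LinearMap.comp_apply, f.2 s w, stabInclusion_smul_lof]

/-- An element `f` of the multiplicity space gives the homomorphism `d ⊗ w ↦ d f(w)`. -/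
def multHom (f : multSpace φ hV i W) :
    Induced (cocycle φ hV) i W →ₗ[algebra φ hV] S.Total :=
  inducedLift (cocycle φ hV) i (DirectSum.lof ℂ S.ι S.M i ∘ₗ f.1)
    (lof_comp_smul φ hV i W f)

/-- `multHom`, as a linear map. -/
def multEval : multSpace φ hV i W →ₗ[ℂ] Induced (cocycle φ hV) i W →ₗ[ℂ] S.Total where
  toFun f := (multHom φ hV i W f).restrictScalars ℂ
  map_add' f g := LinearMap.ext fun t =>
    inducedLift_add (cocycle φ hV) i (lof_comp_smul φ hV i W f) (lof_comp_smul φ hV i W g)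
      (lof_comp_smul φ hV i W (f + g)) (fun w => (DirectSum.lof ℂ S.ι S.M i).map_add (f.1 w) (g.1 w)) t
  map_smul' c f := LinearMap.ext fun t =>
    inducedLift_smul (cocycle φ hV) i (lof_comp_smul φ hV i W f) (lof_comp_smul φ hV i W (c • f)) c
      (fun w => (DirectSum.lof ℂ S.ι S.M i).map_smul c (f.1 w)) t

theorem multEval_mk (f : multSpace φ hV i W) (d : leftIdeal (cocycle φ hV) i) (w : W) :
    multEval φ hV i W f (inducedMk (cocycle φ hV) i W d w) =
      totalAct φ hV (d : algebra φ hV) (DirectSum.lof ℂ S.ι S.M i (f.1 w)) := rfl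

theorem multEval_leftIdealOne (f : multSpace φ hV i W) (w : W) :
    multEval φ hV i W f (inducedMk (cocycle φ hV) i W (leftIdealOne _ i) w) =
      DirectSum.lof ℂ S.ι S.M i (f.1 w) := by
  refine (multEval_mk φ hV i W f (leftIdealOne _ i) w).trans ?_
  rw [leftIdealOne, totalAct_idem, totalProj_apply, lof_apply_self]

theorem multEval_smul (f : multSpace φ hV i W) (a : algebra φ hV)
    (t : Induced (cocycle φ hV) i W) :
    multEval φ hV i W f (a • t) = a • multEval φ hV i W f t :=
  (multHom φ hV i W f).map_smul a t

theorem idem_smul_total (t : S.Total) :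
    idem (cocycle φ hV) i • t = DirectSum.lof ℂ S.ι S.M i (t i) := by
  rw [total_smul, totalAct_idem, totalProj_apply]

theorem multEval_injective : Function.Injective (multEval φ hV i W) := fun f g h => by
  refine Subtype.ext (LinearMap.ext fun w => lof_injective i ?_)
  exact (multEval_leftIdealOne φ hV i W f w).symm.trans
    ((LinearMap.congr_fun h _).trans (multEval_leftIdealOne φ hV i W g w))

/-- The other half of Frobenius reciprocity: a homomorphism from the induced module is determined on
e(i) ⊗ w, and it maps this into e(i)ℳ = M_i. -/
theorem exists_multEval_eq (F : Induced (cocycle φ hV) i W →ₗ[algebra φ hV] S.Total) :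
    ∃ f, ∀ t, multEval φ hV i W f t = F t := by
  let f : W →ₗ[ℂ] S.M i := DirectSum.component ℂ S.ι S.M i ∘ₗ F.restrictScalars ℂ ∘ₗ
    inducedMk (cocycle φ hV) i W (leftIdealOne _ i)
  have hf : ∀ w, F (inducedMk (cocycle φ hV) i W (leftIdealOne _ i) w) =
      DirectSum.lof ℂ S.ι S.M i (f w) := fun w => by
    rw [inducedMk_eq_smul, map_smul]
    exact (idem_smul_total φ hV i _).trans rfl
  have hmem : f ∈ multSpace φ hV i W := fun s w => lof_injective i <| by
    rw [← hf, ← stabInclusion_smul_inducedMk, map_smul, hf, stabInclusion_smul_lof]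
  refine ⟨⟨f, hmem⟩, fun t => LinearMap.congr_fun
    (induced_hom_ext (cocycle φ hV) i (F := multHom φ hV i W ⟨f, hmem⟩) fun w => ?_) t⟩
  · exact (multEval_leftIdealOne φ hV i W ⟨f, hmem⟩ w).trans (hf w).symm

theorem multEval_mode (n : ℤ) (a : fixedPoints G) (f : multSpace φ hV i W)
    (t : Induced (cocycle φ hV) i W) :
    multEval φ hV i W (multMode φ hV i W n a f) t = totalMode S n a (multEval φ hV i W f t) := by
  induction t using induced_induction with
  | hmk d w =>
    refine (multEval_mk φ hV i W _ d w).trans (Eq.trans ?_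
      (congrArg (totalMode S n a) (multEval_mk φ hV i W f d w)).symm)
    rw [← totalAct_totalMode, totalMode_lof]
    rfl
  | hadd b c hb hc =>
    exact (map_add _ b c).trans ((congrArg₂ (· + ·) hb hc).trans
      ((map_add _ _ _).symm.trans (congrArg (totalMode S n a) (map_add _ b c).symm)))

end MultEval

end StableFamily

/-! ### Weak modules for the fixed point subalgebra -/

theorem IsTwistedModule.isWeakModule_restrictFixed {V : Type u} [AddCommGroup V] [Module ℂ V]
    [VertexAlgebra V] {G : Subgroup (Aut V)} [Finite G] {M : Type v} [AddCommGroup M] [Module ℂ M]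
    {Y : ModeFamily ℚ V M} {g : Aut V} (hg : g ∈ G) (hY : IsTwistedModule g Y) :
    IsWeakModule (restrictFixed G Y) where
  trunc a x := by
    obtain ⟨N, hN⟩ := hY.trunc (a : V) x
    exact ⟨⌈N⌉, fun n hn => hN n (Int.ceil_le.mp hn)⟩
  vac n x := by
    refine (hY.vac n x).trans ?_
    have h : ((n : ℚ) = -1) ↔ n = -1 := by norm_cast
    simp only [h]
  borcherds a b x l m n := by
    have hord : 0 < orderOf g := by
      have h := orderOf_pos (⟨g, hg⟩ : G)
      rwa [← Subgroup.orderOf_coe] at h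
    have ha : (a : V) ∈ twistedSector g 0 := by
      change g • (a : V) = _
      rw [show g • (a : V) = a from a.2 ⟨g, hg⟩]
      simp
    have h := hY.borcherds 0 hord a ha b x l m n ⟨m, by simp⟩
    have hchoose : ∀ i : ℕ, ((Ring.choose (m : ℚ) i : ℚ) : ℂ) = ((Ring.choose m i : ℤ) : ℂ) :=
      fun i => by
        rw [show (m : ℚ) = Int.castRingHom ℚ m from rfl, ← Ring.map_choose]
        exact Rat.cast_intCast _
    have hcast : ∀ (n : ℤ) (q : ℚ) (c : fixedPoints G), (n : ℚ) = q →
        restrictFixed G Y n c = Y q c := by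
      rintro n _ c rfl
      rfl
    refine Eq.trans (finsum_congr fun i => ?_) (h.trans (finsum_congr fun i => ?_))
    · rw [hchoose, hcast (m + n - i) (m + n - i) _ (by push_cast; rfl)]
      rfl
    · rw [hcast (l + m - i) (l + m - i) _ (by push_cast; rfl),
        hcast (n + i) (n + i) _ (by push_cast; rfl),
        hcast (l + n - i) (l + n - i) _ (by push_cast; rfl),
        hcast (m + i) (m + i) _ (by push_cast; rfl)]

namespace StableFamily

variable {V : Type u} [AddCommGroup V] [Module ℂ V] [VertexAlgebra V] {G : Subgroup (Aut V)}
  {S : StableFamily.{u, v} V G} (φ : S.Intertwiners) (hV : Module.rank ℂ V ≤ Cardinal.aleph0)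

theorem isWeakModule_restrictFixed [Finite G] (i : S.ι) :
    IsWeakModule (restrictFixed G (S.Y i)) := by
  obtain ⟨g, hg, hY⟩ := S.twisted i
  exact hY.isWeakModule_restrictFixed hg

section MultMode

variable (i : S.ι) (W : Type u₁) [AddCommGroup W] [Module ℂ W] [Module (stabAlgebra φ hV i) W]

theorem multMode_apply (n : ℤ) (a : fixedPoints G) (f : multSpace φ hV i W) (w : W) :
    (multMode φ hV i W n a f).1 w = restrictFixed G (S.Y i) n a (f.1 w) := rfl

/-- Truncation on the multiplicity space must be uniform in w; finite dimension of W reduces it to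
the finitely many vectors of a basis. -/
theorem exists_multMode_eq_zero [Finite G] [Module.Finite ℂ W] (a : fixedPoints G)
    (f : multSpace φ hV i W) :
    ∃ N : ℤ, ∀ n : ℤ, N ≤ n → multMode φ hV i W n a f = 0 := by
  let b := Module.finBasis ℂ W
  choose N hN using fun j => (isWeakModule_restrictFixed i).trunc a (f.1 (b j))
  obtain ⟨K, hK⟩ := (Finset.univ.image N).exists_le
  exact ⟨K, fun n hn => Subtype.ext (b.ext fun j =>
    hN j n ((hK _ (Finset.mem_image_of_mem N (Finset.mem_univ j))).trans hn))⟩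

theorem isWeakModule_multMode [Finite G] [Module.Finite ℂ W] :
    IsWeakModule (multMode φ hV i W) where
  trunc := exists_multMode_eq_zero φ hV i W
  vac n f := Subtype.ext <| LinearMap.ext fun w => by
    rw [multMode_apply, (isWeakModule_restrictFixed i).vac]
    split_ifs <;> rfl
  borcherds a b f l m n := Subtype.ext <| LinearMap.ext fun w => by
    let L : multSpace φ hV i W →ₗ[ℂ] S.M i := LinearMap.applyₗ w ∘ₗ (multSpace φ hV i W).subtype
    have hfin : ∀ (g : ℕ → multSpace φ hV i W) (N : ℤ),
        (∀ k : ℕ, N ≤ k → g k = 0) → (Function.support g).Finite := fun g N hg => by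
      refine (Set.finite_lt_nat N.toNat).subset fun k hk => ?_
      by_contra hle
      exact hk (hg k (by
        have h : N.toNat ≤ k := not_lt.mp hle
        omega))
    obtain ⟨N₁, h₁⟩ := VertexAlgebra.trunc a b
    obtain ⟨N₂, h₂⟩ := exists_multMode_eq_zero φ hV i W a f
    obtain ⟨N₃, h₃⟩ := exists_multMode_eq_zero φ hV i W b f
    -- The identity is checked after evaluation at w. Evaluation commutes with these sums because
    -- truncation makes them finite already in the multiplicity space.
    change L (∑ᶠ k : ℕ, _) = L (∑ᶠ k : ℕ, _)
    rw [map_finsum L (hfin _ (N₁ - l) fun k hk => ?_),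
      map_finsum L (hfin _ (max (N₃ - n) (N₂ - m)) fun k hk => ?_)]
    · exact (isWeakModule_restrictFixed i).borcherds a b (f.1 w) l m n
    · rw [h₃ _ (by have := le_max_left (N₃ - n) (N₂ - m); omega),
        h₂ _ (by have := le_max_right (N₃ - n) (N₂ - m); omega), map_zero, map_zero, smul_zero,
        sub_zero, smul_zero]
    · rw [h₁ _ (by omega), map_zero, LinearMap.zero_apply, smul_zero]

end MultMode

/-! ### Complete reducibility -/

theorem component_totalMode (i : S.ι) (n : ℤ) (a : fixedPoints G) (t : S.Total) :
    DirectSum.component ℂ S.ι S.M i (totalMode S n a t) =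
      restrictFixed G (S.Y i) n a (DirectSum.component ℂ S.ι S.M i t) := rfl

theorem nonempty_intertwiners (S : StableFamily.{u, v} V G) : Nonempty S.Intertwiners :=
  ⟨{ map := fun σ i => (S.exists_intertwines σ i).choose_spec.choose
     intertwines := fun σ i => (S.exists_intertwines σ i).choose_spec.choose_spec }⟩

/-- ℳ is spanned by irreducible V^G-submodules, and the projection to M_i sends each of them to zero
or to an irreducible submodule. -/
theorem isCompletelyReducible_restrictFixed (hV : Module.rank ℂ V ≤ Cardinal.aleph0) [Finite G]
    (i : S.ι) :
    IsCompletelyReducible (restrictFixed G (S.Y i)) := by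
  obtain ⟨φ⟩ := S.nonempty_intertwiners
  obtain ⟨s, hs, htop⟩ := (actsDensely_totalMode φ hV).isCompletelyReducible
    fun a n b t => totalAct_totalMode φ hV a n b t
  let π := DirectSum.component ℂ S.ι S.M i
  refine isCompletelyReducible_of_sSup_eq_top (s := {Q | ∃ P ∈ s, P.map π = Q ∧ Q ≠ ⊥}) ?_ ?_
  · rintro _ ⟨P, hP, rfl, h0⟩
    exact (hs P hP).map π (component_totalMode i) h0
  · rw [eq_top_iff]
    have hsurj : Submodule.map π ⊤ = ⊤ := by
      rw [Submodule.map_top, LinearMap.range_eq_top]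
      exact fun x => ⟨DirectSum.lof ℂ S.ι S.M i x, lof_apply_self i x⟩
    rw [← hsurj, ← htop, Submodule.map_le_iff_le_comap, sSup_le_iff]
    intro P hP
    rw [← Submodule.map_le_iff_le_comap]
    by_cases h0 : P.map π = ⊥
    · rw [h0]
      exact bot_le
    · exact le_sSup ⟨P, hP, rfl, h0⟩

end StableFamily

/-! ### The decomposition of the direct sum -/

namespace StableFamily

section Decomposition

variable {V : Type u} [AddCommGroup V] [Module ℂ V] [VertexAlgebra V] {G : Subgroup (Aut V)}
  {S : StableFamily.{u, v} V G} (φ : S.Intertwiners) (hV : Module.rank ℂ V ≤ Cardinal.aleph0)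
  {K : Type w} [DecidableEq K] (x : K → S.ι) (W : K → Type u₁) [∀ k, AddCommGroup (W k)] [∀ k, Module ℂ (W k)]
  [∀ k, Module (stabAlgebra φ hV (x k)) (W k)]

/-- The map `(d ⊗ w) ⊗ f ↦ d f(w)`. -/
def decompositionMap :
    (⨁ k, TwistedAlgebra.Induced (cocycle φ hV) (x k) (W k) ⊗[ℂ] multSpace φ hV (x k) (W k)) →ₗ[ℂ]
      S.Total :=
  evalMap (X := fun k => TwistedAlgebra.Induced (cocycle φ hV) (x k) (W k))
    (H := fun k => multSpace φ hV (x k) (W k)) fun k => multEval φ hV (x k) (W k)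

theorem decompositionMap_smul (a : algebra φ hV) (t) :
    decompositionMap φ hV x W (a • t) = totalAct φ hV a (decompositionMap φ hV x W t) := by
  have h := evalMap_smul (X := fun k => TwistedAlgebra.Induced (cocycle φ hV) (x k) (W k))
    (H := fun k => multSpace φ hV (x k) (W k)) (fun k => multEval φ hV (x k) (W k))
    (fun k => multEval_smul φ hV (x k) (W k)) a t
  exact h

theorem decompositionMap_mode (n : ℤ) (a : fixedPoints G) (t) :
    decompositionMap φ hV x W (DirectSum.lmap (fun k =>
      (multMode φ hV (x k) (W k) n a).lTensor
        (TwistedAlgebra.Induced (cocycle φ hV) (x k) (W k))) t) =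
      totalMode S n a (decompositionMap φ hV x W t) := by
  have h := evalMap_lmap_lTensor
    (X := fun k => TwistedAlgebra.Induced (cocycle φ hV) (x k) (W k))
    (H := fun k => multSpace φ hV (x k) (W k)) (fun k => multEval φ hV (x k) (W k))
    (fun k => multMode φ hV (x k) (W k) n a) (totalMode S n a)
    (fun k => multEval_mode φ hV (x k) (W k) n a) t
  exact h

theorem decompositionMap_bijective [Finite G] (hX : IsCompleteIrreducible (algebra φ hV)
      fun k => TwistedAlgebra.Induced (cocycle φ hV) (x k) (W k)) :
    Function.Bijective (decompositionMap φ hV x W) := by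
  have h := evalMap_injective (X := fun k => TwistedAlgebra.Induced (cocycle φ hV) (x k) (W k))
    (H := fun k => multSpace φ hV (x k) (W k)) hX (fun k => multEval φ hV (x k) (W k))
    (fun k => multEval_smul φ hV (x k) (W k)) (fun k => multEval_injective φ hV (x k) (W k))
  have h' := evalMap_surjective (X := fun k => TwistedAlgebra.Induced (cocycle φ hV) (x k) (W k))
    (H := fun k => multSpace φ hV (x k) (W k)) hX (fun k => multEval φ hV (x k) (W k))
    (fun k => multEval_smul φ hV (x k) (W k)) (fun k => exists_multEval_eq φ hV (x k) (W k))
  exact ⟨h, h'⟩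

end Decomposition

end StableFamily

/-! ### The stable family of the twists of a module -/

theorem Isomorphic.refl {Γ : Type u₂} {V : Type u} [AddCommGroup V] [Module ℂ V] {M : Type v}
    [AddCommGroup M] [Module ℂ M] (Y : ModeFamily Γ V M) : Isomorphic Y Y :=
  ⟨LinearEquiv.refl ℂ M, fun _ _ _ => rfl⟩

section Twists

variable {V : Type u} [AddCommGroup V] [Module ℂ V] [VertexAlgebra V] {G : Subgroup (Aut V)}
  {M : Type v} [AddCommGroup M] [Module ℂ M] {Y : ModeFamily ℚ V M}

theorem twistBy_apply (σ : Aut V) (n : ℚ) (a : V) : twistBy σ Y n a = Y n (σ • a) := rfl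

theorem twistBy_twistBy (σ τ : Aut V) : twistBy τ (twistBy σ Y) = twistBy (σ * τ) Y := by
  funext n
  refine LinearMap.ext fun a => ?_
  rw [twistBy_apply, twistBy_apply, twistBy_apply, mul_smul]

theorem restrictFixed_twistBy (σ : G) :
    restrictFixed G (twistBy (σ : Aut V) Y) = restrictFixed G Y := by
  funext n
  refine LinearMap.ext fun a => ?_
  change Y n (σ • (a : V)) = Y n (a : V)
  rw [a.2 σ]

theorem IsIrreducibleModule.twistBy (hY : IsIrreducibleModule Y) (σ : Aut V) :
    IsIrreducibleModule (twistBy σ Y) := by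
  refine ⟨hY.1, fun N hN => hY.2 N fun n a x hx => ?_⟩
  have h := hN n (σ⁻¹ • a) x hx
  rwa [twistBy_apply, smul_inv_smul] at h

/-- Conjugate automorphisms have equal order, and σ maps the sectors of σ⁻¹gσ into those of g with
the same r. -/
theorem IsTwistedModule.twistBy {g : Aut V} (hY : IsTwistedModule g Y) (σ : Aut V) :
    IsTwistedModule (σ⁻¹ * g * σ) (twistBy σ Y) := by
  have hord : orderOf (σ⁻¹ * g * σ) = orderOf g := by
    have h : σ⁻¹ * g * σ = MulAut.conj σ⁻¹ g := by simp
    rw [h]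
    exact MulEquiv.orderOf_eq (MulAut.conj σ⁻¹) g
  have hsector : ∀ (r : ℕ) (a : V), a ∈ twistedSector (σ⁻¹ * g * σ) r →
      σ • a ∈ twistedSector g r := fun r a ha => by
    change (σ⁻¹ * g * σ) • a = _ at ha
    change g • σ • a = _
    rw [hord, mul_smul, mul_smul, inv_smul_eq_iff, aut_smul_smul] at ha
    exact ha
  refine ⟨fun r hr a ha n hn => ?_, fun a x => hY.trunc (σ • a) x, fun n x => ?_,
    fun r hr a ha b x l m n hm => ?_⟩
  · rw [hord] at hr hn
    exact hY.support r hr _ (hsector r a ha) n hn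
  · rw [twistBy_apply, smul_vac]
    exact hY.vac n x
  · rw [hord] at hr hm
    simp only [twistBy_apply, smul_mode]
    exact hY.borcherds r hr _ (hsector r a ha) (σ • b) x l m n hm

variable (G Y) in
/-- Automorphisms with isomorphic twists are identified. -/
def twistSetoid : Setoid G where
  r σ τ := Isomorphic (twistBy (σ : Aut V) Y) (twistBy (τ : Aut V) Y)
  iseqv :=
    { refl := fun _ => Isomorphic.refl _
      symm := by
        rintro σ τ ⟨e, he⟩
        exact ⟨e.symm, fun n a x => by rw [LinearEquiv.symm_apply_eq, he, e.apply_symm_apply]⟩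
      trans := by
        rintro σ τ ρ ⟨e, he⟩ ⟨f, hf⟩
        exact ⟨e.trans f, fun n a x => by
          rw [LinearEquiv.trans_apply, he, hf, LinearEquiv.trans_apply]⟩ }

variable (G) in
/-- The inequivalent twists of an irreducible twisted weak module by the elements of `G`. -/
def twistFamily [Finite G] {g : Aut V} (hg : g ∈ G) (hY : IsTwistedModule g Y)
    (hirr : IsIrreducibleModule Y) : StableFamily.{u, v} V G where
  ι := Quotient (twistSetoid G Y)
  fintype := Fintype.ofFinite _
  M _ := M
  Y i := twistBy ((Quotient.out i : G) : Aut V) Y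
  twisted i := ⟨_, mul_mem (mul_mem (inv_mem (Quotient.out i).2) hg) (Quotient.out i).2,
    hY.twistBy _⟩
  irreducible i := hirr.twistBy _
  inequivalent i k h := Quotient.out_equiv_out.mp h
  stable i σ := by
    refine ⟨Quotient.mk _ (Quotient.out i * σ), ?_⟩
    rw [twistBy_twistBy]
    exact (twistSetoid G Y).symm (Quotient.mk_out (s := twistSetoid G Y) (Quotient.out i * σ))

theorem IsTwistedModule.isCompletelyReducible_restrictFixed [Finite G]
    (hV : Module.rank ℂ V ≤ Cardinal.aleph0) {g : Aut V} (hg : g ∈ G) (hY : IsTwistedModule g Y)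
    (hirr : IsIrreducibleModule Y) : IsCompletelyReducible (restrictFixed G Y) := by
  -- The chosen representative of the class of 1 may be another twist of M, but this is harmless:
  -- V^G does not notice twisting by elements of G.
  have h := (twistFamily G hg hY hirr).isCompletelyReducible_restrictFixed hV (Quotient.mk _ 1)
  change IsCompletelyReducible (restrictFixed G (SchurWeyl.twistBy _ Y)) at h
  rwa [restrictFixed_twistBy] at h

end Twists

end SchurWeyl

end

/-! ### The main theorem -/

open SchurWeyl
open scoped DirectSum TensorProduct

theorem corollary2 {V : Type u} [AddCommGroup V] [Module ℂ V] [VertexAlgebra V]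
    (hsimple : VertexAlgebra.IsSimple V) (hV : Module.rank ℂ V ≤ Cardinal.aleph0)
    (G : Subgroup (VertexAlgebra.Aut V)) [Finite G] :
    (∀ (S : StableFamily.{u, v} V G) (φ : S.Intertwiners)
      -- a representative of each orbit
      (rep : MulAction.orbitRel.Quotient G S.ι → S.ι) (_ : ∀ j, rep j ∈ j.orbit)
      -- the irreducible modules of the twisted group algebras of the stabilizers
      (Λ : MulAction.orbitRel.Quotient G S.ι → Type w) (W : ∀ j, Λ j → Type u₁)
      [∀ j l, AddCommGroup (W j l)] [∀ j l, Module ℂ (W j l)]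
      [∀ j l, Module (StableFamily.stabAlgebra φ hV (rep j)) (W j l)]
      [∀ j l, IsScalarTower ℂ (StableFamily.stabAlgebra φ hV (rep j)) (W j l)]
      (_ : ∀ j, IsCompleteIrreducible (StableFamily.stabAlgebra φ hV (rep j)) (W j)),
      -- the induced modules are the irreducible modules of the algebra
      IsCompleteIrreducible (StableFamily.algebra φ hV)
        (fun p : Σ j, Λ j =>
          TwistedAlgebra.Induced (StableFamily.cocycle φ hV) (rep p.1) (W p.1 p.2)) ∧
      -- the decomposition
      (∃ Θ : (⨁ p : Σ j, Λ j,
            TwistedAlgebra.Induced (StableFamily.cocycle φ hV) (rep p.1) (W p.1 p.2) ⊗[ℂ]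
              StableFamily.multSpace φ hV (rep p.1) (W p.1 p.2)) ≃ₗ[ℂ] S.Total,
        (∀ (x : StableFamily.algebra φ hV) t,
          Θ (x • t) = StableFamily.totalAct φ hV x (Θ t)) ∧
        ∀ (n : ℤ) (a : VertexAlgebra.fixedPoints G) t,
          Θ (DirectSum.lmap (fun p : Σ j, Λ j =>
            (StableFamily.multMode φ hV (rep p.1) (W p.1 p.2) n a).lTensor
              (TwistedAlgebra.Induced (StableFamily.cocycle φ hV) (rep p.1) (W p.1 p.2))) t) =
            StableFamily.totalMode S n a (Θ t)) ∧
      -- the multiplicity spaces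
      (∀ p : Σ j, Λ j,
        IsWeakModule (StableFamily.multMode φ hV (rep p.1) (W p.1 p.2)) ∧
        Nontrivial (StableFamily.multSpace φ hV (rep p.1) (W p.1 p.2)) ∧
        IsIrreducibleModule (StableFamily.multMode φ hV (rep p.1) (W p.1 p.2))) ∧
      (∀ p q : Σ j, Λ j,
        Isomorphic (StableFamily.multMode φ hV (rep p.1) (W p.1 p.2))
          (StableFamily.multMode φ hV (rep q.1) (W q.1 q.2)) ↔ p = q)) ∧
    (∀ g ∈ G, ∀ (M : Type v) [AddCommGroup M] [Module ℂ M] (Y : ModeFamily ℚ V M),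
      IsTwistedModule g Y → IsIrreducibleModule Y →
        IsWeakModule (restrictFixed G Y) ∧ IsCompletelyReducible (restrictFixed G Y)) := by
  refine ⟨fun S φ rep hrep Λ W _ _ _ _ hW => ?_, fun g hg M _ _ Y hY hirr =>
    ⟨hY.isWeakModule_restrictFixed hg, hY.isCompletelyReducible_restrictFixed hV hg hirr⟩⟩
  classical
  have hX := TwistedAlgebra.isCompleteIrreducible_induced (StableFamily.cocycle φ hV) rep hrep hW
  have hsimpleX := hX.simple
  have hsimpleW := fun j => (hW j).simple
  -- Simple modules are finitely generated, hence finite-dimensional over these finite-dimensional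
  -- algebras; truncation and density both need this.
  have hfinW : ∀ j l, Module.Finite ℂ (W j l) := fun j l =>
    have : Module.Finite (StableFamily.stabAlgebra φ hV (rep j)) (W j l) := inferInstance
    Module.Finite.trans (StableFamily.stabAlgebra φ hV (rep j)) (W j l)
  have hfinX : ∀ p : Σ j, Λ j, Module.Finite ℂ
      (TwistedAlgebra.Induced (StableFamily.cocycle φ hV) (rep p.1) (W p.1 p.2)) := fun p =>
    have : Module.Finite (StableFamily.algebra φ hV)
      (TwistedAlgebra.Induced (StableFamily.cocycle φ hV) (rep p.1) (W p.1 p.2)) := inferInstance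
    Module.Finite.trans (StableFamily.algebra φ hV) _
  have hsmul := fun p : Σ j, Λ j => StableFamily.multEval_smul φ hV (rep p.1) (W p.1 p.2)
  have hinj := fun p : Σ j, Λ j => StableFamily.multEval_injective φ hV (rep p.1) (W p.1 p.2)
  have hmode := fun p : Σ j, Λ j => StableFamily.multEval_mode φ hV (rep p.1) (W p.1 p.2)
  have hdense := StableFamily.actsDensely_totalMode φ hV
  have hnontrivial : ∀ p : Σ j, Λ j,
      Nontrivial (StableFamily.multSpace φ hV (rep p.1) (W p.1 p.2)) := fun p =>
    nontrivial_of_faithful (StableFamily.eq_zero_of_smul_eq_zero φ hV hsimple)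
      (StableFamily.exists_multEval_eq φ hV (rep p.1) (W p.1 p.2))
  have hbij := StableFamily.decompositionMap_bijective φ hV (fun p : Σ j, Λ j => rep p.1)
    (fun p => W p.1 p.2) hX
  refine ⟨hX, ⟨LinearEquiv.ofBijective _ hbij, ?_, ?_⟩, fun p => ⟨?_, hnontrivial p, ?_⟩,
    fun p q => ⟨fun h => ?_, ?_⟩⟩
  · exact StableFamily.decompositionMap_smul φ hV _ _
  · exact StableFamily.decompositionMap_mode φ hV _ _
  · exact StableFamily.isWeakModule_multMode φ hV _ _
  · exact hdense.isIrreducibleModule (hsmul p) (hinj p) (hmode p)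
  · by_contra hpq
    exact hdense.not_isomorphic (hsmul p) (hinj p) (hmode p) (hsmul q) (hinj q) (hmode q)
      ⟨fun e => hpq (hX.inequivalent p q ⟨e⟩)⟩ h
  · rintro rfl
    exact Isomorphic.refl _
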